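/- All graphs and posets are finite. The cover graph of a poset $P$ is the graph on the ground set of $P$ in which two elements are adjacent if and only if one of them covers the other. The dimension $\dim(P)$ is the least cardinality of a nonempty family of linear orders on the ground set of $P$ whose intersection is the order of $P$. Let $\mathrm{Inc}(P)$ be the set of ordered pairs $(a,b)$ of incomparable elements of $P$. A min-max pair of $P$ is a pair $(a,b)\in\mathrm{Inc}(P)$ with $a$ minimal and $b$ maximal in $P$. A set $I\subseteq \mathrm{Inc}(P)$ is reversible if some linear extension $L$ of $P$ satisfies $b<a$ in $L$ for all $(a,b)\in I$, and $\dim_P(I)$ is the least integer $d$ such that $I$ can be partitioned into $d$ (possibly empty) reversible sets. A planar drawing of a graph represents the vertices by distinct points of the plane and the edges by polygonal arcs (simple arcs made of finitely many line segments) joining their ends, such that no edge passes through a vertex other than its ends and two edges meet only in common ends. Its exterior face is the unbounded component of the complement of the drawing, and a vertex lies on the exterior face if it is in the closure of that face. A planar drawing is $1$-outerplanar if all vertices lie on the exterior face; for $k\ge 2$ it is $k$-outerplanar if removing all vertices on the exterior face, with their incident edges, yields a $(k-1)$-outerplanar drawing. A graph is $k$-outerplanar if it admits a $k$-outerplanar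 drawing. A set $I\subseteq\mathrm{Inc}(P)$ is doubly exposed if there are a planar drawing of the cover graph of $P$ and two elements $x_0,y_0$ of $P$ on its exterior face such that $x_0\le b$ and $a\le y_0$ in $P$ for every $(a,b)\in I$. **Lemma.** Let $k\ge 1$, and let $P$ be a poset with a $k$-outerplanar cover graph such that $\dim(P)\ge 3$. Then there exist a poset $P'$ with a $(k+1)$-outerplanar cover graph and a doubly exposed set $I$ of min-max pairs of $P'$ such that \[ \dim(P)\le 4k\cdot \dim_{P'}(I). \] -/

import Mathlib

universe u

/-! ### Order dimension -/

namespace PosetDim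

variable (P : Type*) [PartialOrder P]

/-- `r` (read as a relation `≤`) is a linear extension of the poset `P`: a linear order on the
ground set of `P` that contains the order of `P`. -/
def IsLinearExtension (r : P → P → Prop) : Prop :=
  IsLinearOrder P r ∧ ∀ x y : P, x ≤ y → r x y

/-- `R` is a nonempty family of linear extensions of `P` whose intersection is the order of `P`. -/
def IsRealizer (R : Finset (P → P → Prop)) : Prop :=
  R.Nonempty ∧ (∀ r ∈ R, IsLinearExtension P r) ∧ ∀ x y : P, x ≤ y ↔ ∀ r ∈ R, r x y

/-- The dimension of a finite poset: the least cardinality of a realizer. (For a finite poset a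
finite realizer exists, so this is the minimum of a nonempty set.) -/
noncomputable def dim : ℕ :=
  sInf {d : ℕ | ∃ R : Finset (P → P → Prop), IsRealizer P R ∧ R.card = d}

/-- The set of ordered pairs of incomparable elements of `P`. -/
def Inc : Set (P × P) :=
  {p | ¬ p.1 ≤ p.2 ∧ ¬ p.2 ≤ p.1}

/-- The set of min-max pairs: incomparable pairs `(a, b)` with `a` minimal and `b` maximal. -/
def MinMaxPairs : Set (P × P) :=
  {p | p ∈ Inc P ∧ IsMin p.1 ∧ IsMax p.2}

variable {P}

/-- A set of pairs is reversible if a single linear extension `r` of `P` reverses all its pairs,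
i.e. puts `b` (strictly) below `a` for each of its pairs `(a, b)`. -/
def Reversible (I : Set (P × P)) : Prop :=
  ∃ r : P → P → Prop, IsLinearExtension P r ∧ ∀ p ∈ I, r p.2 p.1 ∧ p.2 ≠ p.1

/-- `dim_P(I)`: the least `d` such that `I` can be partitioned into `d` reversible sets.
(Used for sets `I` of incomparable pairs of a finite poset, where such a `d` exists. Allowing empty
parts does not change the minimum.) -/
noncomputable def dimOf (I : Set (P × P)) : ℕ :=
  sInf {d : ℕ | ∃ S : Fin d → Set (P × P),
    (∀ i j, i ≠ j → Disjoint (S i) (S j)) ∧ (⋃ i, S i) = I ∧ ∀ i, Reversible (S i)}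

end PosetDim

/-! ### Planar drawings

The Euclidean plane is identified with `ℂ`. -/

/-- `A` is a (polygonal) arc with ends `p` and `q`: a union of finitely many straight line segments
which is the image of an injective path from `p` to `q`. -/
def IsPolygonalArc (A : Set ℂ) (p q : ℂ) : Prop :=
  (∃ γ : Path p q, Function.Injective γ ∧ Set.range γ = A) ∧
    ∃ s : Set (ℂ × ℂ), s.Finite ∧ A = ⋃ e ∈ s, segment ℝ e.1 e.2

/-- A planar (crossing-free) drawing of a graph `G`: vertices are distinct points, every edge is an
arc joining its two ends and passing through no other vertex, and two distinct edges meet only in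
vertices (hence only in common ends). The value of `arc` outside the edge set is irrelevant. -/
structure PlanarDrawing {V : Type*} (G : SimpleGraph V) where
  /-- the point representing a vertex -/
  pt : V → ℂ
  /-- the set of points representing an edge -/
  arc : Sym2 V → Set ℂ
  pt_injective : Function.Injective pt
  isArc : ∀ u v : V, G.Adj u v → IsPolygonalArc (arc s(u, v)) (pt u) (pt v)
  mem_of_pt_mem_arc : ∀ e ∈ G.edgeSet, ∀ w : V, pt w ∈ arc e → w ∈ e
  arc_inter_arc : ∀ e ∈ G.edgeSet, ∀ f ∈ G.edgeSet, e ≠ f → arc e ∩ arc f ⊆ Set.range pt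

namespace PlanarDrawing

variable {V : Type*} {G : SimpleGraph V} (D : PlanarDrawing G)

/-- The point set of the induced drawing of the subgraph of `G` induced by `W`: the vertices in `W`
together with all edges having both ends in `W`. -/
def support (W : Set V) : Set ℂ :=
  D.pt '' W ∪ ⋃ e ∈ {e : Sym2 V | e ∈ G.edgeSet ∧ ∀ v ∈ e, v ∈ W}, D.arc e

/-- The exterior face of the induced drawing of `G[W]`: the unbounded component of the complement
of the drawing. -/
def exteriorFace (W : Set V) : Set ℂ :=
  {z | z ∈ (D.support W)ᶜ ∧ ¬ Bornology.IsBounded (connectedComponentIn (D.support W)ᶜ z)}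

/-- The set of vertices of `G[W]` that lie on (the boundary of) the exterior face of the induced
drawing of `G[W]`. -/
def exteriorVertices (W : Set V) : Set V :=
  {v | v ∈ W ∧ D.pt v ∈ closure (D.exteriorFace W)}

/-- The induced drawing of `G[W]` is `k`-outerplanar: removing `k` times all vertices on
the current exterior face leaves no vertex. In particular, it is `1`-outerplanar iff all vertices of
`G[W]` lie on the exterior face, and it is `(k+1)`-outerplanar iff removing the vertices on the
exterior face yields a `k`-outerplanar drawing. -/
def IsOuterplanarOn : ℕ → Set V → Prop
  | 0, W => W = ∅
  | k + 1, W => IsOuterplanarOn k (W \ D.exteriorVertices W)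

/-- The drawing of the whole graph `G` is `k`-outerplanar. -/
def IsOuterplanar (k : ℕ) : Prop :=
  D.IsOuterplanarOn k Set.univ

end PlanarDrawing

/-- A graph is `k`-outerplanar if it admits a `k`-outerplanar drawing. -/
def IsKOuterplanar {V : Type*} (k : ℕ) (G : SimpleGraph V) : Prop :=
  ∃ D : PlanarDrawing G, D.IsOuterplanar k

/-- A set `I` of incomparable pairs of `P` is doubly exposed if, for some planar drawing of the
cover graph of `P`, there are vertices `x₀`, `y₀` on the exterior face with `x₀ ≤ b` and `a ≤ y₀`
for all `(a, b) ∈ I`. (`SimpleGraph.hasse P` is the cover graph of `P`.) -/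
def IsDoublyExposed {P : Type*} [PartialOrder P] (I : Set (P × P)) : Prop :=
  I ⊆ PosetDim.Inc P ∧
    ∃ (D : PlanarDrawing (SimpleGraph.hasse P)) (x₀ y₀ : P),
      x₀ ∈ D.exteriorVertices Set.univ ∧ y₀ ∈ D.exteriorVertices Set.univ ∧
        ∀ p ∈ I, x₀ ≤ p.2 ∧ p.1 ≤ y₀

/-! A set of incomparable pairs is reversible exactly when it has no alternating cycle, that is, no
cyclic sequence of pairs in which the first entry of each pair lies below the second entry of the
next (`noAlt_of_reversible`, `reversible_of_noAlt`). So every bound is about colouring pairs without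
monochromatic alternating cycles. Two principles keep the number of colours small. A function that
is monotone along alternation is constant on cycles, so its fibres may share colours
(`AltColorable.of_fibres`). Pairs without predecessor or successor may be ignored
(`AltColorable.of_inner`).

Let `M` bound the dimension of all doubly exposed sets of min-max pairs in posets with a
(k+1)-outerplanar cover graph. It suffices to colour the incomparable pairs of `P` with 4kM colours.
Take a k-outerplanar drawing. For a pair (a, b), compare the outermost layer met by the up-set of a
with the outermost layer met by the down-set of b. Up to duality (a factor 2) the second is at least
as far out. Fix the first (a factor k), and let Q consist of this layer and everything deeper. Then
the up-set of a stays in Q and meets the exterior face of Q. If b lies in Q, then b is above an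
exterior vertex of Q by a chain inside Q.

In each relevant component of the graph on Q choose an exterior vertex e, and unfold from e: take
the up-set of e, its down-closure, the up-closure of that, and so on. Comparing the level at which a
appears in a down-set with the level at which b appears in an up-set splits the pairs in two (the
last factor 2). In each half the level is monotone along alternation, so one level may be treated at
a time (`altColorable_of_downLevel_lt`, `altColorable_of_upLevel_le`). At one level, up to duality,
there is a connected up-set X of Q that contains e, has an element above each a, and contains no
entry of a relevant pair. Redirecting the edges inside X towards e puts e above each a and leaves
the comparabilities outside X unchanged. A new element drawn in the exterior face and placed below
the exterior vertices outside X lies below each b. This makes the pairs doubly exposed at the cost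
of one more layer (`altColorable_of_upset`). Attaching leaves then turns them into min-max pairs
(`Exposed.altColorable`).

The topological task is to draw the new star while e stays on the exterior face. It rests on one
fact: cutting a connected open set along a segment with a free end inside does not disconnect it
(`isPreconnected_diff_segment`). A tree joining e, infinity and the new point is reserved first
(`exists_tripod`), and the star is drawn in its complement (`exists_star`). -/

open Relation

/-- `p` precedes `q` if both lie in `J` and the first entry of `p` is below the second entry of
`q`. Cycles of this relation are the alternating cycles of `J`. -/
def altRel {α : Type*} (le : α → α → Prop) (J : Set (α × α)) (p q : α × α) : Prop :=
  p ∈ J ∧ q ∈ J ∧ le p.1 q.2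

/-- `J` contains no alternating cycle. -/
def NoAlt {α : Type*} (le : α → α → Prop) (J : Set (α × α)) : Prop :=
  ∀ p, ¬ TransGen (altRel le J) p p

/-- `J` can be coloured with `n` colours so that no colour class has an alternating cycle. -/
def AltColorable {α : Type*} (le : α → α → Prop) (J : Set (α × α)) (n : ℕ) : Prop :=
  ∃ c : α × α → ℕ, (∀ p ∈ J, c p < n) ∧ ∀ i, NoAlt le {p | p ∈ J ∧ c p = i}

/-! ### Colourings without monochromatic alternating cycles -/

section Alt
variable {α β : Type*} {le : α → α → Prop} {le' : β → β → Prop} {J J' : Set (α × α)}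

/-- A map of pairs that preserves alternation sends cycles to cycles. This is how colourings are
pulled back from auxiliary posets. -/
theorem NoAlt.comap {J' : Set (β × β)} (h : NoAlt le' J') (φ : α × α → β × β)
    (hφ : ∀ p ∈ J, φ p ∈ J') (hle : ∀ p ∈ J, ∀ q ∈ J, le p.1 q.2 → le' (φ p).1 (φ q).2) :
    NoAlt le J := by
  intro p hp
  exact h (φ p) (hp.lift φ fun a b hab => ⟨hφ a hab.1, hφ b hab.2.1, hle a hab.1 b hab.2.1 hab.2.2⟩)

theorem NoAlt.mono (h : NoAlt le J') (hJ : J ⊆ J') : NoAlt le J :=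
  h.comap id (fun _ hp => hJ hp) fun _ _ _ _ h => h

theorem AltColorable.comap {J' : Set (β × β)} {n : ℕ} (h : AltColorable le' J' n)
    (φ : α × α → β × β) (hφ : ∀ p ∈ J, φ p ∈ J')
    (hle : ∀ p ∈ J, ∀ q ∈ J, le p.1 q.2 → le' (φ p).1 (φ q).2) :
    AltColorable le J n := by
  obtain ⟨c, hc, hn⟩ := h
  refine ⟨fun p => c (φ p), fun p hp => hc _ (hφ p hp), fun i => ?_⟩
  exact (hn i).comap φ (fun p hp => ⟨hφ p hp.1, hp.2⟩) fun p hp q hq => hle p hp.1 q hq.1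

theorem AltColorable.mono {n : ℕ} (h : AltColorable le J' n) (hJ : J ⊆ J') :
    AltColorable le J n :=
  h.comap id (fun _ hp => hJ hp) fun _ _ _ _ h => h

theorem NoAlt.swap (h : NoAlt le J) : NoAlt (flip le) (Prod.swap ⁻¹' J) := by
  intro p hp
  refine h p.swap ?_
  have := (transGen_swap (r := altRel (flip le) (Prod.swap ⁻¹' J)) (a := p) (b := p)).2 hp
  exact this.lift Prod.swap fun a b hab => ⟨hab.2.1, hab.1, hab.2.2⟩

theorem AltColorable.swap {n : ℕ} (h : AltColorable le J n) :
    AltColorable (flip le) (Prod.swap ⁻¹' J) n := by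
  obtain ⟨c, hc, hn⟩ := h
  exact ⟨fun p => c p.swap, fun p hp => hc _ hp, fun i => (hn i).swap⟩

theorem AltColorable.union {m n : ℕ} (h : AltColorable le J m) (h' : AltColorable le J' n) :
    AltColorable le (J ∪ J') (m + n) := by
  classical
  obtain ⟨c, hc, hn⟩ := h
  obtain ⟨c', hc', hn'⟩ := h'
  refine ⟨fun p => if p ∈ J then c p else m + c' p, fun p hp => ?_, fun i => ?_⟩
  · dsimp only
    split_ifs with hJ
    · exact (hc p hJ).trans_le (Nat.le_add_right _ _)
    · have := hc' p (hp.resolve_left hJ)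
      omega
  · by_cases hi : i < m
    · refine (hn i).mono fun p hp => ?_
      obtain ⟨hp, hpi⟩ := hp
      dsimp only at hpi
      split_ifs at hpi with hJ
      · exact ⟨hJ, hpi⟩
      · omega
    · refine (hn' (i - m)).mono fun p hp => ?_
      obtain ⟨hp, hpi⟩ := hp
      dsimp only at hpi
      split_ifs at hpi with hJ
      · have := hc p hJ
        omega
      · exact ⟨hp.resolve_left hJ, by omega⟩

theorem AltColorable.iUnion {n : ℕ} (F : ℕ → Set (α × α)) :
    ∀ k : ℕ, (∀ i < k, AltColorable le (F i) n) → AltColorable le (⋃ i < k, F i) (k * n)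
  | 0, _ => ⟨fun _ => 0, by simp, fun i => by
      intro p hp
      obtain ⟨q, hq, -⟩ := TransGen.head'_iff.1 hp
      simpa using hq.1.1⟩
  | k + 1, h => by
      have := (AltColorable.iUnion F k fun i hi => h i (by omega)).union (h k (by omega))
      rw [← Nat.succ_mul] at this
      refine this.mono fun p hp => ?_
      simp only [Set.mem_iUnion] at hp
      obtain ⟨i, hi, hp⟩ := hp
      rcases Nat.lt_succ_iff_lt_or_eq.1 hi with hi | rfl
      · exact Or.inl (Set.mem_iUnion₂.2 ⟨i, hi, hp⟩)
      · exact Or.inr hp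

/-- A monotone function along the alternation relation is constant on alternating cycles. -/
theorem NoAlt.of_fibres {ι : Type*} [PartialOrder ι] (g : α × α → ι)
    (hg : ∀ p ∈ J, ∀ q ∈ J, le p.1 q.2 → g p ≤ g q)
    (h : ∀ t, NoAlt le {p | p ∈ J ∧ g p = t}) : NoAlt le J := by
  intro p hp
  have hle : ∀ x y, TransGen (altRel le J) x y → g x ≤ g y := fun x y hxy => by
    induction hxy with
    | single h => exact hg _ h.1 _ h.2.1 h.2.2
    | tail _ h ih => exact ih.trans (hg _ h.1 _ h.2.1 h.2.2)
  refine h (g p) p ?_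
  have key : ∀ y, TransGen (altRel le J) p y → ReflTransGen (altRel le J) y p →
      TransGen (altRel le {q | q ∈ J ∧ g q = g p}) p y := by
    intro y hy
    induction hy with
    | @single y h =>
      intro hyp
      have h1 : g p ≤ g y := hg _ h.1 _ h.2.1 h.2.2
      have h2 : g y ≤ g p := by
        rcases reflTransGen_iff_eq_or_transGen.1 hyp with h | h
        · rw [h]
        · exact hle _ _ h
      exact .single ⟨⟨h.1, rfl⟩, ⟨h.2.1, le_antisymm h2 h1⟩, h.2.2⟩
    | @tail b y hb h ih =>
      intro hyp
      have hbp : ReflTransGen (altRel le J) b p := .head h hyp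
      have h1 : g p ≤ g b := hle _ _ hb
      have h2 : g b ≤ g y := hg _ h.1 _ h.2.1 h.2.2
      have h3 : g y ≤ g p := by
        rcases reflTransGen_iff_eq_or_transGen.1 hyp with h | h
        · rw [h]
        · exact hle _ _ h
      exact .tail (ih hbp) ⟨⟨h.1, le_antisymm (h2.trans h3) h1⟩,
        ⟨h.2.1, le_antisymm h3 (h1.trans h2)⟩, h.2.2⟩
  exact key p hp .refl

/-- All fibres use the same `n` colours: a cycle inside one colour class stays in a single fibre.
Hence the numbers of components and of unfolding levels do not enter the bound. -/
theorem AltColorable.of_fibres {ι : Type*} [PartialOrder ι] {n : ℕ} (g : α × α → ι)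
    (hg : ∀ p ∈ J, ∀ q ∈ J, le p.1 q.2 → g p ≤ g q)
    (h : ∀ t, AltColorable le {p | p ∈ J ∧ g p = t} n) : AltColorable le J n := by
  choose c hc hn using h
  refine ⟨fun p => c (g p) p, fun p hp => hc _ p ⟨hp, rfl⟩, fun i => ?_⟩
  refine NoAlt.of_fibres g (fun p hp q hq => hg p hp.1 q hq.1) fun t => ?_
  refine (hn t i).mono ?_
  rintro p ⟨⟨hp, hpi⟩, rfl⟩
  exact ⟨⟨hp, rfl⟩, hpi⟩

/-- Pairs without predecessor or without successor lie on no alternating cycle. -/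
theorem NoAlt.of_inner (h : NoAlt le {p | p ∈ J ∧ (∃ q ∈ J, le q.1 p.2) ∧ ∃ q ∈ J, le p.1 q.2}) :
    NoAlt le J := by
  set J₀ := {p | p ∈ J ∧ (∃ q ∈ J, le q.1 p.2) ∧ ∃ q ∈ J, le p.1 q.2}
  intro p hp
  have pred : ∀ x y, TransGen (altRel le J) x y → ∃ q ∈ J, le q.1 y.2 := fun x y hxy => by
    obtain ⟨z, -, hz⟩ := TransGen.tail'_iff.1 hxy
    exact ⟨z, hz.1, hz.2.2⟩
  have succ : ∀ x y, TransGen (altRel le J) x y → ∃ q ∈ J, le x.1 q.2 := fun x y hxy => by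
    obtain ⟨z, hz, -⟩ := TransGen.head'_iff.1 hxy
    exact ⟨z, hz.2.1, hz.2.2⟩
  have key : ∀ y, TransGen (altRel le J) p y → ReflTransGen (altRel le J) y p →
      TransGen (altRel le J₀) p y := by
    intro y hy
    induction hy with
    | @single y h =>
      intro hyp
      refine .single ⟨⟨h.1, pred _ _ hp, succ _ _ hp⟩, ⟨h.2.1, ⟨p, h.1, h.2.2⟩, ?_⟩, h.2.2⟩
      exact succ _ _ (TransGen.trans_right hyp hp)
    | @tail b y hb h ih =>
      intro hyp
      refine .tail (ih (.head h hyp)) ⟨⟨h.1, pred _ _ hb, ⟨y, h.2.1, h.2.2⟩⟩,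
        ⟨h.2.1, ⟨b, h.1, h.2.2⟩, succ _ _ (TransGen.trans_right hyp hp)⟩, h.2.2⟩
  exact h p (key p hp .refl)

/-- Outer pairs lie on no cycle, so they can all receive colour 0. Positivity of `n` makes this
colour available. -/
theorem AltColorable.of_inner {n : ℕ} (hn : 0 < n)
    (h : AltColorable le {p | p ∈ J ∧ (∃ q ∈ J, le q.1 p.2) ∧ ∃ q ∈ J, le p.1 q.2} n) :
    AltColorable le J n := by
  classical
  obtain ⟨c, hc, hnc⟩ := h
  set J₀ := {p | p ∈ J ∧ (∃ q ∈ J, le q.1 p.2) ∧ ∃ q ∈ J, le p.1 q.2}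
  refine ⟨fun p => if p ∈ J₀ then c p else 0, fun p hp => ?_, fun i => ?_⟩
  · dsimp only
    split_ifs with h0
    · exact hc p h0
    · exact hn
  · refine NoAlt.of_inner ((hnc i).mono ?_)
    rintro p ⟨⟨hp, hpi⟩, ⟨q, hq, hqp⟩, q', hq', hpq'⟩
    have h0 : p ∈ J₀ := ⟨hp, ⟨q, hq.1, hqp⟩, q', hq'.1, hpq'⟩
    dsimp only at hpi
    rw [if_pos h0] at hpi
    exact ⟨h0, hpi⟩

end Alt

/-! ### Reversible sets, alternating cycles and dimension -/

namespace PosetDim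

variable {P : Type*} [PartialOrder P]

/-- Along an alternating cycle the linear extension would go up by the comparabilities and also by
the reversed pairs, and would return to its start. -/
theorem noAlt_of_reversible {I : Set (P × P)} (h : Reversible I) : NoAlt (· ≤ ·) I := by
  obtain ⟨r, ⟨hr, hext⟩, hI⟩ := h
  intro p hp
  have trans : ∀ {x y z}, r x y → r y z → r x z := fun hxy hyz => _root_.trans hxy hyz
  have key : ∀ x y, TransGen (altRel (· ≤ ·) I) x y → r x.1 y.2 ∧ y ∈ I := fun x y hxy => by
    induction hxy with
    | single h => exact ⟨hext _ _ h.2.2, h.2.1⟩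
    | tail _ h ih =>
      exact ⟨trans ih.1 (trans (hI _ ih.2).1 (hext _ _ h.2.2)), h.2.1⟩
  obtain ⟨h1, h2⟩ := key p p hp
  exact (hI p h2).2 (_root_.antisymm (hI p h2).1 h1)

/-- Add the relation b < a for every pair (a, b) and close transitively. A violation of antisymmetry
is an alternating cycle, so the result is a partial order, and any linear extension of it reverses
all pairs. -/
theorem reversible_of_noAlt {I : Set (P × P)} (h : NoAlt (· ≤ ·) I) : Reversible I := by
  let s : P → P → Prop := fun u v => u ≤ v ∨ ∃ p ∈ I, ∃ q ∈ I, u ≤ p.2 ∧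
    ReflTransGen (altRel (· ≤ ·) I) p q ∧ q.1 ≤ v
  have hcyc : ∀ p ∈ I, ∀ q ∈ I, ReflTransGen (altRel (· ≤ ·) I) p q → ¬ q.1 ≤ p.2 :=
    fun p hp q hq hpq hqp => h q (TransGen.head' ⟨hq, hp, hqp⟩ hpq)
  have hs : IsPartialOrder P s :=
    { refl := fun u => Or.inl le_rfl
      trans := by
        rintro u v w (huv | ⟨p, hp, q, hq, hup, hpq, hqv⟩) (hvw | ⟨p', hp', q', hq', hvp, hpq', hqw⟩)
        · exact Or.inl (huv.trans hvw)
        · exact Or.inr ⟨p', hp', q', hq', huv.trans hvp, hpq', hqw⟩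
        · exact Or.inr ⟨p, hp, q, hq, hup, hpq, hqv.trans hvw⟩
        · exact Or.inr ⟨p, hp, q', hq', hup,
            (hpq.tail ⟨hq, hp', hqv.trans hvp⟩).trans hpq', hqw⟩
      antisymm := by
        rintro u v (huv | ⟨p, hp, q, hq, hup, hpq, hqv⟩) (hvw | ⟨p', hp', q', hq', hvp, hpq', hqw⟩)
        · exact le_antisymm huv hvw
        · exact (hcyc p' hp' q' hq' hpq' (hqw.trans (huv.trans hvp))).elim
        · exact (hcyc p hp q hq hpq (hqv.trans (hvw.trans hup))).elim
        · exact (hcyc p hp q' hq' ((hpq.tail ⟨hq, hp', hqv.trans hvp⟩).trans hpq')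
            (hqw.trans hup)).elim }
  obtain ⟨r, hr, hsr⟩ := extend_partialOrder s
  refine ⟨r, ⟨hr, fun x y hxy => hsr _ _ (Or.inl hxy)⟩, fun p hp => ⟨hsr _ _ ?_, ?_⟩⟩
  · exact Or.inr ⟨p, hp, p, hp, le_rfl, .refl, le_rfl⟩
  · intro heq
    exact hcyc p hp p hp .refl heq.ge

theorem altColorable_of_mem {I : Set (P × P)} {d : ℕ} (S : Fin d → Set (P × P))
    (hU : (⋃ i, S i) = I) (hS : ∀ i, Reversible (S i)) : AltColorable (· ≤ ·) I d := by
  classical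
  have : ∀ p : P × P, ∃ n : ℕ, p ∈ I → ∃ h : n < d, p ∈ S ⟨n, h⟩ := fun p => by
    by_cases hp : p ∈ I
    · rw [← hU, Set.mem_iUnion] at hp
      obtain ⟨i, hi⟩ := hp
      exact ⟨i, fun _ => ⟨i.2, hi⟩⟩
    · exact ⟨0, fun h => (hp h).elim⟩
  choose c hc using this
  refine ⟨c, fun p hp => (hc p hp).1, fun i => ?_⟩
  by_cases hi : i < d
  · refine (noAlt_of_reversible (hS ⟨i, hi⟩)).mono ?_
    rintro p ⟨hp, rfl⟩
    exact (hc p hp).2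
  · intro p hp
    obtain ⟨q, hq, -⟩ := TransGen.head'_iff.1 hp
    obtain ⟨⟨hpI, rfl⟩, -⟩ := hq
    exact hi (hc p hpI).1

/-- A partition into reversible sets obtained from a colouring. -/
theorem exists_partition_of_altColorable {I : Set (P × P)} {d : ℕ}
    (h : AltColorable (· ≤ ·) I d) : ∃ S : Fin d → Set (P × P),
      (∀ i j, i ≠ j → Disjoint (S i) (S j)) ∧ (⋃ i, S i) = I ∧ ∀ i, Reversible (S i) := by
  obtain ⟨c, hc, hn⟩ := h
  refine ⟨fun i => {p | p ∈ I ∧ c p = i}, fun i j hij => ?_, ?_, fun i => reversible_of_noAlt (hn i)⟩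
  · refine Set.disjoint_left.2 ?_
    rintro p ⟨-, h1⟩ ⟨-, h2⟩
    exact hij (Fin.ext (h1.symm.trans h2))
  · ext p
    simp only [Set.mem_iUnion]
    exact ⟨fun ⟨_, hp⟩ => hp.1, fun hp => ⟨⟨c p, hc p hp⟩, hp, rfl⟩⟩

/-- Each pair gets its own colour; a one-element cycle would make the pair comparable. This ensures
that the infimum defining `dimOf` is attained. -/
theorem exists_altColorable [Finite P] {I : Set (P × P)} (hI : I ⊆ Inc P) :
    ∃ d, AltColorable (· ≤ ·) I d := by
  obtain ⟨n, ⟨e⟩⟩ := Finite.exists_equiv_fin (P × P)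
  refine ⟨n, fun p => e p, fun p _ => (e p).2, fun i p hp => ?_⟩
  obtain ⟨q, ⟨⟨hp, h1⟩, ⟨hq, h2⟩, hle⟩, -⟩ := TransGen.head'_iff.1 hp
  have : p = q := e.injective (Fin.ext (h1.trans h2.symm))
  subst this
  exact (hI hp).1 hle

theorem altColorable_dimOf [Finite P] {I : Set (P × P)} (hI : I ⊆ Inc P) :
    AltColorable (· ≤ ·) I (dimOf I) := by
  obtain ⟨d, hd⟩ := exists_altColorable hI
  obtain ⟨S, -, hU, hS⟩ := Nat.sInf_mem (s := {d : ℕ | ∃ S : Fin d → Set (P × P),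
    (∀ i j, i ≠ j → Disjoint (S i) (S j)) ∧ (⋃ i, S i) = I ∧ ∀ i, Reversible (S i)})
    ⟨d, exists_partition_of_altColorable hd⟩
  exact altColorable_of_mem S hU hS

theorem dimOf_pos [Finite P] {I : Set (P × P)} (hI : I ⊆ Inc P) (hne : I.Nonempty) :
    0 < dimOf I := by
  obtain ⟨c, hc, -⟩ := altColorable_dimOf hI
  obtain ⟨p, hp⟩ := hne
  exact (Nat.zero_le _).trans_lt (hc p hp)

theorem dim_le_of_altColorable {d : ℕ} (hd : 0 < d)
    (h : AltColorable (· ≤ ·) (Inc P) d) : dim P ≤ d := by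
  classical
  obtain ⟨S, -, hU, hS⟩ := exists_partition_of_altColorable h
  choose r hr hrev using hS
  have hreal : IsRealizer P (Finset.univ.image r) := by
    refine ⟨⟨r ⟨0, hd⟩, by simp⟩, by simpa using hr, fun x y => ⟨fun hxy s hs => ?_, fun hall => ?_⟩⟩
    · obtain ⟨i, -, rfl⟩ := Finset.mem_image.1 hs
      exact (hr i).2 x y hxy
    · by_contra hxy
      have hall' : ∀ i, r i x y := fun i => hall _ (Finset.mem_image_of_mem _ (Finset.mem_univ i))
      by_cases hyx : y ≤ x
      · have := (hr ⟨0, hd⟩).1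
        exact hxy (_root_.antisymm (hall' ⟨0, hd⟩) ((hr ⟨0, hd⟩).2 _ _ hyx)).le
      · have hmem : (x, y) ∈ ⋃ i, S i := hU ▸ ⟨hxy, hyx⟩
        obtain ⟨i, hi⟩ := Set.mem_iUnion.1 hmem
        have := (hr i).1
        exact (hrev i _ hi).2 (_root_.antisymm (hrev i _ hi).1 (hall' i))
  calc dim P ≤ (Finset.univ.image r).card := Nat.sInf_le ⟨_, hreal, rfl⟩
    _ ≤ (Finset.univ : Finset (Fin d)).card := Finset.card_image_le
    _ = d := by simp

end PosetDim

/-! ### Polygonal sets: local conic structure and sides of a line -/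

section Conic

/-- Near every point `p`, the set `K` contains a point `z` as soon as it contains a point of the
half-open segment `(p, z]`. -/
def LocallyConic (K : Set ℂ) : Prop :=
  ∀ p : ℂ, ∃ ε > 0, ∀ z, dist z p < ε → ∀ t : ℝ, 0 < t → t ≤ 1 → p + t • (z - p) ∈ K → z ∈ K

theorem LocallyConic.union {K L : Set ℂ} (hK : LocallyConic K) (hL : LocallyConic L) :
    LocallyConic (K ∪ L) := by
  intro p
  obtain ⟨ε, hε, h⟩ := hK p
  obtain ⟨δ, hδ, h'⟩ := hL p
  refine ⟨min ε δ, lt_min hε hδ, fun z hz t ht ht1 hzt => ?_⟩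
  exact hzt.imp (h z (hz.trans_le (min_le_left _ _)) t ht ht1)
    (h' z (hz.trans_le (min_le_right _ _)) t ht ht1)

theorem LocallyConic.inter {K L : Set ℂ} (hK : LocallyConic K) (hL : LocallyConic L) :
    LocallyConic (K ∩ L) := by
  intro p
  obtain ⟨ε, hε, h⟩ := hK p
  obtain ⟨δ, hδ, h'⟩ := hL p
  refine ⟨min ε δ, lt_min hε hδ, fun z hz t ht ht1 hzt => ⟨?_, ?_⟩⟩
  · exact h z (hz.trans_le (min_le_left _ _)) t ht ht1 hzt.1
  · exact h' z (hz.trans_le (min_le_right _ _)) t ht ht1 hzt.2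

/-- Off the boundary line, a small ball lies on one side of it. On the boundary, the sign of `f z -
c` is invariant under scaling from `p`. -/
theorem locallyConic_le (f : ℂ →L[ℝ] ℝ) (c : ℝ) : LocallyConic {z | f z ≤ c} := by
  intro p
  rcases lt_trichotomy (f p) c with h | h | h
  · obtain ⟨ε, hε, hb⟩ := Metric.isOpen_iff.1 (isOpen_Iio.preimage f.continuous) p h
    exact ⟨ε, hε, fun z hz t _ _ _ => (show f z < c from hb hz).le⟩
  · refine ⟨1, one_pos, fun z _ t ht _ hzt => ?_⟩
    simp only [Set.mem_ofPred_eq, map_add, map_smul, map_sub, smul_eq_mul, h] at hzt ⊢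
    nlinarith
  · obtain ⟨ε, hε, hb⟩ := Metric.isOpen_iff.1 (isOpen_Ioi.preimage f.continuous) p h
    refine ⟨ε, hε, fun z hz t ht ht1 hzt => ?_⟩
    have h1 : c < f z := hb hz
    simp only [Set.mem_ofPred_eq, map_add, map_smul, map_sub, smul_eq_mul] at hzt
    nlinarith

/-- The part of the real axis to the right of `h`. -/
def realRay (h : ℝ) : Set ℂ := {z | z.im = 0 ∧ h ≤ z.re}

theorem isClosed_realRay (h : ℝ) : IsClosed (realRay h) :=
  (isClosed_eq Complex.continuous_im continuous_const).inter
    (isClosed_le continuous_const Complex.continuous_re)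

theorem locallyConic_realRay (h : ℝ) : LocallyConic (realRay h) := by
  have : realRay h = ({z | Complex.imCLM z ≤ 0} ∩ {z | (-Complex.imCLM) z ≤ 0}) ∩
      {z | (-Complex.reCLM) z ≤ -h} := by
    ext z
    simp [realRay, le_antisymm_iff]
  rw [this]
  exact ((locallyConic_le _ _).inter (locallyConic_le _ _)).inter (locallyConic_le _ _)

theorem isCompact_segment (u v : ℂ) : IsCompact (segment ℝ u v) := by
  rw [segment_eq_image']
  exact isCompact_Icc.image (by fun_prop)

theorem isClosed_segment (u v : ℂ) : IsClosed (segment ℝ u v) := (isCompact_segment u v).isClosed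

theorem isPreconnected_segment (u v : ℂ) : IsPreconnected (segment ℝ u v) :=
  (convex_segment u v).isPreconnected

theorem locallyConic_segment (u v : ℂ) : LocallyConic (segment ℝ u v) := by
  intro p
  by_cases hp : p ∈ segment ℝ u v
  · rw [segment_eq_image'] at hp
    obtain ⟨s, ⟨hs0, hs1⟩, rfl⟩ := hp
    rcases eq_or_ne u v with rfl | huv
    · refine ⟨1, one_pos, fun z _ t ht _ hzt => ?_⟩
      simp only [sub_self, smul_zero, add_zero, segment_same, Set.mem_singleton_iff] at hzt ⊢
      have : t • (z - u) = 0 := by simpa using hzt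
      rcases smul_eq_zero.1 this with h | h
      · exact (ht.ne' h).elim
      · exact sub_eq_zero.1 h
    · have hd : 0 < ‖v - u‖ := norm_pos_iff.2 (sub_ne_zero.2 huv.symm)
      refine ⟨‖v - u‖ * min (if s = 0 then 1 else s) (if s = 1 then 1 else 1 - s), ?_, ?_⟩
      · refine mul_pos hd (lt_min ?_ ?_)
        · split_ifs with h
          · exact one_pos
          · exact lt_of_le_of_ne hs0 (Ne.symm h)
        · split_ifs with h
          · exact one_pos
          · exact sub_pos.2 (lt_of_le_of_ne hs1 h)
      · intro z hz t ht ht1 hzt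
        dsimp only at hz hzt
        rw [segment_eq_image'] at hzt ⊢
        obtain ⟨s', ⟨h0, h1⟩, hs'⟩ := hzt
        dsimp only at hs'
        set l : ℝ := (s' - s) / t with hl
        have hlt : l * t = s' - s := by rw [hl]; field_simp
        have hzp : z = (u + s • (v - u)) + l • (v - u) := by
          have h2 : t • (z - (u + s • (v - u))) = t • (l • (v - u)) := by
            rw [smul_smul, mul_comm, hlt, sub_smul]
            linear_combination -hs'
          have h3 := smul_right_injective ℂ ht.ne' h2
          linear_combination h3
        have hll : |l| < min (if s = 0 then 1 else s) (if s = 1 then 1 else 1 - s) := by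
          rw [hzp, dist_eq_norm, add_sub_cancel_left, norm_smul, Real.norm_eq_abs, mul_comm] at hz
          exact lt_of_mul_lt_mul_left hz hd.le
        obtain ⟨hl1, hl2⟩ := lt_min_iff.1 hll
        refine ⟨s + l, ⟨?_, ?_⟩, ?_⟩
        · split_ifs at hl1 with h
          · have : 0 ≤ l := div_nonneg (by linarith) ht.le
            linarith
          · linarith [neg_abs_le l]
        · split_ifs at hl2 with h
          · have : l ≤ 0 := div_nonpos_of_nonpos_of_nonneg (by linarith) ht.le
            linarith
          · linarith [le_abs_self l]
        · dsimp only
          rw [hzp, add_smul]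
          ring
  · obtain ⟨ε, hε, hb⟩ := Metric.isOpen_iff.1 (isClosed_segment u v).isOpen_compl p hp
    refine ⟨ε, hε, fun z hz t ht ht1 hzt => ?_⟩
    refine (hb ?_ hzt).elim
    rw [Metric.mem_ball, dist_eq_norm, add_sub_cancel_left, norm_smul, Real.norm_eq_abs,
      abs_of_pos ht]
    rw [dist_eq_norm] at hz
    nlinarith [norm_nonneg (z - p)]

/-- A union of finitely many segments. -/
def PolySet (K : Set ℂ) : Prop :=
  ∃ s : Set (ℂ × ℂ), s.Finite ∧ K = ⋃ e ∈ s, segment ℝ e.1 e.2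

theorem polySet_segment (u v : ℂ) : PolySet (segment ℝ u v) :=
  ⟨{(u, v)}, Set.finite_singleton _, by simp⟩

theorem polySet_singleton (u : ℂ) : PolySet {u} := by
  simpa using polySet_segment u u

theorem polySet_empty : PolySet ∅ := ⟨∅, Set.finite_empty, by simp⟩

theorem PolySet.union {K L : Set ℂ} (hK : PolySet K) (hL : PolySet L) : PolySet (K ∪ L) := by
  obtain ⟨s, hs, rfl⟩ := hK
  obtain ⟨t, ht, rfl⟩ := hL
  exact ⟨s ∪ t, hs.union ht, (Set.biUnion_union s t _).symm⟩

theorem PolySet.biUnion {ι : Type*} {S : Set ι} (hS : S.Finite) {f : ι → Set ℂ}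
    (hf : ∀ i ∈ S, PolySet (f i)) : PolySet (⋃ i ∈ S, f i) := by
  induction S, hS using Set.Finite.induction_on with
  | empty => simpa using polySet_empty
  | @insert a S _ _ ih =>
    rw [Set.biUnion_insert]
    exact (hf a (Set.mem_insert _ _)).union (ih fun i hi => hf i (Set.mem_insert_of_mem _ hi))

/-- To show that all unions of finitely many segments have a property, consider segments and
unions. -/
theorem PolySet.induction {p : Set ℂ → Prop} (h0 : p ∅) (h1 : ∀ u v, p (segment ℝ u v))
    (h2 : ∀ K L, PolySet L → p K → p L → p (K ∪ L)) {K : Set ℂ} (hK : PolySet K) : p K := by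
  obtain ⟨s, hs, rfl⟩ := hK
  induction s, hs using Set.Finite.induction_on with
  | empty => simpa using h0
  | @insert a s _ hs ih =>
    rw [Set.biUnion_insert]
    exact h2 _ _ ⟨s, hs, rfl⟩ (h1 _ _) ih

theorem PolySet.isCompact {K : Set ℂ} (hK : PolySet K) : IsCompact K :=
  hK.induction isCompact_empty isCompact_segment fun _ _ _ h h' => h.union h'

theorem PolySet.isClosed {K : Set ℂ} (hK : PolySet K) : IsClosed K := hK.isCompact.isClosed

theorem PolySet.locallyConic {K : Set ℂ} (hK : PolySet K) : LocallyConic K :=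
  hK.induction (fun _ => ⟨1, one_pos, fun _ _ _ _ _ h => h.elim⟩) locallyConic_segment
    fun _ _ _ h h' => h.union h'

/-- Signed distance (up to a factor) from the line through `a` in direction `d`. -/
noncomputable def side (a d z : ℂ) : ℝ := (z.im - a.im) * d.re - (z.re - a.re) * d.im

theorem side_add_smul (a d : ℂ) (s : ℝ) : side a d (a + s • d) = 0 := by
  simp [side]; ring

theorem side_add_I_mul (a d z : ℂ) (s : ℝ) :
    side a d (z + (s : ℂ) * (Complex.I * d)) = side a d z + s * Complex.normSq d := by
  simp [side, Complex.normSq_apply]; ring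

theorem side_eq_zero_of_mem_segment {a b z : ℂ} (hz : z ∈ segment ℝ a b) :
    side a (b - a) z = 0 := by
  rw [segment_eq_image'] at hz
  obtain ⟨s, -, rfl⟩ := hz
  exact side_add_smul _ _ _

/-- Every neighbourhood of a point contains points on the given side of, and not on, a line through
the point, or points off a line. -/
theorem exists_shift_mem {U : Set ℂ} (hU : IsOpen U) {z : ℂ} (hz : z ∈ U) (d : ℂ) :
    ∃ δ > 0, ∀ s : ℝ, |s| < δ → z + (s : ℂ) * (Complex.I * d) ∈ U := by
  have hc : Continuous fun s : ℝ => z + (s : ℂ) * (Complex.I * d) := by fun_prop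
  obtain ⟨δ, hδ, hb⟩ := Metric.isOpen_iff.1 (hU.preimage hc) 0 (by simpa using hz)
  exact ⟨δ, hδ, fun s hs => hb (by simpa [Real.dist_eq] using hs)⟩

theorem exists_mem_side_ne_zero {U : Set ℂ} (hU : IsOpen U) (hne : U.Nonempty) (a : ℂ) {d : ℂ}
    (hd : d ≠ 0) : ∃ z ∈ U, side a d z ≠ 0 := by
  obtain ⟨z, hz⟩ := hne
  by_cases h : side a d z = 0
  · obtain ⟨δ, hδ, hs⟩ := exists_shift_mem hU hz d
    refine ⟨_, hs (δ / 2) (by rw [abs_of_pos] <;> linarith), ?_⟩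
    rw [side_add_I_mul, h, zero_add]
    exact mul_ne_zero (by linarith) (Complex.normSq_pos.2 hd).ne'
  · exact ⟨z, hz, h⟩

theorem interior_segment (u v : ℂ) : interior (segment ℝ u v) = ∅ := by
  by_contra h
  have hne := Set.nonempty_iff_ne_empty.2 h
  rcases eq_or_ne u v with rfl | huv
  · obtain ⟨z, hz, hs⟩ := exists_mem_side_ne_zero isOpen_interior hne u one_ne_zero
    have := interior_subset hz
    rw [segment_same] at this
    rw [this] at hs
    simp [side] at hs
  · obtain ⟨z, hz, hs⟩ := exists_mem_side_ne_zero isOpen_interior hne u (sub_ne_zero.2 huv.symm)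
    exact hs (side_eq_zero_of_mem_segment (interior_subset hz))

theorem PolySet.interior_eq {K : Set ℂ} (hK : PolySet K) : interior K = ∅ :=
  hK.induction (p := fun K => interior K = ∅) interior_empty interior_segment fun K L hL h h' => by
    rw [Set.union_comm, interior_union_isClosed_of_interior_empty hL.isClosed h, h']

theorem closure_diff_of_interior_eq_empty {X : Type*} [TopologicalSpace X] {U K : Set X}
    (hU : IsOpen U) (hK : interior K = ∅) : U ⊆ closure (U \ K) := by
  have : Dense Kᶜ := interior_eq_empty_iff_dense_compl.1 hK
  exact this.open_subset_closure_inter hU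

theorem closure_subset_closure_diff {X : Type*} [TopologicalSpace X] {U K : Set X}
    (hU : IsOpen U) (hK : interior K = ∅) : closure U ⊆ closure (U \ K) :=
  closure_minimal (closure_diff_of_interior_eq_empty hU hK) isClosed_closure

end Conic

/-! ### Components of cut open sets -/

section Components

/-- `C` is a connected component of `U`. -/
def IsComp (U C : Set ℂ) : Prop := ∃ y ∈ U, C = connectedComponentIn U y

variable {U C F : Set ℂ}

theorem IsComp.subset (h : IsComp U C) : C ⊆ U := by
  obtain ⟨y, -, rfl⟩ := h
  exact connectedComponentIn_subset _ _

theorem IsComp.isPreconnected (h : IsComp U C) : IsPreconnected C := by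
  obtain ⟨y, -, rfl⟩ := h
  exact isPreconnected_connectedComponentIn

theorem IsComp.nonempty (h : IsComp U C) : C.Nonempty := by
  obtain ⟨y, hy, rfl⟩ := h
  exact ⟨y, mem_connectedComponentIn hy⟩

theorem IsComp.isOpen (h : IsComp U C) (hU : IsOpen U) : IsOpen C := by
  obtain ⟨y, -, rfl⟩ := h
  exact hU.connectedComponentIn

theorem IsComp.subset_of_inter (h : IsComp U C) {T : Set ℂ} (hT : IsPreconnected T) (hTU : T ⊆ U)
    (hne : (T ∩ C).Nonempty) : T ⊆ C := by
  obtain ⟨y, hy, rfl⟩ := h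
  obtain ⟨w, hw, hwC⟩ := hne
  rw [connectedComponentIn_eq hwC]
  exact hT.subset_connectedComponentIn hw hTU

theorem IsComp.mem_of_mem_closure (h : IsComp U C) (hU : IsOpen U) {z : ℂ} (hz : z ∈ U)
    (hzC : z ∈ closure C) : z ∈ C := by
  obtain ⟨ε, hε, hb⟩ := Metric.isOpen_iff.1 hU z hz
  obtain ⟨w, hw⟩ := mem_closure_iff.1 hzC _ Metric.isOpen_ball (Metric.mem_ball_self hε)
  exact h.subset_of_inter (convex_ball z ε).isPreconnected hb ⟨w, hw⟩ (Metric.mem_ball_self hε)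

theorem isComp_connectedComponentIn {y : ℂ} (hy : y ∈ U) : IsComp U (connectedComponentIn U y) :=
  ⟨y, hy, rfl⟩

/-- A component of the complement of a closed set in a connected open set touches the removed set,
unless it is everything. -/
theorem IsComp.exists_mem_closure {s : Set ℂ} (hF : IsOpen F) (hFc : IsPreconnected F)
    (hs : IsClosed s) (hFs : (F ∩ s).Nonempty) (h : IsComp (F \ s) C) :
    ∃ w ∈ F ∩ s, w ∈ closure C := by
  by_contra! hno
  have hFC : F ⊆ C := by
    refine hFc.subset_of_closure_inter_subset (h.isOpen (hF.sdiff hs)) ?_ ?_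
    · obtain ⟨w, hw⟩ := h.nonempty
      exact ⟨w, (h.subset hw).1, hw⟩
    · rintro w ⟨hw, hwF⟩
      exact h.mem_of_mem_closure (hF.sdiff hs) ⟨hwF, fun hws => hno w ⟨hwF, hws⟩ hw⟩ hw
  obtain ⟨w, hwF, hws⟩ := hFs
  exact (h.subset (hFC hwF)).2 hws

/-- A component touching one point of an open segment along which the complement consists of the
two sides of the segment touches the whole segment. -/
theorem IsComp.segment_subset_closure (hU : IsOpen U) (h : IsComp U C) {a b w₀ : ℂ} (hab : a ≠ b)
    (hloc : ∀ w ∈ openSegment ℝ a b, ∃ ε > 0, ∀ z ∈ Metric.ball w ε, side a (b - a) z ≠ 0 → z ∈ U)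
    (hw₀ : w₀ ∈ openSegment ℝ a b) (hw₀C : w₀ ∈ closure C) : segment ℝ a b ⊆ closure C := by
  have hd : b - a ≠ 0 := sub_ne_zero.2 hab.symm
  have hn : 0 < Complex.normSq (b - a) := Complex.normSq_pos.2 hd
  set γ : ℝ → ℂ := fun t => a + t • (b - a) with hγ
  have hγc : Continuous γ := by fun_prop
  have hseg : openSegment ℝ a b = γ '' Set.Ioo 0 1 := openSegment_eq_image' ℝ a b
  set T : Set ℝ := γ ⁻¹' closure C
  have hT : IsClosed T := isClosed_closure.preimage hγc
  -- The parameters whose points lie in the closure of `C` form a set that is closed, and also open: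
  -- `C` meets one of the two half-disks at such a point, hence contains that half-disk, which
  -- accumulates at all nearby points of the line.
  have hstep : ∀ t ∈ Set.Ioo (0 : ℝ) 1, t ∈ T → t ∈ interior T := by
    intro t ht htT
    obtain ⟨ε, hε, hball⟩ := hloc (γ t) (hseg ▸ Set.mem_image_of_mem γ ht)
    obtain ⟨z, ⟨hzb, hzC⟩, hz0⟩ := exists_mem_side_ne_zero
      (Metric.isOpen_ball.inter (h.isOpen hU))
      (mem_closure_iff.1 htT _ Metric.isOpen_ball (Metric.mem_ball_self hε)) a hd
    obtain ⟨σ, hσ, hσz⟩ : ∃ σ : ℝ, (σ = 1 ∨ σ = -1) ∧ 0 < σ * side a (b - a) z := by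
      rcases lt_or_gt_of_ne hz0 with h | h
      · exact ⟨-1, Or.inr rfl, by linarith⟩
      · exact ⟨1, Or.inl rfl, by linarith⟩
    set H : Set ℂ := Metric.ball (γ t) ε ∩ {z | 0 < σ * side a (b - a) z}
    have hH : Convex ℝ H := by
      refine (convex_ball _ _).inter ?_
      intro x hx y hy s r hs hr hsr
      simp only [Set.mem_ofPred_eq] at hx hy ⊢
      have : σ * side a (b - a) (s • x + r • y) =
          s * (σ * side a (b - a) x) + r * (σ * side a (b - a) y) := by
        simp only [side, Complex.add_re, Complex.add_im, Complex.smul_re, Complex.smul_im,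
          smul_eq_mul]
        have : r = 1 - s := by linarith
        subst this
        ring
      rw [this]
      rcases hs.eq_or_lt with rfl | hs
      · have : r = 1 := by linarith
        subst this
        linarith
      · have := mul_pos hs hx
        have := mul_nonneg hr hy.le
        linarith
    have hHC : H ⊆ C := by
      refine h.subset_of_inter hH.isPreconnected (fun w hw => hball w hw.1 fun h0 => ?_)
        ⟨z, ⟨hzb, hσz⟩, hzC⟩
      have := hw.2
      simp only [Set.mem_ofPred_eq, h0, mul_zero, lt_self_iff_false] at this
    rw [mem_interior]
    refine ⟨γ ⁻¹' Metric.ball (γ t) ε, fun s hs => ?_, Metric.isOpen_ball.preimage hγc,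
      Metric.mem_ball_self hε⟩
    refine closure_mono hHC (mem_closure_iff.2 fun O hO hsO => ?_)
    obtain ⟨δ, hδ, hshift⟩ := exists_shift_mem (hO.inter Metric.isOpen_ball) ⟨hsO, hs⟩ (b - a)
    have habs : |σ * (δ / 2)| < δ := by
      have : |σ| = 1 := by rcases hσ with rfl | rfl <;> simp
      rw [abs_mul, this, one_mul, abs_of_pos (half_pos hδ)]
      exact half_lt_self hδ
    obtain ⟨h1, h2⟩ := hshift _ habs
    refine ⟨_, h1, h2, ?_⟩
    simp only [Set.mem_ofPred_eq]
    rw [side_add_I_mul, hγ, side_add_smul, zero_add]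
    have : σ * σ = 1 := by rcases hσ with rfl | rfl <;> norm_num
    have : σ * (σ * (δ / 2) * Complex.normSq (b - a)) = δ / 2 * Complex.normSq (b - a) := by
      linear_combination (δ / 2 * Complex.normSq (b - a)) * this
    rw [this]
    positivity
  have hsub : Set.Ioo (0 : ℝ) 1 ⊆ interior T := by
    refine isPreconnected_Ioo.subset_of_closure_inter_subset isOpen_interior ?_ ?_
    · rw [hseg] at hw₀
      obtain ⟨t, ht, rfl⟩ := hw₀
      exact ⟨t, ht, hstep t ht hw₀C⟩
    · rintro t ⟨ht, ht'⟩
      exact hstep t ht' (hT.closure_subset_iff.2 interior_subset ht)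
  intro z hz
  rw [segment_eq_image'] at hz
  obtain ⟨t, ht, rfl⟩ := hz
  have : closure (Set.Ioo (0 : ℝ) 1) ⊆ T := hT.closure_subset_iff.2 (hsub.trans interior_subset)
  rw [closure_Ioo zero_ne_one] at this
  exact this ht

/-- Every component that remains after cutting a connected open set along a segment with open
segment inside the set touches the end `p` of the cut. -/
theorem IsComp.left_mem_closure {p q : ℂ} (hF : IsOpen F) (hFc : IsPreconnected F) (hpq : p ≠ q)
    (hq : q ∉ F) (hseg : openSegment ℝ p q ⊆ F) (h : IsComp (F \ segment ℝ p q) C) :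
    p ∈ closure C := by
  have hmid : (F ∩ segment ℝ p q).Nonempty := by
    have : midpoint ℝ p q ∈ openSegment ℝ p q := by
      rw [midpoint_eq_smul_add]
      exact ⟨1/2, 1/2, by norm_num, by norm_num, by norm_num, by simp [smul_add]⟩
    exact ⟨_, hseg this, openSegment_subset_segment ℝ p q this⟩
  obtain ⟨w, ⟨hwF, hws⟩, hwC⟩ := h.exists_mem_closure hF hFc (isClosed_segment p q) hmid
  rw [← insert_endpoints_openSegment, Set.mem_insert_iff, Set.mem_insert_iff] at hws
  rcases hws with rfl | rfl | hws
  · exact hwC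
  · exact (hq hwF).elim
  · refine h.segment_subset_closure (hF.sdiff (isClosed_segment p q)) hpq (fun w hw => ?_) hws hwC
      (left_mem_segment ℝ p q)
    obtain ⟨ε, hε, hb⟩ := Metric.isOpen_iff.1 hF w (hseg hw)
    exact ⟨ε, hε, fun z hz h0 => ⟨hb hz, fun hzs => h0 (side_eq_zero_of_mem_segment hzs)⟩⟩

/-- A disk cut along a radius is connected. -/
theorem isPreconnected_ball_diff_segment {p q : ℂ} {ε : ℝ} (hε : 0 < ε) (hεq : ε ≤ dist q p) :
    IsPreconnected (Metric.ball p ε \ segment ℝ p q) := by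
  have hd : 0 < ‖q - p‖ := by rw [← dist_eq_norm]; exact hε.trans_le hεq
  set δ : ℝ := ε / (2 * ‖q - p‖) with hδ
  have hδ0 : 0 < δ := by positivity
  have hcollapse : ∀ s : ℝ, 0 ≤ s → p + s • (q - p) ∈ Metric.ball p ε →
      p + s • (q - p) ∈ segment ℝ p q := by
    intro s hs hb
    rw [Metric.mem_ball, dist_eq_norm, add_sub_cancel_left, norm_smul, Real.norm_eq_abs,
      abs_of_nonneg hs] at hb
    rw [dist_eq_norm] at hεq
    rw [segment_eq_image']
    refine ⟨s, ⟨hs, ?_⟩, rfl⟩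
    by_contra! h1
    nlinarith
  have ho : p + (-δ) • (q - p) ∈ Metric.ball p ε := by
    rw [Metric.mem_ball, dist_eq_norm, add_sub_cancel_left, norm_smul, Real.norm_eq_abs, abs_neg,
      abs_of_pos hδ0, hδ]
    field_simp
    linarith
  -- The centre lies beyond `p`, opposite to `q`, at distance ε/2. A line of sight from it can hit
  -- the cut only if its target lies on the ray from `p` through `q`, and inside the ball that ray
  -- belongs to the cut because ε is at most the distance to `q`.
  have hstar : StarConvex ℝ (p + (-δ) • (q - p)) (Metric.ball p ε \ segment ℝ p q) := by
    intro z hz a b ha hb hab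
    refine ⟨convex_ball p ε ho hz.1 ha hb hab, fun hs => ?_⟩
    rw [segment_eq_image'] at hs
    obtain ⟨s, ⟨hs0, -⟩, hs⟩ := hs
    dsimp only at hs
    have hb0 : b ≠ 0 := by
      rintro rfl
      have ha1 : a = 1 := by linarith
      subst ha1
      have : (s + δ) • (q - p) = 0 := by
        rw [add_smul]
        simp only [one_smul, zero_smul, add_zero] at hs
        linear_combination (norm := module) hs
      rcases smul_eq_zero.1 this with h | h
      · linarith
      · rw [h, norm_zero] at hd
        exact lt_irrefl _ hd
    have hbpos : 0 < b := lt_of_le_of_ne hb (Ne.symm hb0)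
    have hz' : z = p + ((s + a * δ) / b) • (q - p) := by
      have : b • z = b • (p + ((s + a * δ) / b) • (q - p)) := by
        rw [smul_add, smul_smul, mul_div_cancel₀ _ hb0]
        have ha' : a = 1 - b := by linarith
        subst ha'
        linear_combination (norm := module) -hs
      exact smul_right_injective ℂ hb0 this
    refine hz.2 ?_
    have hz1 := hz.1
    rw [hz'] at hz1 ⊢
    exact hcollapse _ (by positivity) hz1
  refine (hstar.isPathConnected ⟨ho, fun hs => ?_⟩).isConnected.isPreconnected
  rw [segment_eq_image'] at hs
  obtain ⟨s, ⟨hs0, -⟩, hs⟩ := hs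
  have : (s + δ) • (q - p) = 0 := by
    dsimp only at hs
    linear_combination (norm := module) hs
  rcases smul_eq_zero.1 this with h | h
  · linarith
  · rw [h, norm_zero] at hd
    exact lt_irrefl _ hd

/-- A cut with a free end inside does not disconnect a connected open set. -/
theorem isPreconnected_diff_segment {p q : ℂ} (hF : IsOpen F) (hFc : IsPreconnected F)
    (hp : p ∈ F) (hq : q ∉ F) (hseg : openSegment ℝ p q ⊆ F) :
    IsPreconnected (F \ segment ℝ p q) := by
  have hpq : p ≠ q := fun h => hq (h ▸ hp)
  obtain ⟨ε, hε, hb⟩ := Metric.isOpen_iff.1 hF p hp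
  have hδ : 0 < min ε (dist q p) := lt_min hε (dist_pos.2 hpq.symm)
  have hB := isPreconnected_ball_diff_segment hδ (min_le_right ε (dist q p))
  set B := Metric.ball p (min ε (dist q p)) \ segment ℝ p q
  have hBU : B ⊆ F \ segment ℝ p q := fun z hz =>
    ⟨hb (Metric.ball_subset_ball (min_le_left _ _) hz.1), hz.2⟩
  -- Every remaining component touches the free end `p`, around which the slit disk `B` is
  -- connected; so every component contains `B`.
  have key : ∀ y ∈ F \ segment ℝ p q, B ⊆ connectedComponentIn (F \ segment ℝ p q) y ∧ B.Nonempty := by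
    intro y hy
    have hC := isComp_connectedComponentIn hy
    obtain ⟨w, hwb, hwC⟩ := mem_closure_iff.1 (hC.left_mem_closure hF hFc hpq hq hseg) _
      Metric.isOpen_ball (Metric.mem_ball_self hδ)
    have hwB : w ∈ B := ⟨hwb, (hC.subset hwC).2⟩
    exact ⟨hC.subset_of_inter hB hBU ⟨w, hwB, hwC⟩, w, hwB⟩
  refine isPreconnected_of_forall_pair fun x hx y hy => ?_
  obtain ⟨w, hw⟩ := (key x hx).2
  have hxy : connectedComponentIn (F \ segment ℝ p q) x =
      connectedComponentIn (F \ segment ℝ p q) y :=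
    (connectedComponentIn_eq ((key x hx).1 hw)).trans (connectedComponentIn_eq ((key y hy).1 hw)).symm
  exact ⟨_, connectedComponentIn_subset _ x, mem_connectedComponentIn hx,
    hxy ▸ mem_connectedComponentIn hy, isPreconnected_connectedComponentIn⟩

/-- Polar coordinates exhibit the set as an image of a product of intervals. The minus sign moves
the slit of the principal argument from the negative to the positive real axis. -/
theorem isPreconnected_outside_diff_realRay {R : ℝ} (hR : 0 ≤ R) :
    IsPreconnected ({z : ℂ | R < ‖z‖} \ realRay 0) := by
  have : {z : ℂ | R < ‖z‖} \ realRay 0 =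
      (fun x : ℝ × ℝ => -((x.1 : ℂ) * Complex.exp (x.2 * Complex.I))) ''
        (Set.Ioi R ×ˢ Set.Ioo (-Real.pi) Real.pi) := by
    ext z
    constructor
    · rintro ⟨hz, hz'⟩
      refine ⟨(‖-z‖, (-z).arg), ⟨by simpa using hz, Complex.neg_pi_lt_arg _,
        lt_of_le_of_ne (Complex.arg_le_pi _) fun h => hz' ?_⟩, ?_⟩
      · rw [Complex.arg_eq_pi_iff] at h
        exact ⟨by simpa using h.2, by simpa using h.1.le⟩
      · dsimp only
        rw [Complex.norm_mul_exp_arg_mul_I, neg_neg]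
    · rintro ⟨⟨r, θ⟩, ⟨hr, hθ⟩, rfl⟩
      have hr' : R < r := hr
      have hr0 : 0 < r := hR.trans_lt hr'
      refine ⟨?_, ?_⟩
      · simp only [Set.mem_ofPred_eq, norm_neg, norm_mul, Complex.norm_exp_ofReal_mul_I, mul_one,
          Complex.norm_real, Real.norm_eq_abs, abs_of_pos hr0, hr']
      · rintro ⟨h1, h2⟩
        have h3 := Complex.arg_mul_cos_add_sin_mul_I hr0 (Set.Ioo_subset_Ioc_self hθ)
        rw [← Complex.exp_mul_I] at h3
        have h4 : ((r : ℂ) * Complex.exp (θ * Complex.I)).arg = Real.pi := by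
          rw [Complex.arg_eq_pi_iff]
          refine ⟨lt_of_le_of_ne (by simpa using h2) fun h5 => ?_, by simpa using h1⟩
          have : (r : ℂ) * Complex.exp (θ * Complex.I) = 0 :=
            Complex.ext (by simpa using h5) (by simpa using h1)
          simp [hr0.ne'] at this
        exact hθ.2.ne (h3.symm.trans h4)
  rw [this]
  exact (isPreconnected_Ioi.prod isPreconnected_Ioo).image _ (by fun_prop)

/-- A cut along a ray to infinity does not disconnect a connected neighbourhood of infinity. -/
theorem isPreconnected_diff_realRay {h R : ℝ} (hF : IsOpen F) (hFc : IsPreconnected F)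
    (hh : (h : ℂ) ∉ F) (hray : ∀ t : ℝ, h < t → (t : ℂ) ∈ F) (hR : ∀ z : ℂ, R < ‖z‖ → z ∈ F) :
    IsPreconnected (F \ realRay h) := by
  set R' := max R |h| with hR'
  have hR'0 : 0 ≤ R' := (abs_nonneg h).trans (le_max_right _ _)
  have hB := isPreconnected_outside_diff_realRay hR'0
  set B := {z : ℂ | R' < ‖z‖} \ realRay 0
  have hBray : ∀ z : ℂ, R' < ‖z‖ → z ∈ realRay h → z ∈ realRay 0 := by
    rintro z hz ⟨h1, h2⟩
    refine ⟨h1, ?_⟩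
    by_contra! h3
    have hz' : ‖z‖ = |z.re| := by
      rw [← Complex.re_add_im z, h1]; simp
    rw [hz', abs_of_neg h3] at hz
    have := le_max_right R |h|
    have := neg_abs_le h
    linarith
  have hBray' : ∀ z : ℂ, R' < ‖z‖ → z ∈ realRay 0 → z ∈ realRay h := by
    rintro z hz ⟨h1, h2⟩
    refine ⟨h1, ?_⟩
    have hz' : ‖z‖ = |z.re| := by
      rw [← Complex.re_add_im z, h1]; simp
    rw [hz', abs_of_nonneg h2] at hz
    have := le_max_right R |h|
    have := le_abs_self h
    linarith
  have hBU : B ⊆ F \ realRay h := fun z hz =>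
    ⟨hR z ((le_max_left _ _).trans_lt hz.1), fun hzr => hz.2 (hBray z hz.1 hzr)⟩
  have hU : IsOpen (F \ realRay h) := hF.sdiff (isClosed_realRay h)
  have key : ∀ y ∈ F \ realRay h, B ⊆ connectedComponentIn (F \ realRay h) y ∧ B.Nonempty := by
    intro y hy
    have hC := isComp_connectedComponentIn hy
    obtain ⟨w, ⟨hwF, hwr⟩, hwC⟩ := hC.exists_mem_closure hF hFc (isClosed_realRay h)
      ⟨((h + 1 : ℝ) : ℂ), hray _ (by linarith), by simp [realRay]⟩
    have hw : w = (w.re : ℂ) := Complex.ext rfl (by simpa using hwr.1)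
    have hwh : h < w.re := lt_of_le_of_ne hwr.2 fun h' => hh (by rw [h', ← hw]; exact hwF)
    -- The component touches the ray at `w`. Contact propagates along the ray to `m`, which lies so
    -- far out that the component must meet the connected slit region `B`.
    set m : ℝ := max w.re R' + 1
    have hm1 : w.re < m := (le_max_left _ _).trans_lt (lt_add_one _)
    have hm2 : R' < m := (le_max_right _ _).trans_lt (lt_add_one _)
    have hhm : (h : ℂ) ≠ m := by
      intro h'
      have := Complex.ofReal_injective h'
      linarith
    have hside : ∀ z : ℂ, side (h : ℂ) ((m : ℂ) - h) z ≠ 0 → z.im ≠ 0 := by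
      intro z hz hz0
      simp [side, hz0] at hz
    have hmC : (m : ℂ) ∈ closure (connectedComponentIn (F \ realRay h) y) := by
      refine hC.segment_subset_closure hU hhm (fun z hz => ?_) (w₀ := w) ?_ hwC
        (right_mem_segment ℝ _ _)
      · have hzF : z ∈ F := by
          rw [openSegment_eq_image'] at hz
          obtain ⟨s, ⟨hs, -⟩, rfl⟩ := hz
          have := hray (h + s * (m - h)) (by nlinarith)
          simpa using this
        obtain ⟨ε, hε, hb⟩ := Metric.isOpen_iff.1 hF z hzF
        exact ⟨ε, hε, fun z hz h0 => ⟨hb hz, fun hzs => hside z h0 hzs.1⟩⟩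
      · rw [openSegment_eq_image']
        have hmh : 0 < m - h := by linarith
        refine ⟨(w.re - h) / (m - h), ⟨by apply div_pos <;> linarith, ?_⟩, ?_⟩
        · rw [div_lt_one hmh]; linarith
        · rw [hw]
          have : ((m : ℂ) - h) ≠ 0 := sub_ne_zero.2 hhm.symm
          simp only [Complex.real_smul, Complex.ofReal_div, Complex.ofReal_sub, Complex.ofReal_re]
          field_simp
          ring
    have hopen : IsOpen {z : ℂ | R' < ‖z‖} := isOpen_lt continuous_const continuous_norm
    obtain ⟨v, hv, hvC⟩ := mem_closure_iff.1 hmC _ hopen (by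
      simp only [Set.mem_ofPred_eq, Complex.norm_real, Real.norm_eq_abs]
      exact hm2.trans_le (le_abs_self m))
    have hvB : v ∈ B := ⟨hv, fun hv0 => (hC.subset hvC).2 (hBray' v hv hv0)⟩
    exact ⟨hC.subset_of_inter hB hBU ⟨v, hvB, hvC⟩, v, hvB⟩
  refine isPreconnected_of_forall_pair fun x hx y hy => ?_
  obtain ⟨w, hw⟩ := (key x hx).2
  have hxy : connectedComponentIn (F \ realRay h) x = connectedComponentIn (F \ realRay h) y :=
    (connectedComponentIn_eq ((key x hx).1 hw)).trans (connectedComponentIn_eq ((key y hy).1 hw)).symm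
  exact ⟨_, connectedComponentIn_subset _ x, mem_connectedComponentIn hx,
    hxy ▸ mem_connectedComponentIn hy, isPreconnected_connectedComponentIn⟩

end Components

/-! ### Simple polygonal arcs, stars and the tripod -/

section PArc

/-- `PArc p q A`: the set `A` is a simple polygonal arc from `p` to `q`. -/
inductive PArc : ℂ → ℂ → Set ℂ → Prop
  | seg {p q : ℂ} (h : p ≠ q) : PArc p q (segment ℝ p q)
  | cons {p q r : ℂ} {A : Set ℂ} (h : p ≠ q) (hA : PArc q r A) (hi : segment ℝ p q ∩ A ⊆ {q}) :
      PArc p r (segment ℝ p q ∪ A)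

variable {p q v z : ℂ} {A F ρ : Set ℂ}

theorem PArc.polySet (h : PArc p q A) : PolySet A := by
  induction h with
  | seg h => exact polySet_segment _ _
  | cons h _ _ ih => exact (polySet_segment _ _).union ih

theorem PArc.left_mem (h : PArc p q A) : p ∈ A := by
  cases h with
  | seg h => exact left_mem_segment ℝ _ _
  | cons h _ _ => exact Or.inl (left_mem_segment ℝ _ _)

theorem PArc.right_mem (h : PArc p q A) : q ∈ A := by
  induction h with
  | seg h => exact right_mem_segment ℝ _ _
  | cons h _ _ ih => exact Or.inr ih

theorem PArc.ne (h : PArc p q A) : p ≠ q := by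
  cases h with
  | seg h => exact h
  | cons h hA hi =>
    rintro rfl
    exact h (hi ⟨left_mem_segment ℝ _ _, hA.right_mem⟩)

theorem segment_diff_right (p q : ℂ) (h : p ≠ q) :
    segment ℝ p q \ {q} = (fun t : ℝ => p + t • (q - p)) '' Set.Ico 0 1 := by
  have hd : q - p ≠ 0 := sub_ne_zero.2 h.symm
  have hiff : ∀ t : ℝ, p + t • (q - p) = q ↔ t = 1 := fun t => by
    constructor
    · intro ht
      have : (t - 1) • (q - p) = 0 := by
        rw [sub_smul, one_smul]; linear_combination ht
      rcases smul_eq_zero.1 this with h | h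
      · linarith
      · exact (hd h).elim
    · rintro rfl; simp
  rw [segment_eq_image']
  ext z
  constructor
  · rintro ⟨⟨t, ht, rfl⟩, hz⟩
    exact ⟨t, ⟨ht.1, lt_of_le_of_ne ht.2 fun h1 => hz ((hiff t).2 h1)⟩, rfl⟩
  · rintro ⟨t, ht, rfl⟩
    exact ⟨⟨t, ⟨ht.1, ht.2.le⟩, rfl⟩, fun h1 => ht.2.ne ((hiff t).1 h1)⟩

theorem isPreconnected_segment_diff_right (h : p ≠ q) : IsPreconnected (segment ℝ p q \ {q}) := by
  rw [segment_diff_right p q h]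
  exact isPreconnected_Ico.image _ (by fun_prop)

theorem mem_closure_segment_diff_right (h : p ≠ q) : q ∈ closure (segment ℝ p q \ {q}) := by
  rw [segment_diff_right p q h]
  have hc : Continuous fun t : ℝ => p + t • (q - p) := by fun_prop
  refine image_closure_subset_closure_image hc ⟨1, ?_, by simp⟩
  rw [closure_Ico zero_ne_one]
  exact ⟨zero_le_one, le_rfl⟩

theorem PArc.isPreconnected_diff (h : PArc p q A) : IsPreconnected (A \ {q}) := by
  induction h with
  | seg h => exact isPreconnected_segment_diff_right h
  | @cons p q r A h hA hi ih =>
    have hr : r ∉ segment ℝ p q := fun hr => hA.ne (hi ⟨hr, hA.right_mem⟩).symm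
    rw [Set.union_sdiff_distrib, Set.sdiff_singleton_eq_self hr]
    exact (isPreconnected_segment p q).union' ⟨q, right_mem_segment ℝ _ _, hA.left_mem, hA.ne⟩ ih

theorem PArc.right_mem_closure (h : PArc p q A) : q ∈ closure (A \ {q}) := by
  induction h with
  | seg h => exact mem_closure_segment_diff_right h
  | cons h hA hi ih => exact closure_mono (Set.sdiff_subset_sdiff_left Set.subset_union_right) ih

theorem Path.trans_injective {X : Type*} [TopologicalSpace X] {x y z : X} {γ : Path x y}
    {γ' : Path y z} (h : Function.Injective γ) (h' : Function.Injective γ')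
    (hi : Set.range γ ∩ Set.range γ' ⊆ {y}) : Function.Injective (γ.trans γ') := by
  have key : ∀ s t : unitInterval, (s : ℝ) ≤ 1 / 2 → ¬ (t : ℝ) ≤ 1 / 2 →
      γ.trans γ' s ≠ γ.trans γ' t := by
    intro s t hs ht heq
    rw [Path.trans_apply, Path.trans_apply, dif_pos hs, dif_neg ht] at heq
    have hy := hi ⟨⟨_, heq⟩, ⟨_, rfl⟩⟩
    have := h' (hy.trans γ'.source.symm)
    have := congrArg Subtype.val this
    simp only [Set.Icc.coe_zero] at this
    linarith
  intro s t heq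
  by_cases hs : (s : ℝ) ≤ 1 / 2 <;> by_cases ht : (t : ℝ) ≤ 1 / 2
  · rw [Path.trans_apply, Path.trans_apply, dif_pos hs, dif_pos ht] at heq
    have := congrArg Subtype.val (h heq)
    dsimp only at this
    exact Subtype.ext (by linarith)
  · exact (key s t hs ht heq).elim
  · exact (key t s ht hs heq.symm).elim
  · rw [Path.trans_apply, Path.trans_apply, dif_neg hs, dif_neg ht] at heq
    have := congrArg Subtype.val (h' heq)
    dsimp only at this
    exact Subtype.ext (by linarith)

theorem exists_path_segment (h : p ≠ q) :
    ∃ γ : Path p q, Function.Injective γ ∧ Set.range γ = segment ℝ p q := by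
  have hc : Continuous fun t : unitInterval => p + (t : ℝ) • (q - p) := by fun_prop
  refine ⟨⟨⟨fun t => p + (t : ℝ) • (q - p), hc⟩, by simp, by simp⟩, fun s t hst => ?_, ?_⟩
  · have : p + (s : ℝ) • (q - p) = p + (t : ℝ) • (q - p) := hst
    exact Subtype.ext (smul_left_injective ℝ (sub_ne_zero.2 h.symm) (add_left_cancel this))
  · rw [segment_eq_image']
    ext z
    constructor
    · rintro ⟨t, rfl⟩
      exact ⟨t, t.2, rfl⟩
    · rintro ⟨t, ht, rfl⟩
      exact ⟨⟨t, ht⟩, rfl⟩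

theorem PArc.isPolygonalArc (h : PArc p q A) : IsPolygonalArc A p q := by
  refine ⟨?_, h.polySet⟩
  induction h with
  | seg h => exact exists_path_segment h
  | cons h hA hi ih =>
    obtain ⟨γ, hγ, hr⟩ := exists_path_segment h
    obtain ⟨γ', hγ', hr'⟩ := ih
    refine ⟨γ.trans γ', Path.trans_injective hγ hγ' ?_, ?_⟩
    · rw [hr, hr']; exact hi
    · rw [Path.trans_range, hr, hr']

theorem ne_of_mem_openSegment (h : p ≠ q) (hz : z ∈ openSegment ℝ p q) : z ≠ p ∧ z ≠ q := by
  constructor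
  · rintro rfl
    exact h (left_mem_openSegment_iff.1 hz)
  · rintro rfl
    exact h (right_mem_openSegment_iff.1 hz)

/-- The last point of a segment in a closed set. -/
theorem exists_last_mem_segment (hρ : IsClosed ρ) (hne : (segment ℝ p q ∩ ρ).Nonempty) :
    ∃ h ∈ segment ℝ p q ∩ ρ, segment ℝ h q ⊆ segment ℝ p q ∧ segment ℝ h q ∩ ρ ⊆ {h} := by
  set γ : ℝ → ℂ := fun t => p + t • (q - p) with hγ
  have hγc : Continuous γ := by fun_prop
  have hcomp : IsCompact (Set.Icc (0 : ℝ) 1 ∩ γ ⁻¹' ρ) := isCompact_Icc.inter_right (hρ.preimage hγc)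
  have hne' : (Set.Icc (0 : ℝ) 1 ∩ γ ⁻¹' ρ).Nonempty := by
    obtain ⟨w, hw, hwρ⟩ := hne
    rw [segment_eq_image'] at hw
    obtain ⟨t, ht, rfl⟩ := hw
    exact ⟨t, ht, hwρ⟩
  obtain ⟨t, ⟨ht, htρ⟩, hmax⟩ := hcomp.exists_isGreatest hne'
  have hmem : γ t ∈ segment ℝ p q := by
    rw [segment_eq_image']; exact ⟨t, ht, rfl⟩
  refine ⟨γ t, ⟨hmem, htρ⟩, (convex_segment p q).segment_subset hmem (right_mem_segment ℝ p q), ?_⟩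
  rintro w ⟨hw, hwρ⟩
  rw [segment_eq_image'] at hw
  obtain ⟨s, ⟨hs0, hs1⟩, rfl⟩ := hw
  have heq : γ t + s • (q - γ t) = γ (t + s * (1 - t)) := by
    simp only [hγ]; module
  dsimp only at hwρ ⊢
  rw [heq] at hwρ ⊢
  have h0 : t + s * (1 - t) ≤ t := hmax ⟨⟨by nlinarith [ht.1, ht.2], by nlinarith [ht.1, ht.2]⟩, hwρ⟩
  have : s * (1 - t) = 0 := le_antisymm (by linarith) (mul_nonneg hs0 (by linarith [ht.2]))
  rw [this, add_zero]
  rfl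

/-- The part of a polygonal arc after its last point in a closed set. -/
theorem PArc.exists_last (h : PArc p v A) (hρ : IsClosed ρ) (hv : v ∉ ρ) (hne : (A ∩ ρ).Nonempty) :
    ∃ z A', PArc z v A' ∧ A' ⊆ A ∧ z ∈ ρ ∧ A' ∩ ρ ⊆ {z} := by
  induction h with
  | @seg p q h =>
    obtain ⟨z, ⟨hz, hzρ⟩, hsub, hi⟩ := exists_last_mem_segment hρ hne
    exact ⟨z, _, .seg fun h => hv (h ▸ hzρ), hsub, hzρ, hi⟩
  | @cons p q r A h hA hi ih =>
    by_cases hne' : (A ∩ ρ).Nonempty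
    · obtain ⟨z, A', h1, h2, h3⟩ := ih hv hne'
      exact ⟨z, A', h1, h2.trans Set.subset_union_right, h3⟩
    · have hdis : ∀ w ∈ A, w ∉ ρ := fun w hw hwρ => hne' ⟨w, hw, hwρ⟩
      obtain ⟨z, ⟨hz, hzρ⟩, hsub, hi'⟩ := exists_last_mem_segment (p := p) (q := q) hρ (by
        obtain ⟨w, hw | hw, hwρ⟩ := hne
        · exact ⟨w, hw, hwρ⟩
        · exact (hdis w hw hwρ).elim)
      have hzq : z ≠ q := fun h => hdis q hA.left_mem (h ▸ hzρ)
      refine ⟨z, _, .cons hzq hA fun w hw => hi ⟨hsub hw.1, hw.2⟩,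
        Set.union_subset_union_left _ hsub, hzρ, ?_⟩
      rintro w ⟨hw | hw, hwρ⟩
      · exact hi' ⟨hw, hwρ⟩
      · exact (hdis w hw hwρ).elim

/-- If `p` is on the arc, keep the part after `p`. Otherwise walk from `p` towards `z` until the arc
is first hit and continue along the arc; this keeps the result simple. -/
theorem PArc.extend (h : PArc z v A) (hp : p ≠ v) :
    ∃ A', PArc p v A' ∧ A' ⊆ segment ℝ p z ∪ A := by
  by_cases hpA : p ∈ A
  · obtain ⟨z', A', h1, h2, rfl, -⟩ := h.exists_last (isClosed_singleton (x := p)) hp.symm ⟨p, hpA, rfl⟩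
    exact ⟨A', h1, h2.trans Set.subset_union_right⟩
  · obtain ⟨w, ⟨hw, hwA⟩, hsub, hi⟩ := exists_last_mem_segment (p := z) (q := p) h.polySet.isClosed
      ⟨z, left_mem_segment ℝ _ _, h.left_mem⟩
    rw [segment_symm ℝ w p, segment_symm ℝ z p] at hsub
    rw [segment_symm ℝ w p] at hi
    have hpw : p ≠ w := fun h => hpA (h ▸ hwA)
    rcases eq_or_ne w v with rfl | hwv
    · exact ⟨_, .seg hpw, hsub.trans Set.subset_union_left⟩
    · obtain ⟨z', A', h1, h2, rfl, -⟩ :=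
        h.exists_last (isClosed_singleton (x := w)) hwv.symm ⟨w, hwA, rfl⟩
      exact ⟨_, .cons hpw h1 fun u hu => hi ⟨hu.1, h2 hu.2⟩,
        Set.union_subset_union hsub h2⟩

/-- An accessible boundary point of a connected open set can be reached by a polygonal arc from
every point of the set. -/
theorem exists_pArc (hF : IsOpen F) (hFc : IsPreconnected F) (hv : v ∉ F) {z₀ : ℂ} (hz₀ : z₀ ∈ F)
    (hseg : segment ℝ z₀ v ⊆ F ∪ {v}) (hz : z ∈ F) : ∃ A, PArc z v A ∧ A ⊆ F ∪ {v} := by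
  set S : Set ℂ := {z | z ∈ F ∧ ∃ A, PArc z v A ∧ A ⊆ F ∪ {v}} with hS
  -- Within a small ball, an arc from one point can be extended to start at any other. Hence the set
  -- of points from which `v` is reachable is open and relatively closed in `F`.
  have hstep : ∀ z ∈ F, ∃ ε > 0, ∀ x ∈ Metric.ball z ε, ∀ y ∈ Metric.ball z ε, x ∈ S → y ∈ S := by
    intro z hz
    obtain ⟨ε, hε, hb⟩ := Metric.isOpen_iff.1 hF z hz
    refine ⟨ε, hε, fun x hx y hy hxS => ⟨hb hy, ?_⟩⟩
    obtain ⟨-, A, hA, hAF⟩ := hxS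
    obtain ⟨A', hA', hsub⟩ := hA.extend (p := y) fun h => hv (h ▸ hb hy)
    refine ⟨A', hA', hsub.trans (Set.union_subset ?_ hAF)⟩
    exact ((convex_ball z ε).segment_subset hy hx).trans (hb.trans Set.subset_union_left)
  have hSo : IsOpen S := by
    refine Metric.isOpen_iff.2 fun z hzS => ?_
    obtain ⟨ε, hε, h⟩ := hstep z hzS.1
    exact ⟨ε, hε, fun y hy => h z (Metric.mem_ball_self hε) y hy hzS⟩
  have hsub : F ⊆ S := by
    refine hFc.subset_of_closure_inter_subset hSo ⟨z₀, hz₀, hz₀, _, .seg fun h => hv (h ▸ hz₀), hseg⟩ ?_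
    rintro z ⟨hzS, hzF⟩
    obtain ⟨ε, hε, h⟩ := hstep z hzF
    obtain ⟨w, hw, hwS⟩ := mem_closure_iff.1 hzS _ Metric.isOpen_ball (Metric.mem_ball_self hε)
    exact h w hw z (Metric.mem_ball_self hε) hwS
  exact (hsub hz).2

/-- An arc that leads from a boundary point into a connected open set does not disconnect it. -/
theorem PArc.isPreconnected_sdiff (h : PArc z v A) (hF : IsOpen F) (hFc : IsPreconnected F)
    (hv : v ∉ F) (hA : A ⊆ F ∪ {v}) : IsPreconnected (F \ A) := by
  have mem_of : ∀ w ∈ F ∪ {v}, w ≠ v → w ∈ F := fun w hw hwv => hw.resolve_right hwv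
  induction h with
  | @seg p q h =>
    refine isPreconnected_diff_segment hF hFc (mem_of _ (hA (left_mem_segment ℝ _ _)) h) hv ?_
    exact fun w hw => mem_of w (hA (openSegment_subset_segment ℝ p q hw)) (ne_of_mem_openSegment h hw).2
  | @cons p q r B h hB hi ih =>
    have hpr : p ≠ r := (PArc.cons h hB hi).ne
    have hBF : B ⊆ F ∪ {r} := Set.subset_union_right.trans hA
    have hr : r ∉ segment ℝ p q := fun hr => hB.ne (hi ⟨hr, hB.right_mem⟩).symm
    have hsegF : segment ℝ p q ⊆ F := fun w hw =>
      mem_of w (hA (Or.inl hw)) fun h => hr (h ▸ hw)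
    -- After the tail `B` is removed, the first segment is a cut with free end `p` whose other end
    -- `q` lies on `B`, outside the remaining open set.
    have := isPreconnected_diff_segment (p := p) (q := q) (hF.sdiff hB.polySet.isClosed)
      (ih hv hBF mem_of) ⟨hsegF (left_mem_segment ℝ _ _), fun hp => h (hi ⟨left_mem_segment ℝ _ _, hp⟩)⟩
      (fun hq => hq.2 hB.left_mem) fun w hw => ⟨hsegF (openSegment_subset_segment ℝ p q hw), fun hwB =>
        (ne_of_mem_openSegment h hw).2 (hi ⟨openSegment_subset_segment ℝ p q hw, hwB⟩)⟩
    rwa [Set.sdiff_sdiff, Set.union_comm] at this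

/-- Every part into which an arc between boundary points cuts a connected open set has the first
end of the arc on its boundary. -/
theorem PArc.left_mem_closure {x : ℂ} {C : Set ℂ} (h : PArc x v A) (hF : IsOpen F)
    (hFc : IsPreconnected F) (hv : v ∉ F) (hA : A ⊆ F ∪ {x, v})
    (hC : IsComp (F \ A) C) : x ∈ closure C := by
  have mem_of : ∀ w ∈ A, w ≠ x → w ≠ v → w ∈ F := fun w hw hwx hwv =>
    (hA hw).resolve_right fun h => h.elim hwx hwv
  cases h with
  | seg h =>
    refine hC.left_mem_closure hF hFc h hv fun w hw => ?_
    exact mem_of w (openSegment_subset_segment ℝ _ _ hw) (ne_of_mem_openSegment h hw).1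
      (ne_of_mem_openSegment h hw).2
  | @cons _ q _ B h hB hi =>
    have hv' : v ∉ segment ℝ x q := fun hr => hB.ne (hi ⟨hr, hB.right_mem⟩).symm
    have hxB : x ∉ B := fun hp => h (hi ⟨left_mem_segment ℝ _ _, hp⟩)
    have hBF : B ⊆ F ∪ {v} := fun w hw => by
      by_cases hwv : w = v
      · exact Or.inr hwv
      · exact Or.inl (mem_of w (Or.inr hw) (fun h => hxB (h ▸ hw)) hwv)
    have hsegF : openSegment ℝ x q ⊆ F \ B := fun w hw => by
      have hws := openSegment_subset_segment ℝ x q hw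
      have hne := ne_of_mem_openSegment h hw
      exact ⟨mem_of w (Or.inl hws) hne.1 (fun h => hv' (h ▸ hws)), fun hwB => hne.2 (hi ⟨hws, hwB⟩)⟩
    -- Removing the tail first leaves a connected set. Only the first segment can then separate, and
    -- every resulting component touches its end `x`.
    rw [Set.union_comm, ← Set.sdiff_sdiff] at hC
    exact hC.left_mem_closure (hF.sdiff hB.polySet.isClosed)
      (hB.isPreconnected_sdiff hF hFc hv hBF) h (fun hq => hq.2 hB.left_mem) hsegF

/-- Boundary points of an open set in the complement of a locally conic set are accessible. -/
theorem LocallyConic.exists_segment {K : Set ℂ} (hK : LocallyConic K) (hFK : F ⊆ Kᶜ)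
    (hv : v ∈ closure F) {ε : ℝ} (hε : 0 < ε) :
    ∃ z ∈ F, dist z v < ε ∧ segment ℝ z v ⊆ Kᶜ ∪ {v} := by
  obtain ⟨δ, hδ, h⟩ := hK v
  obtain ⟨z, hz, hzF⟩ := mem_closure_iff.1 hv _ Metric.isOpen_ball
    (Metric.mem_ball_self (lt_min hε hδ))
  refine ⟨z, hzF, lt_of_lt_of_le hz (min_le_left _ _), ?_⟩
  rw [segment_symm, segment_eq_image']
  rintro _ ⟨t, ⟨ht0, ht1⟩, rfl⟩
  rcases ht0.eq_or_lt with rfl | ht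
  · right; simp
  · exact Or.inl fun hK' => hFK hzF (h z (lt_of_lt_of_le hz (min_le_right _ _)) t ht ht1 hK')

/-- In a component of the complement of a locally conic set, two boundary points can be joined by a
polygonal arc. -/
theorem IsComp.exists_pArc {K F : Set ℂ} {x v : ℂ} (hK : LocallyConic K) (hKc : IsClosed K)
    (hF : IsComp Kᶜ F) (hx : x ∈ closure F) (hv : v ∈ closure F) (hxK : x ∈ K) (hvK : v ∈ K)
    (hxv : x ≠ v) : ∃ A, PArc x v A ∧ A ⊆ F ∪ {x, v} := by
  have access : ∀ y ∈ closure F, y ∈ K → ∃ z ∈ F, segment ℝ z y ⊆ F ∪ {y} := by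
    intro y hy hyK
    obtain ⟨z, hz, -, hs⟩ := hK.exists_segment hF.subset hy one_pos
    refine ⟨z, hz, ?_⟩
    have hzy : z ≠ y := fun h => hF.subset hz (h ▸ hyK)
    have := hF.subset_of_inter (isPreconnected_segment_diff_right hzy)
      (fun w hw => (hs hw.1).resolve_right hw.2) ⟨z, ⟨left_mem_segment ℝ _ _, hzy⟩, hz⟩
    intro w hw
    by_cases hwy : w = y
    · exact Or.inr hwy
    · exact Or.inl (this ⟨hw, hwy⟩)
  obtain ⟨z₀, hz₀, hs₀⟩ := access v hv hvK
  obtain ⟨z₁, hz₁, hs₁⟩ := access x hx hxK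
  obtain ⟨A, hA, hAF⟩ := _root_.exists_pArc (hF.isOpen hKc.isOpen_compl) hF.isPreconnected
    (fun h => hF.subset h hvK) hz₀ hs₀ hz₁
  obtain ⟨A', hA', hsub⟩ := hA.extend (p := x) hxv
  refine ⟨A', hA', fun w hw => ?_⟩
  rcases hsub hw with h | h
  · rw [segment_symm] at h
    rcases hs₁ h with h | rfl
    · exact Or.inl h
    · exact Or.inr (Or.inl rfl)
  · rcases hAF h with h | rfl
    · exact Or.inl h
    · exact Or.inr (Or.inr rfl)

/-- A point `x` can be joined to finitely many points by a star of polygonal arcs, if it shares a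
face with each of them. -/
theorem exists_star {x : ℂ} (S : Finset ℂ) : ∀ {K : Set ℂ}, IsClosed K → LocallyConic K → x ∈ K →
    (∀ v ∈ S, v ∈ K ∧ v ≠ x ∧ ∃ F, IsComp Kᶜ F ∧ x ∈ closure F ∧ v ∈ closure F) →
    ∃ A : ℂ → Set ℂ, (∀ v ∈ S, PArc x v (A v) ∧ A v ∩ K ⊆ {x, v}) ∧
      ∀ v ∈ S, ∀ w ∈ S, v ≠ w → A v ∩ A w ⊆ {x} := by
  classical
  induction S using Finset.induction_on with
  | empty => exact fun _ _ _ _ => ⟨fun _ => ∅, by simp, by simp⟩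
  | @insert v S hvS ih =>
    intro K hKc hK hxK hS
    obtain ⟨hvK, hvx, F, hF, hxF, hvF⟩ := hS v (Finset.mem_insert_self v S)
    have hFo := hF.isOpen hKc.isOpen_compl
    obtain ⟨B, hB, hBF⟩ := hF.exists_pArc hK hKc hxF hvF hxK hvK hvx.symm
    have hBK : B ∩ K ⊆ {x, v} := fun w hw =>
      (hBF hw.1).resolve_left fun h => hF.subset h hw.2
    have hBc := hB.polySet.isClosed
    have hK' := hK.union hB.polySet.locallyConic
    have hKc' := hKc.union hBc
    obtain ⟨A, hA, hAA⟩ := ih hKc' hK' (Or.inl hxK) (by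
      intro w hw
      obtain ⟨hwK, hwx, G, hG, hxG, hwG⟩ := hS w (Finset.mem_insert_of_mem hw)
      have hwv : w ≠ v := fun h => hvS (h ▸ hw)
      have hwB : w ∉ B := fun h => (hBK ⟨h, hwK⟩).elim hwx hwv
      refine ⟨Or.inl hwK, hwx, ?_⟩
      -- If the common face of `x` and `w` is the face `F` cut by `B`, choose the part of `F \ B`
      -- near `w`; `x` is on its boundary, because every part has the end `x` of the arc on its
      -- boundary. Any other face is unaffected.
      by_cases hGF : (G ∩ F).Nonempty
      · have hGF' : G = F := Set.Subset.antisymm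
          (hF.subset_of_inter hG.isPreconnected hG.subset hGF)
          (hG.subset_of_inter hF.isPreconnected hF.subset (by rwa [Set.inter_comm]))
        subst hGF'
        have hGB : G \ B ⊆ (K ∪ B)ᶜ := fun z hz => by
          rintro (h | h)
          · exact hG.subset hz.1 h
          · exact hz.2 h
        have hwcl : w ∈ closure (G \ B) := by
          refine mem_closure_iff.2 fun O hO hwO => ?_
          obtain ⟨z, hz, hzG⟩ := mem_closure_iff.1 hwG _ (hO.inter hBc.isOpen_compl) ⟨hwO, hwB⟩
          exact ⟨z, hz.1, hzG, hz.2⟩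
        obtain ⟨z, hz, -, hs⟩ := hK'.exists_segment hGB hwcl one_pos
        have hzw : z ≠ w := fun h => hG.subset hz.1 (h ▸ hwK)
        have hC := isComp_connectedComponentIn (hGB hz)
        refine ⟨_, hC, ?_, ?_⟩
        · have hC' := isComp_connectedComponentIn hz
          refine closure_mono ?_ (hB.left_mem_closure hFo hF.isPreconnected
            (fun h => hF.subset h hvK) hBF hC')
          exact connectedComponentIn_mono z hGB
        · refine closure_mono ?_ (mem_closure_segment_diff_right hzw)
          exact hC.subset_of_inter (isPreconnected_segment_diff_right hzw)
            (fun y hy => (hs hy.1).resolve_right hy.2)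
            ⟨z, ⟨left_mem_segment ℝ _ _, hzw⟩, mem_connectedComponentIn (hGB hz)⟩
      · have hGK : G ⊆ (K ∪ B)ᶜ := by
          rintro z hz (h | h)
          · exact hG.subset hz h
          · rcases hBF h with h | rfl | rfl
            · exact hGF ⟨z, hz, h⟩
            · exact hG.subset hz hxK
            · exact hG.subset hz hvK
        obtain ⟨z, hz⟩ := hG.nonempty
        have hC := isComp_connectedComponentIn (hGK hz)
        have hsub := hC.subset_of_inter hG.isPreconnected hGK
          ⟨z, hz, mem_connectedComponentIn (hGK hz)⟩
        exact ⟨_, hC, closure_mono hsub hxG, closure_mono hsub hwG⟩)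
    have hnotB : ∀ w ∈ S, w ∉ B := fun w hw h => by
      obtain ⟨hwK, hwx, -⟩ := hS w (Finset.mem_insert_of_mem hw)
      exact (hBK ⟨h, hwK⟩).elim hwx fun h => hvS (h ▸ hw)
    have hAB : ∀ w ∈ S, A w ∩ B ⊆ {x} := by
      rintro w hw z ⟨hz, hzB⟩
      rcases (hA w hw).2 ⟨hz, Or.inr hzB⟩ with h | h
      · exact h
      · exact (hnotB w hw (h ▸ hzB)).elim
    have hne : ∀ w ∈ S, w ≠ v := fun w hw h => hvS (h ▸ hw)
    refine ⟨fun w => if w = v then B else A w, fun w hw => ?_, fun w hw y hy hwy => ?_⟩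
    · rcases Finset.mem_insert.1 hw with rfl | hw
      · simpa using ⟨hB, hBK⟩
      · simp only [if_neg (hne w hw)]
        exact ⟨(hA w hw).1, fun z hz => (hA w hw).2 ⟨hz.1, Or.inl hz.2⟩⟩
    · rcases Finset.mem_insert.1 hw with rfl | hwS <;> rcases Finset.mem_insert.1 hy with rfl | hyS
      · exact (hwy rfl).elim
      · simp only [if_neg (hne y hyS), if_true]
        rw [Set.inter_comm]
        exact hAB y hyS
      · simp only [if_neg (hne w hwS), if_true]
        exact hAB w hwS
      · simp only [if_neg (hne y hyS), if_neg (hne w hwS)]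
        exact hAA w hwS y hyS hwy

/-- A connected neighbourhood `F` of infinity with an accessible boundary point `e` contains a tree
`T` that joins `e`, infinity and a further point `x`, and whose removal leaves `F` connected. -/
theorem exists_tripod {R : ℝ} {e z₀ : ℂ} (hF : IsOpen F) (hFc : IsPreconnected F)
    (hR : ∀ z : ℂ, R < ‖z‖ → z ∈ F) (he : e ∉ F) (hz₀ : z₀ ∈ F) (hseg : segment ℝ z₀ e ⊆ F ∪ {e}) :
    ∃ (T : Set ℂ) (x : ℂ), IsClosed T ∧ LocallyConic T ∧ e ∈ T ∧ x ∈ T ∧ x ∈ F ∧ T ⊆ F ∪ {e} ∧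
      IsPreconnected (F \ T) ∧ x ∈ closure (F \ T) ∧ IsPreconnected (T \ {e, x}) ∧
      ¬ Bornology.IsBounded (T \ {e, x}) ∧ e ∈ closure (T \ {e, x}) ∧ x ∈ closure (T \ {e, x}) := by
  set R₀ : ℝ := max R 0 + 1 with hR₀
  have hR₀pos : 0 < R₀ := by have := le_max_right R 0; linarith
  have hRR₀ : R < R₀ := by have := le_max_left R 0; linarith
  have hrayF : realRay R₀ ⊆ F := fun z hz => hR z (by
    have := Complex.abs_re_le_norm z
    have := le_abs_self z.re
    linarith [hz.2])
  have hR₀F : (R₀ : ℂ) ∈ F := hrayF (by simp [realRay])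
  obtain ⟨A₀, hA₀, hA₀F⟩ := exists_pArc hF hFc he hz₀ hseg hR₀F
  -- Keeping only the part after the last hit makes the arc meet the ray to infinity from `h` in `h`
  -- alone, so the arc and the ray form a tree.
  obtain ⟨h', A, hA, hAA₀, hh', hAi⟩ := hA₀.exists_last (isClosed_realRay R₀) (fun h => he (hrayF h))
    ⟨_, hA₀.left_mem, by simp [realRay]⟩
  obtain ⟨h, rfl⟩ : ∃ h : ℝ, h' = h := ⟨h'.re, Complex.ext rfl (by simpa using hh'.1)⟩
  have hhR₀ : R₀ ≤ h := by simpa using hh'.2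
  have hAF : A ⊆ F ∪ {e} := hAA₀.trans hA₀F
  have hF₁ : IsOpen (F \ A) := hF.sdiff hA.polySet.isClosed
  have hF₁c : IsPreconnected (F \ A) := hA.isPreconnected_sdiff hF hFc he hAF
  obtain ⟨R₂, hR₂⟩ := hA.polySet.isCompact.isBounded.exists_norm_le
  have hfar : ∀ z : ℂ, max R R₂ < ‖z‖ → z ∈ F \ A := fun z hz =>
    ⟨hR z ((le_max_left _ _).trans_lt hz), fun hzA =>
      absurd (hR₂ z hzA) (not_le.2 ((le_max_right _ _).trans_lt hz))⟩
  have hF₂ : IsOpen ((F \ A) \ realRay h) := hF₁.sdiff (isClosed_realRay h)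
  have hF₂c : IsPreconnected ((F \ A) \ realRay h) := by
    refine isPreconnected_diff_realRay hF₁ hF₁c (fun hh => hh.2 hA.left_mem) (fun t ht => ?_) hfar
    have htR : (t : ℂ) ∈ realRay R₀ := ⟨by simp, by simpa using hhR₀.trans ht.le⟩
    refine ⟨hrayF htR, fun htA => ?_⟩
    have := hAi ⟨htA, htR⟩
    exact ht.ne' (Complex.ofReal_injective this)
  set m : ℝ := max h (max R R₂) + 1 with hm
  have hhm : h < m := (le_max_left _ _).trans_lt (lt_add_one _)
  have hRm : max R R₂ < m := (le_max_right _ _).trans_lt (lt_add_one _)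
  -- The third end `x` hangs on a short segment off the ray. As a leaf of the tree, it can be
  -- deleted without disconnecting the tree.
  set x : ℂ := m + Complex.I with hx
  have hxm : x ≠ m := by simp [hx]
  have hsegx : ∀ w ∈ segment ℝ x m, w ∈ F \ A ∧ 0 ≤ w.im ∧ (w.im = 0 → w = m) := by
    intro w hw
    rw [segment_symm, segment_eq_image'] at hw
    obtain ⟨t, ⟨ht0, ht1⟩, rfl⟩ := hw
    refine ⟨hfar _ (hRm.trans_le ?_), by simpa [hx] using ht0, fun h0 => ?_⟩
    · refine le_trans ?_ (Complex.abs_re_le_norm _)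
      simp [hx, le_abs_self]
    · have : t = 0 := by simpa [hx] using h0
      simp [this]
  have hmF₂ : (m : ℂ) ∉ (F \ A) \ realRay h := fun hm' => hm'.2 ⟨by simp, by simpa using hhm.le⟩
  have hxF₂ : x ∈ (F \ A) \ realRay h :=
    ⟨(hsegx x (left_mem_segment ℝ _ _)).1, fun hx' => by simpa [hx] using hx'.1⟩
  have hF₃c : IsPreconnected (((F \ A) \ realRay h) \ segment ℝ x m) := by
    refine isPreconnected_diff_segment hF₂ hF₂c hxF₂ hmF₂ fun w hw => ?_
    obtain ⟨h1, h2, h3⟩ := hsegx w (openSegment_subset_segment ℝ _ _ hw)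
    exact ⟨h1, fun h4 => (ne_of_mem_openSegment hxm hw).2 (h3 h4.1)⟩
  have hdiff : F \ (A ∪ realRay h ∪ segment ℝ x m) = ((F \ A) \ realRay h) \ segment ℝ x m := by
    rw [Set.sdiff_sdiff, Set.sdiff_sdiff, Set.union_assoc]
  have hrayhF : realRay h ⊆ F := fun z hz => hrayF ⟨hz.1, hhR₀.trans hz.2⟩
  have hT' : (A ∪ realRay h ∪ segment ℝ x m) \ {e, x} =
      (A \ {e}) ∪ realRay h ∪ (segment ℝ m x \ {x}) := by
    rw [segment_symm ℝ (m : ℂ) x]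
    ext w
    constructor
    · rintro ⟨(hw | hw) | hw, hne⟩
      · exact Or.inl (Or.inl ⟨hw, fun h => hne (Or.inl h)⟩)
      · exact Or.inl (Or.inr hw)
      · exact Or.inr ⟨hw, fun h => hne (Or.inr h)⟩
    · rintro ((hw | hw) | hw)
      · refine ⟨Or.inl (Or.inl hw.1), ?_⟩
        rintro (h | h)
        · exact hw.2 h
        · exact hxF₂.1.2 (h ▸ hw.1)
      · refine ⟨Or.inl (Or.inr hw), ?_⟩
        rintro (h | h)
        · exact he (h ▸ hrayhF hw)
        · exact hxF₂.2 (h ▸ hw)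
      · refine ⟨Or.inr hw.1, ?_⟩
        rintro (h | h)
        · exact he (h ▸ (hsegx w hw.1).1.1)
        · exact hw.2 h
  have hhray : (h : ℂ) ∈ realRay h := by simp [realRay]
  have hmray : (m : ℂ) ∈ realRay h := ⟨by simp, by simpa using hhm.le⟩
  refine ⟨A ∪ realRay h ∪ segment ℝ x m, x, ?_, ?_, Or.inl (Or.inl hA.right_mem),
    Or.inr (left_mem_segment ℝ _ _), hxF₂.1.1, ?_, hdiff ▸ hF₃c, ?_, ?_, ?_, ?_, ?_⟩
  · exact (hA.polySet.isClosed.union (isClosed_realRay h)).union (isClosed_segment _ _)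
  · exact (hA.polySet.locallyConic.union (locallyConic_realRay h)).union (locallyConic_segment _ _)
  · rintro w ((hw | hw) | hw)
    · exact hAF hw
    · exact Or.inl (hrayhF hw)
    · exact Or.inl (hsegx w hw).1.1
  · rw [hdiff]
    exact closure_diff_of_interior_eq_empty hF₂ (interior_segment _ _) hxF₂
  · rw [hT']
    have hpre : IsPreconnected (realRay h) := by
      have : realRay h = (fun t : ℝ => (t : ℂ)) '' Set.Ici h := by
        ext z
        constructor
        · rintro ⟨h1, h2⟩
          exact ⟨z.re, h2, Complex.ext rfl (by simpa using h1.symm)⟩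
        · rintro ⟨t, ht, rfl⟩
          exact ⟨by simp, by simpa using ht⟩
      rw [this]
      exact isPreconnected_Ici.image _ (by fun_prop)
    refine IsPreconnected.union' ?_ (IsPreconnected.union' ?_ hA.isPreconnected_diff hpre)
      (isPreconnected_segment_diff_right hxm.symm)
    · exact ⟨m, Or.inr hmray, left_mem_segment ℝ _ _, hxm.symm⟩
    · exact ⟨h, ⟨hA.left_mem, fun h' => he (h' ▸ hrayhF hhray)⟩, hhray⟩
  · rw [hT']
    intro hb
    obtain ⟨M, hM⟩ := hb.exists_norm_le
    have := hM ((max h M + 1 : ℝ) : ℂ) (Or.inl (Or.inr ⟨by simp, by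
      have := le_max_left h M
      simp only [Complex.ofReal_re]; linarith⟩))
    rw [Complex.norm_real, Real.norm_eq_abs] at this
    have h1 := le_abs_self (max h M + 1)
    have h2 := le_max_right h M
    linarith
  · rw [hT']
    exact closure_mono (Set.subset_union_left.trans Set.subset_union_left) hA.right_mem_closure
  · rw [hT']
    exact closure_mono Set.subset_union_right (mem_closure_segment_diff_right hxm.symm)

end PArc

/-! ### The exterior face -/

section Outer

/-- The union of the unbounded components of the complement of `K`. -/
def outer (K : Set ℂ) : Set ℂ :=
  {z | z ∈ Kᶜ ∧ ¬ Bornology.IsBounded (connectedComponentIn Kᶜ z)}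

variable {K L T : Set ℂ}

theorem isPreconnected_outside {R : ℝ} (hR : 0 ≤ R) : IsPreconnected {z : ℂ | R < ‖z‖} := by
  have hopen : IsOpen {z : ℂ | R < ‖z‖} := isOpen_lt continuous_const continuous_norm
  have hint : interior (realRay 0) = ∅ := by
    by_contra h
    obtain ⟨z, hz, hs⟩ := exists_mem_side_ne_zero isOpen_interior (Set.nonempty_iff_ne_empty.2 h) 0
      one_ne_zero
    exact hs (by simpa [side] using (interior_subset hz).1)
  exact (isPreconnected_outside_diff_realRay hR).subset_closure Set.sdiff_subset
    (closure_diff_of_interior_eq_empty hopen hint)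

/-- The outside of a large disk is connected and misses `K`. Every unbounded component meets it and
so contains it, hence there is only one. -/
theorem isComp_outer (hK : IsCompact K) :
    IsComp Kᶜ (outer K) ∧ ∃ R : ℝ, ∀ z : ℂ, R < ‖z‖ → z ∈ outer K := by
  obtain ⟨R, hR⟩ := hK.isBounded.exists_norm_le
  set R' := max R 0 with hR'
  have hO := isPreconnected_outside (le_max_right R 0)
  have hOK : {z : ℂ | R' < ‖z‖} ⊆ Kᶜ := fun z hz hzK =>
    absurd (hR z hzK) (not_le.2 ((le_max_left _ _).trans_lt hz))
  have hOunb : ∀ M : ℝ, ∃ z : ℂ, R' < ‖z‖ ∧ M < ‖z‖ := fun M => by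
    have h1 := le_max_left R' |M|
    have h2 := (le_abs_self M).trans (le_max_right R' |M|)
    have h3 : 0 ≤ R' := le_max_right R 0
    refine ⟨((max R' |M| + 1 : ℝ) : ℂ), ?_, ?_⟩ <;> rw [Complex.norm_real, Real.norm_eq_abs,
      abs_of_pos (by linarith)] <;> linarith
  have hmem : ∀ z ∈ Kᶜ, ¬ Bornology.IsBounded (connectedComponentIn Kᶜ z) ↔
      {z : ℂ | R' < ‖z‖} ⊆ connectedComponentIn Kᶜ z := by
    intro z hz
    constructor
    · intro hb
      have : ∃ w ∈ connectedComponentIn Kᶜ z, R' < ‖w‖ := by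
        by_contra! hno
        exact hb (isBounded_iff_forall_norm_le.2 ⟨R', hno⟩)
      obtain ⟨w, hw, hwR⟩ := this
      exact (isComp_connectedComponentIn hz).subset_of_inter hO hOK ⟨w, hwR, hw⟩
    · intro hsub hb
      obtain ⟨M, hM⟩ := hb.exists_norm_le
      obtain ⟨w, hw, hwM⟩ := hOunb M
      exact absurd (hM w (hsub hw)) (not_le.2 hwM)
  obtain ⟨o, ho, -⟩ := hOunb 0
  have heq : outer K = connectedComponentIn Kᶜ o := by
    ext z
    constructor
    · rintro ⟨hz, hzb⟩
      have := (hmem z hz).1 hzb ho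
      rw [← connectedComponentIn_eq this]
      exact mem_connectedComponentIn hz
    · intro hz
      have hzK := connectedComponentIn_subset _ _ hz
      refine ⟨hzK, (hmem z hzK).2 ?_⟩
      rw [← connectedComponentIn_eq hz]
      exact hO.subset_connectedComponentIn ho hOK
  refine ⟨⟨o, hOK ho, heq⟩, R', fun z hz => ?_⟩
  rw [heq]
  exact hO.subset_connectedComponentIn ho hOK hz

theorem subset_outer (hT : IsPreconnected T) (hTK : T ⊆ Kᶜ) (hb : ¬ Bornology.IsBounded T) :
    T ⊆ outer K := fun _ hz =>
  ⟨hTK hz, fun h => hb (h.subset (hT.subset_connectedComponentIn hz hTK))⟩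

theorem outer_anti (h : K ⊆ L) : outer L ⊆ outer K := fun z hz =>
  ⟨fun hzK => hz.1 (h hzK), fun hb => hz.2 (hb.subset
    (connectedComponentIn_mono z (Set.compl_subset_compl.2 h)))⟩

theorem not_isBounded_outer_diff (hK : IsCompact K) (hL : Bornology.IsBounded L) :
    ¬ Bornology.IsBounded (outer K \ L) := by
  obtain ⟨-, R, hR⟩ := isComp_outer hK
  intro hb
  obtain ⟨M, hM⟩ := (hb.union hL).exists_norm_le
  have h1 := (le_abs_self R).trans (le_max_left |R| |M|)
  have h2 := (le_abs_self M).trans (le_max_right |R| |M|)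
  have h3 : ‖((max |R| |M| + 1 : ℝ) : ℂ)‖ = max |R| |M| + 1 := by
    rw [Complex.norm_real, Real.norm_eq_abs, abs_of_nonneg]
    have := (abs_nonneg R).trans (le_max_left |R| |M|)
    linarith
  have h4 := hR ((max |R| |M| + 1 : ℝ) : ℂ) (by rw [h3]; linarith)
  by_cases hmem : ((max |R| |M| + 1 : ℝ) : ℂ) ∈ L
  · have := hM _ (Or.inr hmem)
    rw [h3] at this; linarith
  · have := hM _ (Or.inl ⟨h4, hmem⟩)
    rw [h3] at this; linarith

/-- Attaching a segment by one end does not shrink the closure of the exterior face. -/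
theorem closure_outer_subset {p z : ℂ} (hK : IsCompact K) (hp : p ∈ K) (hz : z ∉ K)
    (hi : segment ℝ z p ∩ K ⊆ {p}) :
    closure (outer K) ⊆ closure (outer (K ∪ segment ℝ z p)) := by
  have hE := (isComp_outer hK).1
  have hEo := hE.isOpen hK.isClosed.isOpen_compl
  have hzp : z ≠ p := fun h => hz (h ▸ hp)
  have hpE : p ∉ outer K := fun h => h.1 hp
  have hsub : segment ℝ z p \ {p} ⊆ Kᶜ := fun w hw hwK => hw.2 (hi ⟨hw.1, hwK⟩)
  have hpre : IsPreconnected (outer K \ segment ℝ z p) := by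
    -- The segment without its attached end is connected and avoids `K`. So it lies in the exterior
    -- face, where it is a cut with a free end, or misses that face altogether.
    by_cases hne : ((segment ℝ z p \ {p}) ∩ outer K).Nonempty
    · have := hE.subset_of_inter (isPreconnected_segment_diff_right hzp) hsub hne
      refine isPreconnected_diff_segment hEo hE.isPreconnected
        (this ⟨left_mem_segment ℝ _ _, hzp⟩) hpE fun w hw => ?_
      exact this ⟨openSegment_subset_segment ℝ _ _ hw, (ne_of_mem_openSegment hzp hw).2⟩
    · have : outer K \ segment ℝ z p = outer K := by
        refine sdiff_eq_left.2 (Set.disjoint_left.2 fun w hw hws => ?_)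
        exact hne ⟨w, ⟨hws, fun h => hpE (h ▸ hw)⟩, hw⟩
      rw [this]
      exact hE.isPreconnected
  refine (closure_subset_closure_diff hEo (interior_segment z p)).trans (closure_mono ?_)
  refine subset_outer hpre ?_ (not_isBounded_outer_diff hK (isCompact_segment z p).isBounded)
  rintro w ⟨hw, hws⟩ (h | h)
  · exact hw.1 h
  · exact hws h

end Outer

/-! ### Induced drawings and peeling -/

theorem IsPolygonalArc.polySet {A : Set ℂ} {p q : ℂ} (h : IsPolygonalArc A p q) : PolySet A := h.2

theorem IsPolygonalArc.symm {A : Set ℂ} {p q : ℂ} (h : IsPolygonalArc A p q) :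
    IsPolygonalArc A q p := by
  obtain ⟨⟨γ, hγ, hr⟩, hs⟩ := h
  exact ⟨⟨γ.symm, fun s t hst => unitInterval.symm_bijective.injective (hγ hst),
    by rw [Path.symm_range, hr]⟩, hs⟩

/-- Removing an end of an arc leaves a connected set with that end in its closure. -/
theorem IsPolygonalArc.diff_right {A : Set ℂ} {p q : ℂ} (h : IsPolygonalArc A p q) :
    p ∈ A ∧ IsPreconnected (A \ {q}) ∧ q ∈ closure (A \ {q}) := by
  obtain ⟨⟨γ, hγ, rfl⟩, -⟩ := h
  have heq : Set.range γ \ {q} = γ.extend '' Set.Ico 0 1 := by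
    ext z
    constructor
    · rintro ⟨⟨t, rfl⟩, hne⟩
      refine ⟨t, ⟨t.2.1, lt_of_le_of_ne t.2.2 fun h => hne ?_⟩, by simp⟩
      have : t = 1 := Subtype.ext h
      rw [this]; exact γ.target
    · rintro ⟨t, ht, rfl⟩
      have ht' : t ∈ Set.Icc (0 : ℝ) 1 := ⟨ht.1, ht.2.le⟩
      rw [Path.extend_apply γ ht']
      refine ⟨⟨_, rfl⟩, fun h => ?_⟩
      have := hγ ((show γ ⟨t, ht'⟩ = q from h).trans γ.target.symm)
      exact ht.2.ne (congrArg Subtype.val this)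
  refine ⟨⟨0, γ.source⟩, ?_, ?_⟩
  · rw [heq]
    exact isPreconnected_Ico.image _ γ.continuous_extend.continuousOn
  · rw [heq]
    refine image_closure_subset_closure_image γ.continuous_extend ⟨1, ?_, by simp⟩
    rw [closure_Ico zero_ne_one]
    exact ⟨zero_le_one, le_rfl⟩

namespace PlanarDrawing

variable {V V' : Type*} {G : SimpleGraph V} {G' : SimpleGraph V'} (D : PlanarDrawing G)

theorem arc_polySet {e : Sym2 V} (he : e ∈ G.edgeSet) : PolySet (D.arc e) := by
  induction e with
  | h u v => exact (D.isArc u v he).polySet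

theorem polySet_support [Finite V] (W : Set V) : PolySet (D.support W) := by
  refine PolySet.union ?_ (PolySet.biUnion (Set.toFinite _) fun e he => D.arc_polySet he.1)
  rw [← Set.biUnion_of_singleton (D.pt '' W)]
  exact PolySet.biUnion (Set.toFinite _) fun _ _ => polySet_singleton _

theorem exteriorFace_eq (W : Set V) : D.exteriorFace W = outer (D.support W) := rfl

variable {D}

theorem mem_support_pt {W : Set V} {v : V} (hv : v ∈ W) : D.pt v ∈ D.support W :=
  Or.inl ⟨v, hv, rfl⟩

theorem arc_subset_support {W : Set V} {e : Sym2 V} (he : e ∈ G.edgeSet) (heW : ∀ v ∈ e, v ∈ W) :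
    D.arc e ⊆ D.support W := fun _ hz => Or.inr (Set.mem_biUnion ⟨he, heW⟩ hz)

theorem mem_support {W : Set V} {z : ℂ} : z ∈ D.support W ↔ (∃ v ∈ W, D.pt v = z) ∨
    ∃ e ∈ G.edgeSet, (∀ v ∈ e, v ∈ W) ∧ z ∈ D.arc e := by
  simp [support, and_assoc]

theorem support_mono {W W' : Set V} (h : W ⊆ W') : D.support W ⊆ D.support W' := by
  intro z hz
  rw [mem_support] at hz ⊢
  rcases hz with ⟨v, hv, rfl⟩ | ⟨e, he, heW, hz⟩
  · exact Or.inl ⟨v, h hv, rfl⟩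
  · exact Or.inr ⟨e, he, fun v hv => h (heW v hv), hz⟩

theorem isOuterplanarOn_empty : ∀ k, D.IsOuterplanarOn k ∅
  | 0 => rfl
  | k + 1 => by
    rw [IsOuterplanarOn, Set.empty_sdiff]
    exact isOuterplanarOn_empty k

/-- Outerplanarity passes to a drawing whose vertices and edges are among those of another one. -/
theorem IsOuterplanarOn.of_support_subset {D' : PlanarDrawing G'} (f : V' → V)
    (hpt : ∀ v, D'.pt v = D.pt (f v)) (hs : ∀ W, D'.support W ⊆ D.support (f '' W)) :
    ∀ {k : ℕ} {W : Set V} {W' : Set V'}, D.IsOuterplanarOn k W → f '' W' ⊆ W →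
      D'.IsOuterplanarOn k W'
  | 0, W, W', h, hW => by
    rw [IsOuterplanarOn] at h ⊢
    rw [h, Set.subset_empty_iff, Set.image_eq_empty] at hW
    exact hW
  | k + 1, W, W', h, hW => by
    rw [IsOuterplanarOn] at h ⊢
    refine IsOuterplanarOn.of_support_subset f hpt hs h ?_
    rintro _ ⟨v, ⟨hv, hve⟩, rfl⟩
    -- Fewer points give a larger exterior face, so each vertex is peeled no later than in the
    -- larger drawing.
    refine ⟨hW ⟨v, hv, rfl⟩, fun hve' => hve ⟨hv, ?_⟩⟩
    rw [hpt]
    exact closure_mono (outer_anti ((hs W').trans (support_mono hW))) hve'.2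

/-- The drawing of (a graph isomorphic to) a subgraph. -/
def comap (D : PlanarDrawing G) (f : V' → V) (hf : Function.Injective f)
    (hG : ∀ u v, G'.Adj u v → G.Adj (f u) (f v)) : PlanarDrawing G' where
  pt v := D.pt (f v)
  arc e := D.arc (e.map f)
  pt_injective := D.pt_injective.comp hf
  isArc u v h := D.isArc _ _ (hG u v h)
  mem_of_pt_mem_arc e he w hw := by
    induction e with
    | h u v =>
      have := D.mem_of_pt_mem_arc _ (hG u v he) (f w) hw
      rw [Sym2.map_mk, Sym2.mem_iff] at this
      rw [Sym2.mem_iff]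
      exact this.imp (fun h => hf h) fun h => hf h
  arc_inter_arc e he e' he' hne := by
    induction e with
    | h u v =>
      induction e' with
      | h u' v' =>
        rintro z ⟨hz, hz'⟩
        obtain ⟨w, rfl⟩ := D.arc_inter_arc _ (hG u v he) _ (hG u' v' he')
          (fun h => hne (Sym2.map.injective hf h)) ⟨hz, hz'⟩
        have hw := D.mem_of_pt_mem_arc _ (hG u v he) w hz
        rcases Sym2.mem_iff.1 hw with rfl | rfl
        · exact ⟨u, rfl⟩
        · exact ⟨v, rfl⟩

theorem support_comap_subset (f : V' → V) (hf : Function.Injective f)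
    (hG : ∀ u v, G'.Adj u v → G.Adj (f u) (f v)) (W : Set V') :
    (D.comap f hf hG).support W ⊆ D.support (f '' W) := by
  intro z hz
  rw [mem_support] at hz ⊢
  rcases hz with ⟨v, hv, rfl⟩ | ⟨e, he, heW, hz⟩
  · exact Or.inl ⟨f v, ⟨v, hv, rfl⟩, rfl⟩
  · induction e with
    | h u v =>
      refine Or.inr ⟨s(f u, f v), hG u v he, fun w hw => ?_, hz⟩
      rcases Sym2.mem_iff.1 hw with rfl | rfl
      · exact ⟨u, heW u (Sym2.mem_mk_left _ _), rfl⟩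
      · exact ⟨v, heW v (Sym2.mem_mk_right _ _), rfl⟩

theorem IsOuterplanarOn.comap {f : V' → V} (hf : Function.Injective f)
    (hG : ∀ u v, G'.Adj u v → G.Adj (f u) (f v)) {k : ℕ} {W : Set V} {W' : Set V'}
    (h : D.IsOuterplanarOn k W) (hW : f '' W' ⊆ W) : (D.comap f hf hG).IsOuterplanarOn k W' :=
  h.of_support_subset f (fun _ => rfl) (support_comap_subset f hf hG) hW

theorem mem_exteriorVertices_comap {f : V' → V} (hf : Function.Injective f)
    (hG : ∀ u v, G'.Adj u v → G.Adj (f u) (f v)) {W : Set V} {W' : Set V'} (hW : f '' W' ⊆ W)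
    {v : V'} (hv : v ∈ W') (h : f v ∈ D.exteriorVertices W) :
    v ∈ (D.comap f hf hG).exteriorVertices W' :=
  ⟨hv, closure_mono (outer_anti ((support_comap_subset f hf hG W').trans (support_mono hW))) h.2⟩

/-- A vertex adjacent to a vertex on the exterior face gets exposed when the vertices on the
exterior face are removed. -/
theorem mem_exteriorVertices_diff [Finite V] {W : Set V} {u v : V} (huv : G.Adj u v)
    (hu : u ∈ D.exteriorVertices W) (hv : v ∈ W) (hve : v ∉ D.exteriorVertices W) :
    v ∈ D.exteriorVertices (W \ D.exteriorVertices W) := by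
  set W' := W \ D.exteriorVertices W with hW'
  have hvW' : v ∈ W' := ⟨hv, hve⟩
  have huW' : u ∉ W' := fun h => h.2 hu
  refine ⟨hvW', ?_⟩
  rw [exteriorFace_eq]
  obtain ⟨humem, hpre, hcl⟩ := (D.isArc u v huv).diff_right
  have hcomp := (D.polySet_support W').isCompact
  -- Once `u` is removed, the edge from `u` to `v` is free of the remaining drawing except at `v`.
  -- It thus connects the old exterior face to `v`.
  have hsub : D.arc s(u, v) \ {D.pt v} ⊆ (D.support W')ᶜ := by
    rintro z ⟨hz, hzv⟩ hzW
    rw [mem_support] at hzW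
    have hpt : ∀ w ∈ W', D.pt w = z → False := by
      rintro w hw rfl
      rcases Sym2.mem_iff.1 (D.mem_of_pt_mem_arc _ huv w hz) with rfl | rfl
      · exact huW' hw
      · exact hzv rfl
    rcases hzW with ⟨w, hw, rfl⟩ | ⟨e, he, heW, hze⟩
    · exact hpt w hw rfl
    · have hne : s(u, v) ≠ e := fun h => huW' (heW u (h ▸ Sym2.mem_mk_left u v))
      obtain ⟨w, rfl⟩ := D.arc_inter_arc _ huv _ he hne ⟨hz, hze⟩
      exact hpt w (heW w (D.mem_of_pt_mem_arc e he w hze)) rfl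
  have hpu : D.pt u ∈ D.arc s(u, v) \ {D.pt v} := ⟨humem, fun h => huv.ne (D.pt_injective h)⟩
  have hE := (isComp_outer hcomp).1
  have huE : D.pt u ∈ outer (D.support W') := by
    refine hE.mem_of_mem_closure hcomp.isClosed.isOpen_compl (hsub hpu) ?_
    exact closure_mono (outer_anti (support_mono Set.sdiff_subset)) hu.2
  exact closure_mono (hE.subset_of_inter hpre hsub ⟨_, hpu, huE⟩) hcl

end PlanarDrawing

/-! ### Adding a vertex to a drawing: stars and leaves -/

/-- The graph obtained from `G` by adding a vertex `none` with neighbourhood `N`. -/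
def addVertex {V : Type*} (G : SimpleGraph V) (N : Set V) : SimpleGraph (Option V) where
  Adj a b := match a, b with
    | some u, some v => G.Adj u v
    | none, some v => v ∈ N
    | some v, none => v ∈ N
    | none, none => False
  symm := ⟨by rintro (_ | u) (_ | v) h; exacts [h, h, h, G.adj_symm h]⟩
  loopless := ⟨by rintro (_ | u) h; exacts [h, G.loopless.irrefl u h]⟩

namespace PlanarDrawing

variable {V : Type*} {G : SimpleGraph V}

/-- The arcs of a drawing with one more vertex. -/
def addArc (D : PlanarDrawing G) (A : V → Set ℂ) : Sym2 (Option V) → Set ℂ :=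
  Sym2.lift ⟨fun a b => match a, b with
    | some u, some v => D.arc s(u, v)
    | none, some v => A v
    | some v, none => A v
    | none, none => ∅, by
      rintro (_ | u) (_ | v)
      · rfl
      · rfl
      · rfl
      · show D.arc s(u, v) = D.arc s(v, u)
        rw [Sym2.eq_swap]⟩

theorem addVertex_edge_cases {N : Set V} {e : Sym2 (Option V)} (he : e ∈ (addVertex G N).edgeSet) :
    (∃ e' ∈ G.edgeSet, e = e'.map some ∧ ∀ (D : PlanarDrawing G) (A : V → Set ℂ),
      D.addArc A e = D.arc e') ∨
    ∃ v ∈ N, e = s(none, some v) ∧ ∀ (D : PlanarDrawing G) (A : V → Set ℂ), D.addArc A e = A v := by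
  induction e with
  | h a b =>
    match a, b, he with
    | some u, some v, he => exact Or.inl ⟨s(u, v), he, rfl, fun _ _ => rfl⟩
    | none, some v, he => exact Or.inr ⟨v, he, rfl, fun _ _ => rfl⟩
    | some v, none, he => exact Or.inr ⟨v, he, Sym2.eq_swap, fun _ _ => rfl⟩

/-- Adding a vertex to a drawing. -/
def addVertex (D : PlanarDrawing G) {N : Set V} {x : ℂ} {A : V → Set ℂ}
    (hx : x ∉ D.support Set.univ) (hA : ∀ v ∈ N, IsPolygonalArc (A v) x (D.pt v))
    (hAs : ∀ v ∈ N, A v ∩ D.support Set.univ ⊆ {D.pt v})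
    (hAA : ∀ v ∈ N, ∀ w ∈ N, v ≠ w → A v ∩ A w ⊆ {x}) : PlanarDrawing (addVertex G N) where
  pt a := a.elim x D.pt
  arc := D.addArc A
  pt_injective := by
    rintro (_ | u) (_ | v) h
    · rfl
    · exact (hx (by rw [show x = D.pt v from h]; exact mem_support_pt (Set.mem_univ v))).elim
    · exact (hx (by rw [← show D.pt u = x from h]; exact mem_support_pt (Set.mem_univ u))).elim
    · exact congrArg some (D.pt_injective h)
  isArc := by
    rintro (_ | u) (_ | v) h
    · exact h.elim
    · exact hA v h
    · exact (hA u h).symm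
    · exact D.isArc u v h
  mem_of_pt_mem_arc e he w hw := by
    rcases addVertex_edge_cases he with ⟨e', he', rfl, h⟩ | ⟨v, hv, rfl, h⟩
    · rw [h] at hw
      rcases w with _ | w
      · exact (hx (arc_subset_support he' (fun _ _ => Set.mem_univ _) hw)).elim
      · exact Sym2.mem_map.2 ⟨w, D.mem_of_pt_mem_arc e' he' w hw, rfl⟩
    · rw [h] at hw
      rcases w with _ | w
      · exact Sym2.mem_mk_left _ _
      · have := D.pt_injective (hAs v hv ⟨hw, mem_support_pt (Set.mem_univ w)⟩)
        rw [this]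
        exact Sym2.mem_mk_right _ _
  arc_inter_arc e he f hf hne := by
    rintro z ⟨hz, hz'⟩
    rcases addVertex_edge_cases he with ⟨e', he', rfl, h⟩ | ⟨v, hv, rfl, h⟩ <;>
      rcases addVertex_edge_cases hf with ⟨f', hf', rfl, h'⟩ | ⟨w, hw, rfl, h'⟩ <;>
      rw [h] at hz <;> rw [h'] at hz'
    · obtain ⟨v, rfl⟩ := D.arc_inter_arc e' he' f' hf' (fun h => hne (by rw [h])) ⟨hz, hz'⟩
      exact ⟨some v, rfl⟩
    · exact ⟨some w, (hAs w hw ⟨hz', arc_subset_support he' (fun _ _ => Set.mem_univ _) hz⟩).symm⟩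
    · exact ⟨some v, (hAs v hv ⟨hz, arc_subset_support hf' (fun _ _ => Set.mem_univ _) hz'⟩).symm⟩
    · exact ⟨none, (hAA v hv w hw (fun h => hne (by rw [h])) ⟨hz, hz'⟩).symm⟩

section AddVertex

variable {D : PlanarDrawing G} {N : Set V} {x : ℂ} {A : V → Set ℂ}
    (hx : x ∉ D.support Set.univ) (hA : ∀ v ∈ N, IsPolygonalArc (A v) x (D.pt v))
    (hAs : ∀ v ∈ N, A v ∩ D.support Set.univ ⊆ {D.pt v})
    (hAA : ∀ v ∈ N, ∀ w ∈ N, v ≠ w → A v ∩ A w ⊆ {x})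

theorem support_addVertex_subset (W : Set (Option V)) :
    (D.addVertex hx hA hAs hAA).support W ⊆ D.support (some ⁻¹' W) ∪ ({x} ∪ ⋃ v ∈ N, A v) := by
  intro z hz
  rcases mem_support.1 hz with ⟨_ | v, hv, rfl⟩ | ⟨e, he, heW, hz⟩
  · exact Or.inr (Or.inl rfl)
  · exact Or.inl (mem_support_pt hv)
  · rcases addVertex_edge_cases he with ⟨e', he', rfl, h⟩ | ⟨v, hv, rfl, h⟩
    · exact Or.inl (arc_subset_support he' (fun v hv => heW _ (Sym2.mem_map.2 ⟨v, hv, rfl⟩))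
        ((h D A).subset hz))
    · exact Or.inr (Or.inr (Set.mem_biUnion hv ((h D A).subset hz)))

theorem support_addVertex_subset' {W : Set (Option V)} (hW : none ∉ W) :
    (D.addVertex hx hA hAs hAA).support W ⊆ D.support (some ⁻¹' W) := by
  intro z hz
  rcases mem_support.1 hz with ⟨_ | v, hv, rfl⟩ | ⟨e, he, heW, hz⟩
  · exact (hW hv).elim
  · exact mem_support_pt hv
  · rcases addVertex_edge_cases he with ⟨e', he', rfl, h⟩ | ⟨v, hv, rfl, h⟩
    · exact arc_subset_support he' (fun v hv => heW _ (Sym2.mem_map.2 ⟨v, hv, rfl⟩))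
        ((h D A).subset hz)
    · exact (hW (heW _ (Sym2.mem_mk_left _ _))).elim

/-- As soon as the new vertex has been peeled away, none of its edges remain, and the old drawing
governs the later rounds. -/
theorem IsOuterplanarOn.addVertex_of_subset : ∀ {k : ℕ} {W : Set V} {W' : Set (Option V)},
    D.IsOuterplanarOn k W → W' ⊆ some '' W → (D.addVertex hx hA hAs hAA).IsOuterplanarOn k W'
  | 0, W, W', h, hW => by
    rw [IsOuterplanarOn] at h ⊢
    rwa [h, Set.image_empty, Set.subset_empty_iff] at hW
  | k + 1, W, W', h, hW => by
    rw [IsOuterplanarOn] at h ⊢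
    refine IsOuterplanarOn.addVertex_of_subset h fun a ha => ?_
    obtain ⟨v, hv, rfl⟩ := hW ha.1
    have hnone : none ∉ W' := fun h => by
      obtain ⟨w, -, hw⟩ := hW h
      cases hw
    refine ⟨v, ⟨hv, fun hve => ha.2 ⟨ha.1, ?_⟩⟩, rfl⟩
    refine closure_mono (outer_anti ((support_addVertex_subset' hx hA hAs hAA hnone).trans
      (support_mono fun w hw => ?_))) hve.2
    obtain ⟨w', hw', h⟩ := hW hw
    exact Option.some_injective V h ▸ hw'

end AddVertex

variable [Finite V] {D : PlanarDrawing G}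

/-- A new vertex can be joined to all vertices on the exterior face other than `e`, so that `e`
stays on the exterior face. -/
theorem exists_addVertex_star {k : ℕ} (hD : D.IsOuterplanar k) {e : V}
    (he : e ∈ D.exteriorVertices Set.univ) {N : Set V} (hN : N ⊆ D.exteriorVertices Set.univ)
    (heN : e ∉ N) : ∃ D' : PlanarDrawing (_root_.addVertex G N), D'.IsOuterplanar (k + 1) ∧
      none ∈ D'.exteriorVertices Set.univ ∧ some e ∈ D'.exteriorVertices Set.univ := by
  classical
  have hpoly := D.polySet_support Set.univ
  have hS := hpoly.isCompact
  set S := D.support Set.univ with hSdef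
  obtain ⟨hE, R, hR⟩ := isComp_outer hS
  have hEo := hE.isOpen hS.isClosed.isOpen_compl
  have hptS : ∀ v, D.pt v ∈ S := fun v => mem_support_pt (Set.mem_univ v)
  have hptE : ∀ v, D.pt v ∉ outer S := fun v h => h.1 (hptS v)
  obtain ⟨z₀, hz₀, -, hs⟩ := hpoly.locallyConic.exists_segment hE.subset he.2 one_pos
  have hz₀e : z₀ ≠ D.pt e := fun h => hptE e (h ▸ hz₀)
  have hseg : segment ℝ z₀ (D.pt e) ⊆ outer S ∪ {D.pt e} := fun w hw => by
    by_cases hwe : w = D.pt e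
    · exact Or.inr hwe
    · exact Or.inl (hE.subset_of_inter (isPreconnected_segment_diff_right hz₀e)
        (fun y hy => (hs hy.1).resolve_right hy.2) ⟨z₀, ⟨left_mem_segment ℝ _ _, hz₀e⟩, hz₀⟩ ⟨hw, hwe⟩)
  obtain ⟨T, x, hTc, hT, heT, hxT, hxE, hTE, hETc, hxcl, hTp, hTb, heT', hxT'⟩ :=
    exists_tripod hEo hE.isPreconnected hR (hptE e) hz₀ hseg
  have hK : IsClosed (S ∪ T) := hS.isClosed.union hTc
  have hET : outer S \ T ⊆ (S ∪ T)ᶜ := fun z hz h => h.elim hz.1.1 hz.2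
  have hptT : ∀ v ∈ N, D.pt v ∉ T := fun v hv h => (hTE h).elim (hptE v) fun h =>
    heN (D.pt_injective h ▸ hv)
  obtain ⟨z₁, hz₁⟩ : (outer S \ T).Nonempty := by
    rw [← closure_nonempty_iff]; exact ⟨x, hxcl⟩
  have hC := isComp_connectedComponentIn (hET hz₁)
  have hsubC := hC.subset_of_inter hETc hET ⟨z₁, hz₁, mem_connectedComponentIn (hET hz₁)⟩
  obtain ⟨A, hA, hAA⟩ := exists_star (Set.toFinite (D.pt '' N)).toFinset hK
    (hpoly.locallyConic.union hT) (Or.inr hxT) (by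
      intro w hw
      rw [Set.Finite.mem_toFinset] at hw
      obtain ⟨v, hv, rfl⟩ := hw
      refine ⟨Or.inl (hptS v), fun h => hptE v (h ▸ hxE), _, hC, closure_mono hsubC hxcl,
        closure_mono hsubC (mem_closure_iff.2 fun O hO hvO => ?_)⟩
      obtain ⟨z, hz, hzE⟩ := mem_closure_iff.1 (hN hv).2 _ (hO.inter hTc.isOpen_compl)
        ⟨hvO, hptT v hv⟩
      exact ⟨z, hz.1, hzE, hz.2⟩)
  have hmem : ∀ v ∈ N, D.pt v ∈ (Set.toFinite (D.pt '' N)).toFinset := fun v hv => by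
    rw [Set.Finite.mem_toFinset]; exact ⟨v, hv, rfl⟩
  have hxS : x ∉ S := hxE.1
  set D' := D.addVertex (N := N) (x := x) (A := fun v => A (D.pt v)) hxS
    (fun v hv => (hA _ (hmem v hv)).1.isPolygonalArc)
    (fun v hv z hz => ((hA _ (hmem v hv)).2 ⟨hz.1, Or.inl hz.2⟩).resolve_left
      fun h => hxS (h ▸ hz.2))
    (fun v hv w hw hvw => hAA _ (hmem v hv) _ (hmem w hw) (D.pt_injective.ne hvw)) with hD'
  -- The tree without `e` and `x` is connected, unbounded and disjoint from the new drawing. So it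
  -- lies in the exterior face, and it accumulates at both `e` and `x`.
  have hTD' : T \ {D.pt e, x} ⊆ outer (D'.support Set.univ) := by
    refine subset_outer hTp (fun z hz hzs => ?_) hTb
    rcases support_addVertex_subset _ _ _ _ _ hzs with h | rfl | h
    · rw [Set.preimage_univ] at h
      rcases hTE hz.1 with h' | h'
      · exact h'.1 h
      · exact hz.2 (Or.inl h')
    · exact hz.2 (Or.inr rfl)
    · obtain ⟨v, hv, hzA⟩ := Set.mem_iUnion₂.1 h
      rcases (hA _ (hmem v hv)).2 ⟨hzA, Or.inr hz.1⟩ with rfl | h'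
      · exact hz.2 (Or.inr rfl)
      · exact hptT v hv (h' ▸ hz.1)
  have hnone : none ∈ D'.exteriorVertices Set.univ := ⟨Set.mem_univ _, closure_mono hTD' hxT'⟩
  refine ⟨D', ?_, hnone, Set.mem_univ _, closure_mono hTD' heT'⟩
  -- The additional round removes at least the new vertex, and the old drawing handles the other `k`
  -- rounds.
  rw [IsOuterplanar, IsOuterplanarOn]
  refine IsOuterplanarOn.addVertex_of_subset _ _ _ _ hD ?_
  rintro (_ | v) ha
  · exact (ha.2 hnone).elim
  · exact ⟨v, Set.mem_univ _, rfl⟩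

/-- For every vertex `p` there is a face at `p` such that a leaf attached to `p` inside this face
keeps the drawing outerplanar. -/
theorem IsOuterplanarOn.exists_face {p : V} : ∀ {k : ℕ} {W : Set V}, D.IsOuterplanarOn k W → p ∈ W →
    ∃ F : Set ℂ, IsOpen F ∧ D.pt p ∈ closure F ∧ ∀ z ∈ F, ∀ hz : z ∉ D.support Set.univ,
      ∀ hA : ∀ v ∈ ({p} : Set V), IsPolygonalArc (segment ℝ z (D.pt p)) z (D.pt v),
      ∀ hAs : ∀ v ∈ ({p} : Set V), segment ℝ z (D.pt p) ∩ D.support Set.univ ⊆ {D.pt v}, ∀ hAA,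
      ∀ W' ⊆ insert none (some '' W), (D.addVertex (N := {p}) hz hA hAs hAA).IsOuterplanarOn k W'
  | 0, W, h, hp => by
    rw [IsOuterplanarOn] at h
    exact (Set.notMem_empty _ (h ▸ hp)).elim
  | k + 1, W, h, hp => by
    rw [IsOuterplanarOn] at h
    have hcomp := (D.polySet_support W).isCompact
    have hE := (isComp_outer hcomp).1
    -- Wherever the leaf is placed, the closure of the exterior face does not shrink, so old
    -- vertices are peeled no later than before.
    have key : ∀ z, ∀ hz : z ∉ D.support Set.univ,
      ∀ hA : ∀ v ∈ ({p} : Set V), IsPolygonalArc (segment ℝ z (D.pt p)) z (D.pt v),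
      ∀ hAs : ∀ v ∈ ({p} : Set V), segment ℝ z (D.pt p) ∩ D.support Set.univ ⊆ {D.pt v}, ∀ hAA,
      ∀ W' ⊆ insert none (some '' W), closure (outer (D.support W)) ⊆
        closure (outer ((D.addVertex (N := {p}) hz hA hAs hAA).support W')) := by
      intro z hz hA hAs hAA W' hW'
      refine (closure_outer_subset hcomp (mem_support_pt hp)
        (fun h => hz (support_mono (Set.subset_univ W) h)) fun w hw => ?_).trans
        (closure_mono (outer_anti fun w hw => ?_))
      · exact hAs p rfl ⟨hw.1, support_mono (Set.subset_univ W) hw.2⟩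
      · rcases support_addVertex_subset _ _ _ _ _ hw with h | rfl | h
        · refine Or.inl (support_mono (fun v hv => ?_) h)
          rcases hW' hv with h | ⟨v', hv', h⟩
          · cases h
          · exact Option.some_injective V h ▸ hv'
        · exact Or.inr (left_mem_segment ℝ _ _)
        · obtain ⟨v, -, hv⟩ := Set.mem_iUnion₂.1 h
          exact Or.inr hv
    have hrest : ∀ z hz hA hAs hAA, ∀ W' ⊆ insert none (some '' W), ∀ v,
        some v ∈ W' \ (D.addVertex (N := {p}) (x := z) (A := fun _ => segment ℝ z (D.pt p))
          hz hA hAs hAA).exteriorVertices W' → v ∈ W \ D.exteriorVertices W := by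
      intro z hz hA hAs hAA W' hW' v hv
      have hvW : v ∈ W := by
        rcases hW' hv.1 with h | ⟨v', hv', h⟩
        · cases h
        · exact Option.some_injective V h ▸ hv'
      exact ⟨hvW, fun hve => hv.2 ⟨hv.1, key z hz hA hAs hAA W' hW' hve.2⟩⟩
    -- The face to use is the exterior face in the round in which `p` itself is peeled; the leaf is
    -- then peeled in the same round, if not earlier.
    by_cases hpe : p ∈ D.exteriorVertices W
    · refine ⟨outer (D.support W), hE.isOpen hcomp.isClosed.isOpen_compl, hpe.2, ?_⟩
      intro z hzE hz hA hAs hAA W' hW'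
      rw [IsOuterplanarOn]
      refine IsOuterplanarOn.addVertex_of_subset hz hA hAs hAA h ?_
      rintro (_ | v) ha
      · exact (ha.2 ⟨ha.1, key z hz hA hAs hAA W' hW' (subset_closure hzE)⟩).elim
      · exact ⟨v, hrest z hz hA hAs hAA W' hW' v ha, rfl⟩
    · obtain ⟨F, hF, hpF, hall⟩ := IsOuterplanarOn.exists_face h ⟨hp, hpe⟩
      refine ⟨F, hF, hpF, fun z hzF hz hA hAs hAA W' hW' => ?_⟩
      rw [IsOuterplanarOn]
      refine hall z hzF hz hA hAs hAA _ ?_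
      rintro (_ | v) ha
      · exact Set.mem_insert _ _
      · exact Or.inr ⟨v, hrest z hz hA hAs hAA W' hW' v ha, rfl⟩

/-- A leaf can be attached to any vertex without spoiling outerplanarity. -/
theorem exists_addVertex_leaf {k : ℕ} (hD : D.IsOuterplanar k) (p : V) :
    ∃ D' : PlanarDrawing (_root_.addVertex G {p}), D'.IsOuterplanar k ∧
      ∀ v ∈ D.exteriorVertices Set.univ, some v ∈ D'.exteriorVertices Set.univ := by
  obtain ⟨F, hF, hpF, hall⟩ := IsOuterplanarOn.exists_face (p := p) hD (Set.mem_univ p)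
  have hpoly := D.polySet_support Set.univ
  have hpF' : D.pt p ∈ closure (F \ D.support Set.univ) :=
    closure_subset_closure_diff hF hpoly.interior_eq hpF
  obtain ⟨z, ⟨hzF, hz⟩, -, hs⟩ := hpoly.locallyConic.exists_segment (fun _ h => h.2) hpF' one_pos
  have hzp : z ≠ D.pt p := fun h => hz (h ▸ mem_support_pt (Set.mem_univ p))
  have hA : ∀ v ∈ ({p} : Set V), IsPolygonalArc (segment ℝ z (D.pt p)) z (D.pt v) := by
    rintro v rfl
    exact (PArc.seg hzp).isPolygonalArc
  have hAs : ∀ v ∈ ({p} : Set V), segment ℝ z (D.pt p) ∩ D.support Set.univ ⊆ {D.pt v} := by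
    rintro v rfl w ⟨hw, hwS⟩
    exact (hs hw).resolve_left fun h => h hwS
  have hAA : ∀ v ∈ ({p} : Set V), ∀ w ∈ ({p} : Set V), v ≠ w →
      segment ℝ z (D.pt p) ∩ segment ℝ z (D.pt p) ⊆ {z} := by
    rintro v rfl w rfl h
    exact (h rfl).elim
  refine ⟨D.addVertex hz hA hAs hAA, hall z hzF hz hA hAs hAA _ ?_, fun v hv => ⟨Set.mem_univ _, ?_⟩⟩
  · rintro (_ | v) -
    · exact Set.mem_insert _ _
    · exact Or.inr ⟨v, Set.mem_univ _, rfl⟩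
  · have := closure_outer_subset hpoly.isCompact (mem_support_pt (Set.mem_univ p)) hz (hAs p rfl)
    refine closure_mono (outer_anti fun w hw => ?_) (this hv.2)
    rcases support_addVertex_subset _ _ _ _ _ hw with h | rfl | h
    · exact Or.inl h
    · exact Or.inr (left_mem_segment ℝ _ _)
    · obtain ⟨v, -, hv⟩ := Set.mem_iUnion₂.1 h
      exact Or.inr hv

/-- A drawing without edges has all vertices on the exterior face. -/
theorem exteriorVertices_eq_univ_of_isEmpty (hG : ∀ u v, ¬ G.Adj u v) :
    D.exteriorVertices Set.univ = Set.univ := by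
  have hsupp : D.support Set.univ = D.pt '' Set.univ := by
    refine Set.union_eq_left.2 fun z hz => ?_
    obtain ⟨e, he, -⟩ := Set.mem_iUnion₂.1 hz
    induction e with
    | h u v => exact (hG u v he.1).elim
  have hfin : (D.support Set.univ).Finite := hsupp ▸ Set.toFinite _
  have hcomp : IsPreconnected (D.support Set.univ)ᶜ :=
    (hfin.countable.isPathConnected_compl_of_one_lt_rank
      (by rw [Complex.rank_real_complex]; exact Nat.one_lt_ofNat)).isConnected.isPreconnected
  have hbdd : ¬ Bornology.IsBounded (D.support Set.univ)ᶜ := by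
    intro hb
    have : (Set.univ : Set ℂ) = D.support Set.univ ∪ (D.support Set.univ)ᶜ := by simp
    exact NormedSpace.unbounded_univ ℝ ℂ (this ▸ hfin.isBounded.union hb)
  have hsub := subset_outer hcomp le_rfl hbdd
  ext v
  refine ⟨fun _ => Set.mem_univ _, fun _ => ⟨Set.mem_univ _, closure_mono hsub ?_⟩⟩
  rw [(hfin.countable.dense_compl ℝ).closure_eq]
  exact Set.mem_univ _

end PlanarDrawing

/-! ### From exposed incomparable pairs to min-max pairs -/

section Exposed

/-- `J` is a set of incomparable pairs of the order generated by `r`, and there is a `k`-outerplanar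
drawing containing the edges of `r` that witnesses that `J` is doubly exposed. -/
structure Exposed (k : ℕ) {V : Type u} (r : V → V → Prop) (J : Set (V × V)) : Prop where
  antisymm : ∀ u v, ReflTransGen r u v → ReflTransGen r v u → u = v
  incomp : ∀ p ∈ J, ¬ ReflTransGen r p.1 p.2 ∧ ¬ ReflTransGen r p.2 p.1
  drawing : ∃ (G : SimpleGraph V) (D : PlanarDrawing G) (x₀ y₀ : V), (∀ u v, r u v → G.Adj u v) ∧
    D.IsOuterplanar k ∧ x₀ ∈ D.exteriorVertices Set.univ ∧ y₀ ∈ D.exteriorVertices Set.univ ∧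
    ∀ p ∈ J, ReflTransGen r x₀ p.2 ∧ ReflTransGen r p.1 y₀

theorem reflTransGen_flip {V : Type*} {r : V → V → Prop} :
    ReflTransGen (flip r) = flip (ReflTransGen r) := by
  ext u v
  exact reflTransGen_swap

theorem Exposed.flip {k : ℕ} {V : Type u} {r : V → V → Prop} {J : Set (V × V)}
    (h : Exposed k r J) : Exposed k (flip r) (Prod.swap ⁻¹' J) := by
  obtain ⟨ha, hi, G, D, x₀, y₀, hr, hk, hx, hy, hJ⟩ := h
  refine ⟨fun u v huv hvu => ?_, fun p hp => ?_, G, D, y₀, x₀, fun u v huv => (hr v u huv).symm, hk,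
    hy, hx, fun p hp => ?_⟩
  · rw [reflTransGen_flip] at huv hvu
    exact ha u v hvu huv
  · rw [reflTransGen_flip]
    exact hi p.swap hp
  · rw [reflTransGen_flip]
    exact (hJ p.swap hp).symm

/-- The relation obtained by adding an element `none` that is only related to `p`. -/
def addBelow {V : Type*} (r : V → V → Prop) (p : V) : Option V → Option V → Prop
  | some u, some v => r u v
  | none, some v => v = p
  | _, none => False

section AddBelow

variable {V : Type*} {r : V → V → Prop} {p u v : V}

theorem reflTransGen_addBelow_some (h : ReflTransGen r u v) :
    ReflTransGen (addBelow r p) (some u) (some v) := h.lift some fun _ _ h => h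

theorem reflTransGen_addBelow_none (h : ReflTransGen r p v) :
    ReflTransGen (addBelow r p) none (some v) :=
  .head (b := some p) (show p = p from rfl) (reflTransGen_addBelow_some h)

/-- Nothing but the leaf lies below the leaf, and sending the leaf to `p` preserves the order. -/
theorem reflTransGen_of_addBelow {a b : Option V} (h : ReflTransGen (addBelow r p) a b) :
    (b = none → a = none) ∧ ∀ v, b = some v → ReflTransGen r (a.getD p) v := by
  induction h with
  | refl => exact ⟨id, by rintro v rfl; exact .refl⟩
  | @tail b c _ hbc ih =>
    match b, c, hbc with
    | some u, some w, hbc =>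
      refine ⟨by simp, fun v hv => ?_⟩
      cases hv
      exact (ih.2 u rfl).tail hbc
    | none, some w, hbc =>
      refine ⟨by simp, fun v hv => ?_⟩
      cases hv
      have h : w = p := hbc
      rw [ih.1 rfl, h]
      exact .refl

end AddBelow

/-- A leaf below `p` lies below exactly those old elements that are above `p`. It can therefore
replace `p` as a first entry without creating comparabilities or losing alternation. -/
theorem Exposed.addBelow {k : ℕ} {V : Type u} [Finite V] {r : V → V → Prop} {J : Set (V × V)}
    (h : Exposed k r J) (p : V) (φ : V × V → Option V × Option V)
    (hφ : ∀ q, ((φ q).1 = some q.1 ∨ q.1 = p ∧ (φ q).1 = none) ∧ (φ q).2 = some q.2) :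
    Exposed k (addBelow r p) (φ '' J) ∧ ∀ m,
      AltColorable (ReflTransGen (_root_.addBelow r p)) (φ '' J) m →
        AltColorable (ReflTransGen r) J m := by
  obtain ⟨ha, hi, G, D, x₀, y₀, hr, hk, hx, hy, hJ⟩ := h
  obtain ⟨D', hD', hext⟩ := D.exists_addVertex_leaf hk p
  have hle : ∀ (q : V × V) v, ReflTransGen r q.1 v →
      ReflTransGen (_root_.addBelow r p) (φ q).1 (some v) := by
    intro q v h
    rcases (hφ q).1 with h1 | ⟨h1, h2⟩
    · rw [h1]; exact reflTransGen_addBelow_some h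
    · rw [h2]; exact reflTransGen_addBelow_none (h1 ▸ h)
  have hget : ∀ q, (φ q).1.getD p = q.1 := fun q => by
    rcases (hφ q).1 with h1 | ⟨h1, h2⟩
    · rw [h1]; rfl
    · rw [h2]; exact h1.symm
  refine ⟨⟨fun a b hab hba => ?_, ?_, _root_.addVertex G {p}, D', some x₀, some y₀, ?_, hD', hext _ hx,
    hext _ hy, ?_⟩, fun m hm => hm.comap φ (fun q hq => ⟨q, hq, rfl⟩) fun q _ q' _ h => ?_⟩
  · have h1 := reflTransGen_of_addBelow hab
    have h2 := reflTransGen_of_addBelow hba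
    match a, b with
    | none, none => rfl
    | none, some v => exact (h2.1 rfl).symm
    | some u, none => exact h1.1 rfl
    | some u, some v => exact congrArg some (ha u v (h1.2 v rfl) (h2.2 u rfl))
  · rintro _ ⟨q, hq, rfl⟩
    rw [(hφ q).2]
    refine ⟨fun h => (hi q hq).1 ?_, fun h => ?_⟩
    · have := (reflTransGen_of_addBelow h).2 _ rfl
      rwa [hget] at this
    · have := reflTransGen_of_addBelow h
      rcases (hφ q).1 with h1 | ⟨h1, h2⟩
      · exact (hi q hq).2 (this.2 _ h1)
      · exact absurd (this.1 h2) (by simp)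
  · rintro (_ | u) (_ | v) h
    · exact h.elim
    · exact h
    · exact h.elim
    · exact hr u v h
  · rintro _ ⟨q, hq, rfl⟩
    rw [(hφ q).2]
    exact ⟨reflTransGen_addBelow_some (hJ q hq).1, hle q _ (hJ q hq).2⟩
  · rw [(hφ q').2]
    exact hle q _ h

/-- Attaching leaves makes all first entries minimal. -/
theorem Exposed.exists_minimal {k : ℕ} : ∀ (n : ℕ) {V : Type u} [Finite V] {r : V → V → Prop}
    {J : Set (V × V)}, Exposed k r J → {a | (∃ q ∈ J, q.1 = a) ∧ ∃ u, r u a}.ncard ≤ n →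
    ∃ (V' : Type u) (_ : Finite V') (r' : V' → V' → Prop) (J' : Set (V' × V')), Exposed k r' J' ∧
      (∀ q ∈ J', ∀ u, ¬ r' u q.1) ∧
      ((∀ q ∈ J, ∀ u, ¬ r q.2 u) → ∀ q ∈ J', ∀ u, ¬ r' q.2 u) ∧
      ∀ m, AltColorable (ReflTransGen r') J' m → AltColorable (ReflTransGen r) J m := by
  classical
  intro n
  induction n with
  | zero =>
    intro V _ r J h hn
    rw [Nat.le_zero, Set.ncard_eq_zero] at hn
    exact ⟨V, ‹_›, r, J, h, fun q hq u hu => (Set.eq_empty_iff_forall_notMem.1 hn) q.1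
      ⟨⟨q, hq, rfl⟩, u, hu⟩, fun h => h, fun m h => h⟩
  | succ n ih =>
    intro V _ r J h hn
    by_cases hbad : ∃ p, p ∈ {a | (∃ q ∈ J, q.1 = a) ∧ ∃ u, r u a}
    · obtain ⟨p, hp⟩ := hbad
      set φ : V × V → Option V × Option V := fun q => (if q.1 = p then none else some q.1, some q.2)
        with hφ
      obtain ⟨h', hcol⟩ := h.addBelow p φ fun q => by
        refine ⟨?_, rfl⟩
        simp only [hφ]
        split_ifs with h1
        · exact Or.inr ⟨h1, rfl⟩
        · exact Or.inl rfl
      obtain ⟨V', hV', r', J', h1, h2, h3, h4⟩ := ih h' (by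
        -- The count drops: `p` is replaced by a minimal leaf, and no other first entry acquires a
        -- new element below it.
        have hsub : {a | (∃ q ∈ φ '' J, q.1 = a) ∧ ∃ u, _root_.addBelow r p u a} ⊆
            some '' ({a | (∃ q ∈ J, q.1 = a) ∧ ∃ u, r u a} \ {p}) := by
          rintro a ⟨⟨_, ⟨q, hq, rfl⟩, rfl⟩, u, hu⟩
          simp only [hφ] at hu ⊢
          split_ifs at hu ⊢ with h1
          · cases u <;> exact hu.elim
          · refine ⟨q.1, ⟨⟨⟨q, hq, rfl⟩, ?_⟩, h1⟩, rfl⟩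
            cases u with
            | none => exact (h1 hu).elim
            | some u => exact ⟨u, hu⟩
        refine (Set.ncard_le_ncard hsub (Set.toFinite _)).trans ?_
        rw [Set.ncard_image_of_injective _ (Option.some_injective V), Set.ncard_sdiff_singleton_of_mem hp]
        omega)
      refine ⟨V', hV', r', J', h1, h2, fun hmax => h3 ?_, fun m hm => hcol m (h4 m hm)⟩
      rintro _ ⟨q, hq, rfl⟩ (_ | u) hu
      · exact hu
      · exact hmax q hq u hu
    · exact ⟨V, ‹_›, r, J, h, fun q hq u hu => hbad ⟨q.1, ⟨q, hq, rfl⟩, u, hu⟩, fun h => h, fun m h => h⟩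

/-- A bound on `dimOf` for doubly exposed sets of min-max pairs bounds the number of colours needed
for doubly exposed sets of arbitrary incomparable pairs. -/
theorem Exposed.altColorable {k M : ℕ}
    (hM : ∀ (P : Type u) [PartialOrder P] [Finite P] (I : Set (P × P)),
      IsKOuterplanar k (SimpleGraph.hasse P) → I ⊆ PosetDim.MinMaxPairs P → IsDoublyExposed I →
        PosetDim.dimOf I ≤ M)
    {V : Type u} [Finite V] {r : V → V → Prop} {J : Set (V × V)} (h : Exposed k r J) :
    AltColorable (ReflTransGen r) J M := by
  obtain ⟨V₁, _, r₁, J₁, h₁, hmin₁, -, hcol₁⟩ := h.exists_minimal _ le_rfl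
  -- The same construction in the dual order treats the second entries; its extra clause preserves
  -- the extremality already achieved for the first entries.
  obtain ⟨V₂, _, r₂, J₂, h₂, hmin₂, hmax₂, hcol₂⟩ := h₁.flip.exists_minimal _ le_rfl
  have hmax₂ := hmax₂ fun q hq u hu => hmin₁ q.swap hq u hu
  have key : AltColorable (ReflTransGen r₂) J₂ M := by
    obtain ⟨ha, hi, G, D, x₀, y₀, hr, hk, hx, hy, hJ⟩ := h₂
    let _ : PartialOrder V₂ :=
      { le := ReflTransGen r₂
        le_refl := fun _ => .refl
        le_trans := fun _ _ _ h h' => h.trans h'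
        le_antisymm := ha }
    -- Covers in the generated order are single steps of `r₂`, so the cover graph is a subgraph of
    -- the drawn graph.
    have hcov : ∀ a b : V₂, a ⋖ b → G.Adj a b := by
      intro a b hab
      rcases ReflTransGen.cases_head (show ReflTransGen r₂ a b from hab.1.le) with h | ⟨c, hac, hcb⟩
      · exact (hab.1.ne h).elim
      · have hac' : a < c := lt_of_le_of_ne (ReflTransGen.single hac) (hr a c hac).ne
        have : c = b := by
          by_contra hne
          exact hab.2 hac' (lt_of_le_of_ne hcb hne)
        exact this ▸ hr a c hac
    have hadj : ∀ a b : V₂, (SimpleGraph.hasse V₂).Adj a b → G.Adj a b := fun a b h =>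
      h.elim (hcov a b) fun h => (hcov b a h).symm
    have hinc : J₂ ⊆ PosetDim.Inc V₂ := fun p hp => hi p hp
    set D' : PlanarDrawing (SimpleGraph.hasse V₂) := D.comap id Function.injective_id hadj
    have hD' : D'.IsOuterplanar k := PlanarDrawing.IsOuterplanarOn.comap _ hadj hk (Set.subset_univ _)
    have hdim := hM V₂ J₂ ⟨D', hD'⟩ (fun p hp => ⟨hinc hp, fun b hb => ?_, fun b hb => ?_⟩)
      ⟨hinc, D', x₀, y₀,
        PlanarDrawing.mem_exteriorVertices_comap Function.injective_id hadj
          (Set.subset_univ _) (Set.mem_univ _) hx,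
        PlanarDrawing.mem_exteriorVertices_comap Function.injective_id hadj
          (Set.subset_univ _) (Set.mem_univ _) hy, hJ⟩
    · obtain ⟨c, hc, hcn⟩ := PosetDim.altColorable_dimOf hinc
      exact ⟨c, fun p hp => (hc p hp).trans_le hdim, hcn⟩
    · rcases ReflTransGen.cases_tail (show ReflTransGen r₂ b p.1 from hb) with h | ⟨c, -, hc⟩
      · exact h.le
      · exact (hmin₂ p hp c hc).elim
    · rcases ReflTransGen.cases_head (show ReflTransGen r₂ p.2 b from hb) with h | ⟨c, hc, -⟩
      · exact h.ge
      · exact (hmax₂ p hp c hc).elim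
  have := (hcol₂ M key).swap
  rw [reflTransGen_flip] at this
  exact hcol₁ M this

end Exposed

/-! ### Making pairs doubly exposed with a connected up-set -/

section Core

variable {V : Type u} {r : V → V → Prop} {Q : Set V}

/-- The restriction of a relation to a set. -/
def restrictTo (r : V → V → Prop) (Q : Set V) (u v : V) : Prop := u ∈ Q ∧ v ∈ Q ∧ r u v

theorem reflTransGen_restrictTo_flip :
    ReflTransGen (restrictTo (flip r) Q) = flip (ReflTransGen (restrictTo r Q)) := by
  rw [← reflTransGen_flip]
  congr 1
  ext u v
  exact ⟨fun h => ⟨h.2.1, h.1, h.2.2⟩, fun h => ⟨h.2.1, h.1, h.2.2⟩⟩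

theorem reflTransGen_of_restrictTo {u v : V} (h : ReflTransGen (restrictTo r Q) u v) :
    ReflTransGen r u v := h.lift id fun _ _ h => h.2.2

theorem mem_iff_of_restrictTo {u v : V} (h : ReflTransGen (restrictTo r Q) u v) :
    u ∈ Q ↔ v ∈ Q := by
  induction h with
  | refl => rfl
  | tail _ h ih => exact ih.trans ⟨fun _ => h.2.1, fun _ => h.1⟩

/-- A relation that increases a rank generates a partial order. -/
theorem antisymm_of_rank {α ι : Type*} [PartialOrder ι] {s : α → α → Prop} (ρ : α → ι)
    (hρ : ∀ a b, s a b → ρ a < ρ b) {a b : α} (hab : ReflTransGen s a b)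
    (hba : ReflTransGen s b a) : a = b := by
  have mono : ∀ {a b}, ReflTransGen s a b → ρ a ≤ ρ b := fun h => by
    induction h with
    | refl => exact le_rfl
    | tail _ h ih => exact ih.trans (hρ _ _ h).le
  rcases ReflTransGen.cases_head hab with h | ⟨c, hac, hcb⟩
  · exact h
  · exact absurd ((hρ _ _ hac).trans_le ((mono hcb).trans (mono hba))) (lt_irrefl _)

/-- The induced subgraph on `X`, as a graph on all vertices. -/
def inside (G : SimpleGraph V) (X : Set V) : SimpleGraph V where
  Adj u v := u ∈ X ∧ v ∈ X ∧ G.Adj u v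
  symm := ⟨fun _ _ h => ⟨h.2.1, h.1, h.2.2.symm⟩⟩
  loopless := ⟨fun u h => G.loopless.irrefl u h.2.2⟩

theorem exists_closer {G : SimpleGraph V} {X : Set V} {e u : V} (h : (inside G X).Reachable u e)
    (hne : u ≠ e) : ∃ v ∈ X, G.Adj u v ∧ (inside G X).Reachable v e ∧
      (inside G X).dist v e < (inside G X).dist u e := by
  obtain ⟨w, hw⟩ := h.exists_walk_length_eq_dist
  cases w with
  | nil => exact (hne rfl).elim
  | @cons _ v _ hadj w =>
    refine ⟨v, hadj.2.1, hadj.2.2, ⟨w⟩, ?_⟩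
    have := SimpleGraph.dist_le w
    rw [SimpleGraph.Walk.length_cons] at hw
    omega

/-- The relation that keeps `r` outside of the up-set `X`, directs the edges inside `X` towards the
vertex from which the distances `d` are measured, and puts a new element `none` below `N`. -/
def unfoldRel (r : V → V → Prop) (G : SimpleGraph V) (Q X N : Set V) (d : V → ℕ) :
    Option Q → Option Q → Prop
  | some u, some v => (u.1 ∉ X ∧ r u v) ∨ (u.1 ∈ X ∧ v.1 ∈ X ∧ G.Adj u v ∧ d v < d u)
  | none, some v => v.1 ∈ N
  | _, none => False

theorem PlanarDrawing.IsOuterplanarOn.mono {G : SimpleGraph V} {D : PlanarDrawing G} {W : Set V} :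
    ∀ {k k' : ℕ}, D.IsOuterplanarOn k W → k ≤ k' → D.IsOuterplanarOn k' W := by
  intro k
  induction k generalizing W with
  | zero =>
    intro k' h _
    rw [IsOuterplanarOn] at h
    rw [h]
    exact isOuterplanarOn_empty k'
  | succ k ih =>
    rintro (_ | k') h hk
    · omega
    · rw [IsOuterplanarOn] at h ⊢
      exact ih h (by omega)

/-- The witnesses for double exposure are the new vertex, placed below the exterior vertices outside
`X`, and `e`, which redirection puts above all of `X`. Since `X` is an up-set, chains ending outside
`X` never enter it, so redirection does not affect comparabilities between entries of pairs. -/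
theorem altColorable_of_upset [Finite V] {k M : ℕ}
    (hM : ∀ (V' : Type u) [Finite V'] (r' : V' → V' → Prop) (J' : Set (V' × V')),
      Exposed (k + 1) r' J' → AltColorable (ReflTransGen r') J' M)
    {G : SimpleGraph V} {D : PlanarDrawing G} (hr : ∀ u v, r u v → G.Adj u v)
    (rk : V → ℤ) (hrk : ∀ u v, r u v → rk u < rk v)
    (hQ : D.IsOuterplanarOn k Q) {e : V} (he : e ∈ D.exteriorVertices Q)
    {X : Set V} (hXQ : X ⊆ Q) (heX : e ∈ X) (hX : ∀ u ∈ X, (inside G X).Reachable u e)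
    (hup : ∀ u ∈ X, ∀ v ∈ Q, r u v → v ∈ X) {J : Set (V × V)}
    (hinc : ∀ p ∈ J, ¬ ReflTransGen r p.1 p.2 ∧ ¬ ReflTransGen r p.2 p.1)
    (h1 : ∀ p ∈ J, p.1 ∈ Q \ X) (h2 : ∀ p ∈ J, p.2 ∈ Q \ X)
    (hJX : ∀ p ∈ J, ∃ x ∈ X, ReflTransGen (restrictTo r Q) p.1 x)
    (hJe : ∀ p ∈ J, ∃ w ∈ D.exteriorVertices Q, ReflTransGen (restrictTo r Q) w p.2)
    (hJQ : ∀ p ∈ J, ∀ q ∈ J, ReflTransGen r p.1 q.2 → ReflTransGen (restrictTo r Q) p.1 q.2) :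
    AltColorable (ReflTransGen r) J M := by
  classical
  set d : V → ℕ := fun v => (inside G X).dist v e with hd
  set N : Set V := D.exteriorVertices Q \ X with hN
  set r' : Option Q → Option Q → Prop := unfoldRel r G Q X N d with hr'
  have hG : ∀ u v : Q, (G.comap ((↑) : Q → V)).Adj u v → G.Adj u v := fun u v h => h
  have himg : ((↑) : Q → V) '' Set.univ ⊆ Q := by rintro _ ⟨v, -, rfl⟩; exact v.2
  set D₁ : PlanarDrawing (G.comap ((↑) : Q → V)) := D.comap _ Subtype.val_injective hG
  have hD₁ : D₁.IsOuterplanar k := PlanarDrawing.IsOuterplanarOn.comap _ hG hQ himg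
  have hext : ∀ v : Q, v.1 ∈ D.exteriorVertices Q → v ∈ D₁.exteriorVertices Set.univ := fun v hv =>
    PlanarDrawing.mem_exteriorVertices_comap _ hG himg (Set.mem_univ v) hv
  obtain ⟨D', hD', hx₀, hy₀⟩ := D₁.exists_addVertex_star hD₁ (hext ⟨e, hXQ heX⟩ he)
    (N := {v : Q | v.1 ∈ N}) (fun v hv => hext v hv.1) (fun h => h.2 heX)
  have hdown : ∀ u v, ReflTransGen (restrictTo r Q) u v → v ∉ X → u ∉ X := by
    intro u v h hv
    induction h with
    | refl => exact hv
    | tail _ h ih => exact ih fun hX => hv (hup _ hX _ h.2.1 h.2.2)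
  have hto : ∀ u v, ReflTransGen (restrictTo r Q) u v → ∀ (hu : u ∈ Q) (hv : v ∈ Q), v ∉ X →
      ReflTransGen r' (some ⟨u, hu⟩) (some ⟨v, hv⟩) := by
    intro u v h hu
    induction h with
    | refl => exact fun _ _ => .refl
    | @tail b c hb hbc ih =>
      intro hc hcX
      have hbX := hdown b c (.single hbc) hcX
      exact (ih hbc.1 hbX).tail (Or.inl ⟨hbX, hbc.2.2⟩)
  have hfrom : ∀ (u : Q) (z : Option Q), ReflTransGen r' (some u) z →
      ∃ v : Q, z = some v ∧ (v.1 ∈ X ∨ ReflTransGen (restrictTo r Q) u v) := by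
    intro u z h
    induction h with
    | refl => exact ⟨u, rfl, Or.inr .refl⟩
    | @tail b c hb hbc ih =>
      obtain ⟨w, rfl, hw⟩ := ih
      match c, hbc with
      | some v, hbc =>
        refine ⟨v, rfl, ?_⟩
        rcases hbc with ⟨hwX, hwv⟩ | ⟨-, hvX, -⟩
        · exact Or.inr ((hw.resolve_left hwX).tail ⟨w.2, v.2, hwv⟩)
        · exact Or.inl hvX
  have htoe : ∀ (n : ℕ) (u : V) (hu : u ∈ X), d u = n →
      ReflTransGen r' (some ⟨u, hXQ hu⟩) (some ⟨e, hXQ heX⟩) := by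
    intro n
    induction n using Nat.strong_induction_on with
    | _ n ih =>
      intro u hu hn
      by_cases hue : u = e
      · subst hue; exact .refl
      · obtain ⟨v, hv, hadj, -, hlt⟩ := exists_closer (hX u hu) hue
        exact .head (b := some ⟨v, hXQ hv⟩) (Or.inr ⟨hu, hv, hadj, hlt⟩) (ih (d v) (hn ▸ hlt) v hv rfl)
  -- An old chain survives until it leaves an element of `X`; from that element the redirected edges
  -- lead to `e`.
  have htoX : ∀ u x, ReflTransGen (restrictTo r Q) u x → ∀ (hu : u ∈ Q) (hx : x ∈ Q),
      ReflTransGen r' (some ⟨u, hu⟩) (some ⟨x, hx⟩) ∨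
        ReflTransGen r' (some ⟨u, hu⟩) (some ⟨e, hXQ heX⟩) := by
    intro u x h hu
    induction h with
    | refl => exact fun _ => Or.inl .refl
    | @tail b c hb hbc ih =>
      intro hc
      rcases ih hbc.1 with h | h
      · by_cases hbX : b ∈ X
        · exact Or.inr (h.trans (htoe _ b hbX rfl))
        · exact Or.inl (h.tail (Or.inl ⟨hbX, hbc.2.2⟩))
      · exact Or.inr h
  set ι : V → Option Q := fun v => if h : v ∈ Q then some ⟨v, h⟩ else none with hι
  have hιQ : ∀ v (h : v ∈ Q), ι v = some ⟨v, h⟩ := fun v h => dif_pos h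
  set φ : V × V → Option Q × Option Q := fun p => (ι p.1, ι p.2) with hφ
  have hback : ∀ u v, u ∈ Q → v ∈ Q \ X → ReflTransGen r' (ι u) (ι v) → ReflTransGen r u v := by
    intro u v hu hv h
    rw [hιQ u hu, hιQ v hv.1] at h
    obtain ⟨w, hw, hw'⟩ := hfrom _ _ h
    cases hw
    exact reflTransGen_of_restrictTo (hw'.resolve_left hv.2)
  have hexp : Exposed (k + 1) r' (φ '' J) := by
    -- The lexicographic rank has three blocks: the new vertex, the elements outside `X` ordered by
    -- `rk`, and the elements of `X` ordered by decreasing distance from `e`.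
    refine ⟨fun a b => antisymm_of_rank (ι := ℕ ×ₗ ℤ) (fun a => match a with
      | none => toLex (0, 0)
      | some v => if v.1 ∈ X then toLex (2, -(d v : ℤ)) else toLex (1, rk v)) ?_, ?_, _, D', none,
      some ⟨e, hXQ heX⟩, ?_, hD', hx₀, hy₀, ?_⟩
    · rintro (_ | u) (_ | v) h
      · exact h.elim
      · dsimp only
        split_ifs <;> exact Prod.Lex.toLex_lt_toLex.2 (Or.inl (by simp))
      · exact h.elim
      · dsimp only
        rcases h with ⟨huX, huv⟩ | ⟨huX, hvX, -, hlt⟩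
        · rw [if_neg huX]
          split_ifs
          · exact Prod.Lex.toLex_lt_toLex.2 (Or.inl (by simp))
          · exact Prod.Lex.toLex_lt_toLex.2 (Or.inr ⟨rfl, hrk _ _ huv⟩)
        · rw [if_pos huX, if_pos hvX]
          refine Prod.Lex.toLex_lt_toLex.2 (Or.inr ⟨rfl, ?_⟩)
          simpa using hlt
    · rintro _ ⟨p, hp, rfl⟩
      exact ⟨fun h => (hinc p hp).1 (hback _ _ (h1 p hp).1 (h2 p hp) h),
        fun h => (hinc p hp).2 (hback _ _ (h2 p hp).1 (h1 p hp) h)⟩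
    · rintro (_ | u) (_ | v) h
      · exact h.elim
      · exact h
      · exact h.elim
      · rcases h with h | h
        · exact hr _ _ h.2
        · exact h.2.2.1
    · rintro _ ⟨p, hp, rfl⟩
      constructor
      · obtain ⟨w, hw, hwp⟩ := hJe p hp
        show ReflTransGen r' none (ι p.2)
        rw [hιQ _ (h2 p hp).1]
        exact .head (b := some ⟨w, hw.1⟩) ⟨hw, hdown _ _ hwp (h2 p hp).2⟩
          (hto w p.2 hwp hw.1 (h2 p hp).1 (h2 p hp).2)
      · obtain ⟨x, hx, hpx⟩ := hJX p hp
        show ReflTransGen r' (ι p.1) _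
        rw [hιQ _ (h1 p hp).1]
        rcases htoX _ _ hpx (h1 p hp).1 (hXQ hx) with h | h
        · exact h.trans (htoe _ x hx rfl)
        · exact h
  refine (hM _ r' _ hexp).comap φ (fun p hp => ⟨p, hp, rfl⟩) fun p hp q hq h => ?_
  show ReflTransGen r' (ι p.1) (ι q.2)
  rw [hιQ _ (h1 p hp).1, hιQ _ (h2 q hq).1]
  exact hto _ _ (hJQ p hp q hq h) _ _ (h2 q hq).2

end Core

theorem altColorable_of_forall_notMem {α : Type*} {le : α → α → Prop} {J : Set (α × α)} {n : ℕ}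
    (h : ∀ p, p ∉ J) : AltColorable le J n :=
  ⟨fun _ => 0, fun p hp => (h p hp).elim, fun i p hp => by
    obtain ⟨q, hq, -⟩ := TransGen.head'_iff.1 hp
    exact h _ hq.1.1⟩

/-! ### Unfolding a component from an exterior vertex -/

section Unfolding

variable {V : Type u} {r : V → V → Prop} {Q : Set V} {e u v : V}

/-- The up-sets of the unfolding of `Q` from `e`: starting with the up-set of `e`, form alternately
down-sets and up-sets. -/
def unfoldUp (r : V → V → Prop) (Q : Set V) (e : V) : ℕ → Set V
  | 0 => {v | ReflTransGen (restrictTo r Q) e v}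
  | j + 1 => {v | ∃ w, ReflTransGen (restrictTo r Q) w v ∧
      ∃ x ∈ unfoldUp r Q e j, ReflTransGen (restrictTo r Q) w x}

/-- The down-sets of the unfolding of `Q` from `e`. -/
def unfoldDown (r : V → V → Prop) (Q : Set V) (e : V) (j : ℕ) : Set V :=
  {w | ∃ x ∈ unfoldUp r Q e j, ReflTransGen (restrictTo r Q) w x}

theorem unfoldUp_subset_unfoldDown (j : ℕ) : unfoldUp r Q e j ⊆ unfoldDown r Q e j :=
  fun x hx => ⟨x, hx, .refl⟩

theorem unfoldDown_subset_unfoldUp (j : ℕ) : unfoldDown r Q e j ⊆ unfoldUp r Q e (j + 1) :=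
  fun w hw => ⟨w, .refl, hw⟩

theorem unfoldUp_of_le {j : ℕ} (hu : u ∈ unfoldUp r Q e j)
    (huv : ReflTransGen (restrictTo r Q) u v) : v ∈ unfoldUp r Q e j := by
  cases j with
  | zero => exact ReflTransGen.trans hu huv
  | succ j =>
    obtain ⟨w, hw, hx⟩ := hu
    exact ⟨w, hw.trans huv, hx⟩

theorem unfoldDown_of_le {j : ℕ} (hu : u ∈ unfoldDown r Q e j)
    (huv : ReflTransGen (restrictTo r Q) v u) : v ∈ unfoldDown r Q e j := by
  obtain ⟨x, hx, hux⟩ := hu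
  exact ⟨x, hx, huv.trans hux⟩

theorem mem_of_mem_unfoldUp (he : e ∈ Q) : ∀ {j : ℕ} {v : V}, v ∈ unfoldUp r Q e j → v ∈ Q
  | 0, _, h => (mem_iff_of_restrictTo h).1 he
  | _ + 1, _, ⟨_, hw, _, hx, hwx⟩ =>
    (mem_iff_of_restrictTo hw).1 ((mem_iff_of_restrictTo hwx).2 (mem_of_mem_unfoldUp he hx))

theorem mem_of_mem_unfoldDown (he : e ∈ Q) {j : ℕ} (h : v ∈ unfoldDown r Q e j) : v ∈ Q := by
  obtain ⟨x, hx, hvx⟩ := h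
  exact (mem_iff_of_restrictTo hvx).2 (mem_of_mem_unfoldUp he hx)

theorem reachable_inside_mono {G : SimpleGraph V} {S T : Set V} (hST : S ⊆ T)
    (h : (inside G S).Reachable u v) : (inside G T).Reachable u v :=
  h.mono (show inside G S ≤ inside G T from fun _ _ h => ⟨hST h.1, hST h.2.1, h.2.2⟩)

theorem reachable_inside_of_le {G : SimpleGraph V} (hr : ∀ u v, r u v → G.Adj u v) {S : Set V}
    (h : ReflTransGen (restrictTo r Q) u v)
    (hS : ∀ y, ReflTransGen (restrictTo r Q) u y → ReflTransGen (restrictTo r Q) y v → y ∈ S) :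
    (inside G S).Reachable u v := by
  induction h with
  | refl => exact .refl _
  | @tail b c hb hbc ih =>
    refine (ih fun y h1 h2 => hS y h1 (h2.tail hbc)).trans (SimpleGraph.Adj.reachable ?_)
    exact ⟨hS b hb (.single hbc), hS c (hb.tail hbc) .refl, hr _ _ hbc.2.2⟩

theorem reachable_unfoldUp {G : SimpleGraph V} (hr : ∀ u v, r u v → G.Adj u v) :
    ∀ {j : ℕ} {v : V}, v ∈ unfoldUp r Q e j → (inside G (unfoldUp r Q e j)).Reachable v e
  | 0, _, h => (reachable_inside_of_le hr h fun _ hy _ => hy).symm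
  | j + 1, v, ⟨w, hw, x, hx, hwx⟩ => by
    have hsub : unfoldUp r Q e j ⊆ unfoldUp r Q e (j + 1) :=
      (unfoldUp_subset_unfoldDown j).trans (unfoldDown_subset_unfoldUp j)
    have hwu : w ∈ unfoldUp r Q e (j + 1) := ⟨w, .refl, x, hx, hwx⟩
    refine ((reachable_inside_of_le hr hw fun y hy _ => unfoldUp_of_le hwu hy).symm.trans
      (reachable_inside_of_le hr hwx fun y hy _ => unfoldUp_of_le hwu hy)).trans ?_
    exact reachable_inside_mono hsub (reachable_unfoldUp hr hx)

theorem reachable_unfoldDown {G : SimpleGraph V} (hr : ∀ u v, r u v → G.Adj u v) {j : ℕ}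
    (h : v ∈ unfoldDown r Q e j) : (inside G (unfoldDown r Q e j)).Reachable v e := by
  obtain ⟨x, hx, hvx⟩ := h
  have h := reachable_inside_of_le (S := unfoldDown r Q e j) hr hvx fun y _ hy => ⟨x, hx, hy⟩
  exact h.trans (reachable_inside_mono (unfoldUp_subset_unfoldDown j) (reachable_unfoldUp hr hx))

theorem mem_unfoldUp_self (j : ℕ) : e ∈ unfoldUp r Q e j := by
  induction j with
  | zero => exact .refl
  | succ j ih => exact ⟨e, .refl, e, ih, .refl⟩

/-- Every edge of a walk from `e` goes up, staying in the current up-set, or goes down, which costs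
one level. -/
theorem exists_mem_unfoldUp {G : SimpleGraph V} (hr : ∀ u v, G.Adj u v → r u v ∨ r v u)
    (h : (inside G Q).Reachable v e) : ∃ j, v ∈ unfoldUp r Q e j := by
  replace h := (SimpleGraph.reachable_iff_reflTransGen _ _).1 h.symm
  induction h with
  | refl => exact ⟨0, .refl⟩
  | @tail b c _ hbc ih =>
    obtain ⟨j, hj⟩ := ih
    rcases hr _ _ hbc.2.2 with h | h
    · exact ⟨j, unfoldUp_of_le hj (.single ⟨hbc.1, hbc.2.1, h⟩)⟩
    · exact ⟨j + 1, unfoldDown_subset_unfoldUp j ⟨b, hj, .single ⟨hbc.2.1, hbc.1, h⟩⟩⟩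

/-- The index of the first up-set of the unfolding that contains `v`. -/
noncomputable def upLevel (r : V → V → Prop) (Q : Set V) (e v : V) : ℕ :=
  sInf {j | v ∈ unfoldUp r Q e j}

/-- The index of the first down-set of the unfolding that contains `v`. -/
noncomputable def downLevel (r : V → V → Prop) (Q : Set V) (e v : V) : ℕ :=
  sInf {j | v ∈ unfoldDown r Q e j}

theorem mem_unfoldUp_upLevel (h : ∃ j, v ∈ unfoldUp r Q e j) :
    v ∈ unfoldUp r Q e (upLevel r Q e v) := Nat.sInf_mem (s := {j | v ∈ unfoldUp r Q e j}) h

theorem mem_unfoldDown_downLevel (h : ∃ j, v ∈ unfoldUp r Q e j) :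
    v ∈ unfoldDown r Q e (downLevel r Q e v) :=
  Nat.sInf_mem (s := {j | v ∈ unfoldDown r Q e j}) (h.imp fun j hj => unfoldUp_subset_unfoldDown j hj)

theorem downLevel_le_upLevel (h : ∃ j, v ∈ unfoldUp r Q e j)
    (huv : ReflTransGen (restrictTo r Q) u v) : downLevel r Q e u ≤ upLevel r Q e v :=
  Nat.sInf_le (s := {j | u ∈ unfoldDown r Q e j}) ⟨v, mem_unfoldUp_upLevel h, huv⟩

/-- With the previous inequality, `u ≤ v` inside `Q` forces the up-level of `v` to be the down-level
of `u` or one more. This makes the levels monotone along alternation. -/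
theorem upLevel_le_downLevel_succ (h : ∃ j, u ∈ unfoldUp r Q e j)
    (huv : ReflTransGen (restrictTo r Q) u v) : upLevel r Q e v ≤ downLevel r Q e u + 1 :=
  Nat.sInf_le (s := {j | v ∈ unfoldUp r Q e j}) ⟨u, huv, mem_unfoldDown_downLevel h⟩

variable [Finite V] {k M : ℕ}
    (hM : ∀ (V' : Type u) [Finite V'] (r' : V' → V' → Prop) (J' : Set (V' × V')),
      Exposed (k + 1) r' J' → AltColorable (ReflTransGen r') J' M)
    {G : SimpleGraph V} {D : PlanarDrawing G} (hr : ∀ u v, G.Adj u v ↔ r u v ∨ r v u)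
    {rk : V → ℤ} (hrk : ∀ u v, r u v → rk u < rk v) (hQ : D.IsOuterplanarOn k Q)

include hM hr hrk hQ

/-- If p alternates to q, the down-level of q.1 is less than the up-level of q.2, which is at most
one more than the down-level of p.1. So the down-level is nonincreasing, hence constant on cycles,
say `j`. The `j`-th up-set then serves as `X`: it misses each second entry by hypothesis, and each
first entry because that lies below some second entry. -/
theorem altColorable_of_downLevel_lt (hM0 : 0 < M) (he : e ∈ D.exteriorVertices Q)
    {J : Set (V × V)} (hinc : ∀ p ∈ J, ¬ ReflTransGen r p.1 p.2 ∧ ¬ ReflTransGen r p.2 p.1)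
    (hJQ : ∀ p ∈ J, p.1 ∈ Q ∧ p.2 ∈ Q)
    (hJe : ∀ p ∈ J, (inside G Q).Reachable p.1 e ∧ (inside G Q).Reachable p.2 e)
    (hJb : ∀ p ∈ J, ∃ w ∈ D.exteriorVertices Q, ReflTransGen (restrictTo r Q) w p.2)
    (hle : ∀ p ∈ J, ∀ q ∈ J, ReflTransGen r p.1 q.2 → ReflTransGen (restrictTo r Q) p.1 q.2)
    (hlev : ∀ p ∈ J, downLevel r Q e p.1 < upLevel r Q e p.2) :
    AltColorable (ReflTransGen r) J M := by
  have hex : ∀ p ∈ J, (∃ j, p.1 ∈ unfoldUp r Q e j) ∧ ∃ j, p.2 ∈ unfoldUp r Q e j := fun p hp =>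
    ⟨exists_mem_unfoldUp (fun u v h => (hr u v).1 h) (hJe p hp).1,
      exists_mem_unfoldUp (fun u v h => (hr u v).1 h) (hJe p hp).2⟩
  refine AltColorable.of_fibres (fun p => OrderDual.toDual (downLevel r Q e p.1))
    (fun p hp q hq h => ?_) fun t => AltColorable.of_inner hM0 ?_
  · have h1 := upLevel_le_downLevel_succ (hex p hp).1 (hle p hp q hq h)
    have h2 := hlev q hq
    show downLevel r Q e q.1 ≤ downLevel r Q e p.1
    omega
  · set j : ℕ := OrderDual.ofDual t with hj
    have hfib : ∀ p : V × V, OrderDual.toDual (downLevel r Q e p.1) = t → downLevel r Q e p.1 = j :=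
      fun p h => congrArg OrderDual.ofDual h
    have hb : ∀ p ∈ J, downLevel r Q e p.1 = j → p.2 ∉ unfoldUp r Q e j := fun p hp hpj =>
      Nat.notMem_of_lt_sInf (s := {j | p.2 ∈ unfoldUp r Q e j}) (hpj ▸ hlev p hp)
    refine altColorable_of_upset hM (fun u v h => (hr u v).2 (Or.inl h)) rk hrk hQ he
      (X := unfoldUp r Q e j) (fun v hv => mem_of_mem_unfoldUp he.1 hv) (mem_unfoldUp_self j)
      (fun u hu => reachable_unfoldUp (fun u v h => (hr u v).2 (Or.inl h)) hu)
      (fun u hu v hv huv => unfoldUp_of_le hu (.single ⟨mem_of_mem_unfoldUp he.1 hu, hv, huv⟩))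
      (fun p hp => hinc p hp.1.1) ?_ ?_ ?_ (fun p hp => hJb p hp.1.1)
      fun p hp q hq => hle p hp.1.1 q hq.1.1
    · rintro p ⟨⟨hp, hpj⟩, -, q, ⟨hq, hqj⟩, hpq⟩
      exact ⟨(hJQ p hp).1, fun hpX => hb q hq (hfib q hqj) (unfoldUp_of_le hpX (hle p hp q hq hpq))⟩
    · rintro p ⟨⟨hp, hpj⟩, -⟩
      exact ⟨(hJQ p hp).2, hb p hp (hfib p hpj)⟩
    · rintro p ⟨⟨hp, hpj⟩, -⟩
      have := mem_unfoldDown_downLevel (hex p hp).1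
      rwa [hfib p hpj] at this

/-- Here the down-level of first entries is nondecreasing along alternation, so it has a constant
value `j` on cycles, and the up-level of second entries equals `j` too. The argument is dual: the
down-set preceding the `j`-th up-set plays the role of `X` in the reversed order. -/
theorem altColorable_of_upLevel_le (hM0 : 0 < M) (he : e ∈ D.exteriorVertices Q)
    {J : Set (V × V)} (hinc : ∀ p ∈ J, ¬ ReflTransGen r p.1 p.2 ∧ ¬ ReflTransGen r p.2 p.1)
    (hJQ : ∀ p ∈ J, p.1 ∈ Q ∧ p.2 ∈ Q)
    (hJe : ∀ p ∈ J, (inside G Q).Reachable p.1 e ∧ (inside G Q).Reachable p.2 e)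
    (hJa : ∀ p ∈ J, ∃ w ∈ D.exteriorVertices Q, ReflTransGen (restrictTo r Q) p.1 w)
    (hle : ∀ p ∈ J, ∀ q ∈ J, ReflTransGen r p.1 q.2 → ReflTransGen (restrictTo r Q) p.1 q.2)
    (hlev : ∀ p ∈ J, upLevel r Q e p.2 ≤ downLevel r Q e p.1) :
    AltColorable (ReflTransGen r) J M := by
  have hex : ∀ p ∈ J, (∃ j, p.1 ∈ unfoldUp r Q e j) ∧ ∃ j, p.2 ∈ unfoldUp r Q e j := fun p hp =>
    ⟨exists_mem_unfoldUp (fun u v h => (hr u v).1 h) (hJe p hp).1,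
      exists_mem_unfoldUp (fun u v h => (hr u v).1 h) (hJe p hp).2⟩
  have hr' : ∀ u v, r u v → G.Adj u v := fun u v h => (hr u v).2 (Or.inl h)
  refine AltColorable.of_fibres (fun p => downLevel r Q e p.1)
    (fun p hp q hq h => ?_) fun j => AltColorable.of_inner hM0 ?_
  · exact (downLevel_le_upLevel (hex q hq).2 (hle p hp q hq h)).trans (hlev q hq)
  · set F := {p | p ∈ {p | p ∈ J ∧ downLevel r Q e p.1 = j} ∧
      (∃ q ∈ {p | p ∈ J ∧ downLevel r Q e p.1 = j}, ReflTransGen r q.1 p.2) ∧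
        ∃ q ∈ {p | p ∈ J ∧ downLevel r Q e p.1 = j}, ReflTransGen r p.1 q.2} with hF
    obtain ⟨Y, hYQ, heY, hYe, hYdown, hYa, hYb⟩ : ∃ Y : Set V, Y ⊆ Q ∧ e ∈ Y ∧
        (∀ u ∈ Y, (inside G Y).Reachable u e) ∧
        (∀ u ∈ Y, ∀ v, ReflTransGen (restrictTo r Q) v u → v ∈ Y) ∧
        (∀ p ∈ J, downLevel r Q e p.1 = j → p.1 ∉ Y) ∧
        ∀ p ∈ F, ∃ y ∈ Y, ReflTransGen (restrictTo r Q) y p.2 := by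
      have hup : ∀ p ∈ F, p.2 ∈ unfoldUp r Q e j := by
        rintro p ⟨⟨hp, hpj⟩, ⟨q, ⟨hq, hqj⟩, hqp⟩, -⟩
        have h1 := downLevel_le_upLevel (hex p hp).2 (hle q hq p hp hqp)
        have h2 := hlev p hp
        have h3 : upLevel r Q e p.2 = j := by omega
        exact h3 ▸ mem_unfoldUp_upLevel (hex p hp).2
      cases j with
      | zero =>
        -- No down-set of the unfolding precedes level 0, so the down-set of `e` itself is used. A
        -- first entry in it would lie below `e`, hence below its own second entry.
        refine ⟨{v | ReflTransGen (restrictTo r Q) v e},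
          fun v hv => (mem_iff_of_restrictTo hv).2 he.1, .refl,
          fun u hu => reachable_inside_of_le hr' hu fun y _ hy => hy,
          fun u hu v hvu => hvu.trans hu, fun p hp hpj hpY => ?_, fun p hp => ⟨e, .refl, hup p hp⟩⟩
        have h1 := hlev p hp
        rw [hpj, Nat.le_zero] at h1
        have h2 := mem_unfoldUp_upLevel (hex p hp).2
        rw [h1] at h2
        exact (hinc p hp).1 (reflTransGen_of_restrictTo (ReflTransGen.trans hpY h2))
      | succ i =>
        refine ⟨unfoldDown r Q e i, fun v hv => mem_of_mem_unfoldDown he.1 hv,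
          unfoldUp_subset_unfoldDown i (mem_unfoldUp_self i),
          fun u hu => reachable_unfoldDown hr' hu, fun u hu v hvu => unfoldDown_of_le hu hvu,
          fun p hp hpj => ?_, fun p hp => ?_⟩
        · exact Nat.notMem_of_lt_sInf (s := {j | p.1 ∈ unfoldDown r Q e j}) (by
            show i < downLevel r Q e p.1
            omega)
        · obtain ⟨w, hw, hx⟩ := hup p hp
          exact ⟨w, hx, hw⟩
    have := altColorable_of_upset hM (r := flip r) (J := Prod.swap ⁻¹' F)
      (fun u v h => (hr u v).2 (Or.inr h)) (fun v => - rk v)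
      (fun u v h => neg_lt_neg (hrk v u h)) hQ he hYQ heY hYe
      (fun u hu v hv huv => hYdown u hu v (.single ⟨hv, hYQ hu, huv⟩))
      (fun p hp => by
        rw [reflTransGen_flip]
        exact hinc p.swap hp.1.1)
      (fun p hp => ?_) (fun p hp => ⟨(hJQ p.swap hp.1.1).1, hYa p.swap hp.1.1 hp.1.2⟩)
      (fun p hp => by
        rw [reflTransGen_restrictTo_flip]
        exact hYb p.swap hp)
      (fun p hp => by
        rw [reflTransGen_restrictTo_flip]
        exact hJa p.swap hp.1.1)
      (fun p hp q hq h => by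
        rw [reflTransGen_restrictTo_flip]
        rw [reflTransGen_flip] at h
        exact hle q.swap hq.1.1 p.swap hp.1.1 h)
    · have := this.swap
      rwa [reflTransGen_flip] at this
    · refine ⟨(hJQ p.swap hp.1.1).2, fun hpY => ?_⟩
      obtain ⟨⟨hpJ, hpj⟩, ⟨q, ⟨hq, hqj⟩, hqp⟩, -⟩ := hp
      exact hYa q hq hqj (hYdown _ hpY _ (hle q hq _ hpJ hqp))

/-- The two colour blocks treat two kinds of pairs, split first by the order of the component
numbers of their entries and, in case of a tie, by the levels. Alternation links entries of the same
component, so the component number is monotone on each kind and every component can reuse the same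
colours. -/
theorem altColorable_of_exterior (hM0 : 0 < M) {J : Set (V × V)}
    (hinc : ∀ p ∈ J, ¬ ReflTransGen r p.1 p.2 ∧ ¬ ReflTransGen r p.2 p.1)
    (hJQ : ∀ p ∈ J, ∀ v, ReflTransGen r p.1 v → v ∈ Q)
    (hJa : ∀ p ∈ J, ∃ w ∈ D.exteriorVertices Q, ReflTransGen r p.1 w)
    (hJb : ∀ p ∈ J, p.2 ∈ Q → ∃ w ∈ D.exteriorVertices Q, ReflTransGen (restrictTo r Q) w p.2) :
    AltColorable (ReflTransGen r) J (M + M) := by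
  classical
  have hr' : ∀ u v, r u v → G.Adj u v := fun u v h => (hr u v).2 (Or.inl h)
  rcases isEmpty_or_nonempty V with hemp | hne
  · exact altColorable_of_forall_notMem fun p _ => hemp.elim p.1
  refine AltColorable.of_inner (by omega) ?_
  set J₀ := {p | p ∈ J ∧ (∃ q ∈ J, ReflTransGen r q.1 p.2) ∧ ∃ q ∈ J, ReflTransGen r p.1 q.2}
  have hle : ∀ p ∈ J, ∀ v, ReflTransGen r p.1 v → ReflTransGen (restrictTo r Q) p.1 v := by
    intro p hp v h
    induction h with
    | refl => exact .refl
    | @tail b c hb hbc ih => exact ih.tail ⟨hJQ p hp b hb, hJQ p hp c (hb.tail hbc), hbc⟩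
  have hmem : ∀ p ∈ J₀, p.1 ∈ Q ∧ p.2 ∈ Q := by
    rintro p ⟨hp, ⟨q, hq, hqp⟩, -⟩
    exact ⟨hJQ p hp _ .refl, hJQ q hq _ hqp⟩
  have hreach : ∀ {u v}, ReflTransGen (restrictTo r Q) u v → (inside G Q).Reachable u v :=
    fun {u v} h => by
      induction h with
      | refl => exact .refl _
      | tail _ h ih => exact ih.trans (SimpleGraph.Adj.reachable ⟨h.1, h.2.1, hr' _ _ h.2.2⟩)
  have hreachJ : ∀ p ∈ J₀, (∃ w ∈ D.exteriorVertices Q, (inside G Q).Reachable p.1 w) ∧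
      ∃ w ∈ D.exteriorVertices Q, (inside G Q).Reachable p.2 w := by
    intro p hp
    obtain ⟨w, hw, hpw⟩ := hJa p hp.1
    obtain ⟨w', hw', hpw'⟩ := hJb p hp.1 (hmem p hp).2
    exact ⟨⟨w, hw, hreach (hle p hp.1 w hpw)⟩, w', hw', (hreach hpw').symm⟩
  obtain ⟨n, ⟨f⟩⟩ := Finite.exists_equiv_fin (inside G Q).ConnectedComponent
  set κ : V → ℕ := fun v => f ((inside G Q).connectedComponentMk v) with hκ
  have hκiff : ∀ u v, κ u = κ v ↔ (inside G Q).Reachable u v := fun u v => by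
    rw [← SimpleGraph.ConnectedComponent.eq]
    exact ⟨fun h => f.injective (Fin.ext h), fun h => by simp only [hκ, h]⟩
  -- There must be one root per component, common to both entries of all its pairs. A component
  -- without exterior vertex contains no entry of a relevant pair and gets a dummy root.
  have hroot : ∀ t : ℕ, ∃ e : V, ∀ v, κ v = t →
      (∃ w ∈ D.exteriorVertices Q, (inside G Q).Reachable v w) →
        e ∈ D.exteriorVertices Q ∧ (inside G Q).Reachable v e := by
    intro t
    by_cases h : ∃ v, κ v = t ∧ ∃ w ∈ D.exteriorVertices Q, (inside G Q).Reachable v w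
    · obtain ⟨v, hv, w, hw, hvw⟩ := h
      exact ⟨w, fun v' hv' _ => ⟨hw, ((hκiff v' v).1 (hv'.trans hv.symm)).trans hvw⟩⟩
    · exact ⟨hne.some, fun v hv hw => (h ⟨v, hv, hw⟩).elim⟩
  choose e he using hroot
  have hκle : ∀ p ∈ J₀, ∀ q ∈ J₀, ReflTransGen r p.1 q.2 → κ p.1 = κ q.2 := fun p hp q _ h =>
    (hκiff _ _).2 (hreach (hle p hp.1 _ h))
  set A := {p | p ∈ J₀ ∧ (κ p.1 < κ p.2 ∨ κ p.1 = κ p.2 ∧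
    downLevel r Q (e (κ p.1)) p.1 < upLevel r Q (e (κ p.1)) p.2)} with hA
  set B := {p | p ∈ J₀ ∧ (κ p.2 < κ p.1 ∨ κ p.1 = κ p.2 ∧
    upLevel r Q (e (κ p.1)) p.2 ≤ downLevel r Q (e (κ p.1)) p.1)} with hB
  have hAB : J₀ ⊆ A ∪ B := by
    intro p hp
    rcases lt_trichotomy (κ p.1) (κ p.2) with h | h | h
    · exact Or.inl ⟨hp, Or.inl h⟩
    · rcases lt_or_ge (downLevel r Q (e (κ p.1)) p.1) (upLevel r Q (e (κ p.1)) p.2) with h' | h'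
      · exact Or.inl ⟨hp, Or.inr ⟨h, h'⟩⟩
      · exact Or.inr ⟨hp, Or.inr ⟨h, h'⟩⟩
    · exact Or.inr ⟨hp, Or.inl h⟩
  -- A predecessor in the same fibre forces the second entry into component `t` as well, so pairs
  -- across two components drop out.
  have hcomp : ∀ S ⊆ J₀, ∀ t : ℕ, ∀ p ∈ {p | p ∈ {p | p ∈ S ∧ κ p.1 = t} ∧
      (∃ q ∈ {p | p ∈ S ∧ κ p.1 = t}, ReflTransGen r q.1 p.2) ∧
        ∃ q ∈ {p | p ∈ S ∧ κ p.1 = t}, ReflTransGen r p.1 q.2},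
      p ∈ J₀ ∧ p ∈ S ∧ κ p.1 = t ∧ κ p.2 = t ∧ e t ∈ D.exteriorVertices Q ∧
        (inside G Q).Reachable p.1 (e t) ∧ (inside G Q).Reachable p.2 (e t) := by
    rintro S hS t p ⟨⟨hp, hpt⟩, ⟨q, ⟨hq, hqt⟩, hqp⟩, -⟩
    have hp2 : κ p.2 = t := (hκle q (hS hq) p (hS hp) hqp).symm.trans hqt
    have h1 := he t p.1 hpt (hreachJ p (hS hp)).1
    exact ⟨hS hp, hp, hpt, hp2, h1.1, h1.2, (he t p.2 hp2 (hreachJ p (hS hp)).2).2⟩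
  refine AltColorable.mono (AltColorable.union (J := A) (J' := B) ?_ ?_) hAB
  · refine AltColorable.of_fibres (fun p => OrderDual.toDual (κ p.1)) (fun p hp q hq h => ?_)
      fun t => AltColorable.of_inner hM0 ?_
    · have h1 := hκle p hp.1 q hq.1 h
      show κ q.1 ≤ κ p.1
      rcases hq.2 with h | h
      · omega
      · omega
    · have hall := hcomp A (fun p hp => hp.1) (OrderDual.ofDual t)
      by_cases hne : ∃ p, p ∈ {p | p ∈ {p | p ∈ A ∧ κ p.1 = OrderDual.ofDual t} ∧
        (∃ q ∈ {p | p ∈ A ∧ κ p.1 = OrderDual.ofDual t}, ReflTransGen r q.1 p.2) ∧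
          ∃ q ∈ {p | p ∈ A ∧ κ p.1 = OrderDual.ofDual t}, ReflTransGen r p.1 q.2}
      · obtain ⟨p₀, hp₀⟩ := hne
        refine altColorable_of_downLevel_lt hM hr hrk hQ hM0 (hall p₀ hp₀).2.2.2.2.1
          (fun p hp => hinc p (hall p hp).1.1) (fun p hp => hmem p (hall p hp).1)
          (fun p hp => (hall p hp).2.2.2.2.2)
          (fun p hp => hJb p (hall p hp).1.1 (hmem p (hall p hp).1).2)
          (fun p hp q _ => hle p (hall p hp).1.1 _) fun p hp => ?_
        obtain ⟨-, hpA, h1, h2, -⟩ := hall p hp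
        rcases hpA.2 with h | h
        · omega
        · rw [← h1]; exact h.2
      · exact altColorable_of_forall_notMem fun p hp => hne ⟨p, hp⟩
  · refine AltColorable.of_fibres (fun p => κ p.1) (fun p hp q hq h => ?_)
      fun t => AltColorable.of_inner hM0 ?_
    · have h1 := hκle p hp.1 q hq.1 h
      rcases hq.2 with h | h
      · omega
      · omega
    · have hall := hcomp B (fun p hp => hp.1) t
      by_cases hne : ∃ p, p ∈ {p | p ∈ {p | p ∈ B ∧ κ p.1 = t} ∧
        (∃ q ∈ {p | p ∈ B ∧ κ p.1 = t}, ReflTransGen r q.1 p.2) ∧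
          ∃ q ∈ {p | p ∈ B ∧ κ p.1 = t}, ReflTransGen r p.1 q.2}
      · obtain ⟨p₀, hp₀⟩ := hne
        refine altColorable_of_upLevel_le hM hr hrk hQ hM0 (hall p₀ hp₀).2.2.2.2.1
          (fun p hp => hinc p (hall p hp).1.1) (fun p hp => hmem p (hall p hp).1)
          (fun p hp => (hall p hp).2.2.2.2.2) (fun p hp => ?_)
          (fun p hp q _ => hle p (hall p hp).1.1 _) fun p hp => ?_
        · obtain ⟨w, hw, hpw⟩ := hJa p (hall p hp).1.1
          exact ⟨w, hw, hle p (hall p hp).1.1 w hpw⟩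
        · obtain ⟨-, hpB, h1, h2, -⟩ := hall p hp
          rcases hpB.2 with h | h
          · omega
          · rw [← h1]; exact h.2
      · exact altColorable_of_forall_notMem fun p hp => hne ⟨p, hp⟩

end Unfolding

/-! ### Splitting the pairs by layers -/

section Layers

variable {V : Type u} {G : SimpleGraph V} (D : PlanarDrawing G)

/-- The vertices left after removing `n` times the vertices on the exterior face. -/
def PlanarDrawing.peel : ℕ → Set V
  | 0 => Set.univ
  | n + 1 => PlanarDrawing.peel n \ D.exteriorVertices (PlanarDrawing.peel n)

variable {D}

theorem PlanarDrawing.peel_anti {m n : ℕ} (h : m ≤ n) : D.peel n ⊆ D.peel m := by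
  induction n, h using Nat.le_induction with
  | base => exact le_rfl
  | succ n _ ih => exact Set.sdiff_subset.trans ih

theorem PlanarDrawing.IsOuterplanar.peel {k : ℕ} (h : D.IsOuterplanar k) :
    ∀ {n m : ℕ}, m + n = k → D.IsOuterplanarOn m (D.peel n)
  | 0, m, hm => by
    rw [add_zero] at hm
    exact hm ▸ h
  | n + 1, m, hm => PlanarDrawing.IsOuterplanar.peel h (n := n) (m := m + 1) (by omega)

theorem PlanarDrawing.IsOuterplanar.peel_eq_empty {k : ℕ} (h : D.IsOuterplanar k) :
    D.peel k = ∅ := h.peel (zero_add k)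

/-- A vertex of a layer that is adjacent to a vertex of an earlier layer is on the exterior face of
its layer. -/
theorem PlanarDrawing.mem_exteriorVertices_peel [Finite V] {n : ℕ} {u v : V} (huv : G.Adj u v)
    (hu : u ∉ D.peel n) (hv : v ∈ D.peel n) : v ∈ D.exteriorVertices (D.peel n) := by
  have hex : ∃ m, m < n ∧ u ∈ D.exteriorVertices (D.peel m) := by
    clear hv
    induction n with
    | zero => exact (hu (Set.mem_univ u)).elim
    | succ n ih =>
      by_cases hun : u ∈ D.peel n
      · exact ⟨n, Nat.lt_succ_self n, by_contra fun h => hu ⟨hun, h⟩⟩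
      · obtain ⟨m, hm, h⟩ := ih hun
        exact ⟨m, hm.trans (Nat.lt_succ_self n), h⟩
  obtain ⟨m, hmn, hum⟩ := hex
  have hvm : v ∈ D.peel (m + 1) := PlanarDrawing.peel_anti hmn hv
  have hve : v ∈ D.exteriorVertices (D.peel (m + 1)) :=
    PlanarDrawing.mem_exteriorVertices_diff huv hum hvm.1 hvm.2
  -- If `u` was peeled before the last round, then `v` would have been exposed and peeled before
  -- stage `n`.
  rcases (Nat.succ_le_of_lt hmn).eq_or_lt with rfl | h
  · exact hve
  · exact ((PlanarDrawing.peel_anti h hv).2 hve).elim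

variable [Finite V] {r : V → V → Prop} {k M : ℕ}

/-- The index of the outermost layer met by the up-set of `a`. -/
noncomputable def upLayer (D : PlanarDrawing G) (r : V → V → Prop) (a : V) : ℕ :=
  sInf {n | ∃ v, ReflTransGen r a v ∧ v ∉ D.peel (n + 1)}

omit [Finite V] in
-- Being outside `peel (n + 1)` means lying in layer `n` or further out. The index `k - 1` always
-- qualifies because `peel k` is empty, so the infimum is attained.
theorem upLayer_spec (hD : D.IsOuterplanar k) (hk : 1 ≤ k) (a : V) :
    upLayer D r a < k ∧ (∀ v, ReflTransGen r a v → v ∈ D.peel (upLayer D r a)) ∧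
      ∃ v ∈ D.exteriorVertices (D.peel (upLayer D r a)), ReflTransGen r a v := by
  have hne : k - 1 ∈ {n | ∃ v, ReflTransGen r a v ∧ v ∉ D.peel (n + 1)} := by
    refine ⟨a, .refl, ?_⟩
    rw [Nat.sub_add_cancel hk, hD.peel_eq_empty]
    exact Set.notMem_empty a
  have hall : ∀ v, ReflTransGen r a v → v ∈ D.peel (upLayer D r a) := by
    intro v hv
    rcases hn : upLayer D r a with _ | n
    · exact Set.mem_univ v
    · by_contra h
      have : upLayer D r a ≤ n := Nat.sInf_le (s := {n | ∃ v, ReflTransGen r a v ∧ v ∉ D.peel (n + 1)})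
        ⟨v, hv, h⟩
      omega
  obtain ⟨v, hv, hvn⟩ : upLayer D r a ∈ {n | ∃ v, ReflTransGen r a v ∧ v ∉ D.peel (n + 1)} :=
    Nat.sInf_mem ⟨_, hne⟩
  refine ⟨(Nat.sInf_le hne).trans_lt (by omega), hall, v, ?_, hv⟩
  by_contra h
  exact hvn ⟨hall v hv, h⟩

/-- Each of the `k` possible layers gets its own colours. If the layer is `n`, the set left after
`n` rounds contains the up-set of the first entry and satisfies the hypotheses of
`altColorable_of_exterior`. -/
theorem altColorable_of_upLayer
    (hM : ∀ (V' : Type u) [Finite V'] (r' : V' → V' → Prop) (J' : Set (V' × V')),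
      Exposed (k + 1) r' J' → AltColorable (ReflTransGen r') J' M) (hM0 : 0 < M)
    (hr : ∀ u v, G.Adj u v ↔ r u v ∨ r v u) {rk : V → ℤ} (hrk : ∀ u v, r u v → rk u < rk v)
    (hk : 1 ≤ k) (hD : D.IsOuterplanar k) {J : Set (V × V)}
    (hinc : ∀ p ∈ J, ¬ ReflTransGen r p.1 p.2 ∧ ¬ ReflTransGen r p.2 p.1)
    (hJ : ∀ p ∈ J, upLayer D (flip r) p.2 ≤ upLayer D r p.1) :
    AltColorable (ReflTransGen r) J (k * (M + M)) := by
  refine (AltColorable.iUnion (fun n => {p | p ∈ J ∧ upLayer D r p.1 = n}) k fun n hn => ?_).mono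
    fun p hp => Set.mem_iUnion₂.2 ⟨upLayer D r p.1, (upLayer_spec hD hk p.1).1, hp, rfl⟩
  have hQ : D.IsOuterplanarOn k (D.peel n) := (hD.peel (Nat.sub_add_cancel hn.le)).mono (Nat.sub_le _ _)
  refine altColorable_of_exterior hM hr hrk hQ hM0 (fun p hp => hinc p hp.1) ?_ ?_ ?_
  · rintro p ⟨-, rfl⟩
    exact (upLayer_spec hD hk p.1).2.1
  · rintro p ⟨-, rfl⟩
    exact (upLayer_spec hD hk p.1).2.2
  · rintro p ⟨hp, hpn⟩ hpQ
    obtain ⟨-, -, u, hu, hup⟩ := upLayer_spec (r := flip r) hD hk p.2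
    rw [reflTransGen_flip] at hup
    have hun : u ∉ D.peel (n + 1) := fun h =>
      (PlanarDrawing.peel_anti (Nat.succ_le_succ (hpn ▸ hJ p hp)) h).2 hu
    -- Follow a chain from `u`, in layer `n` or further out, up to the second entry. The vertex at
    -- which it last enters `Q`, or `u` itself if the chain never leaves `Q`, is exterior in `Q`.
    have key : ∀ b, ReflTransGen r u b → b ∈ D.peel n →
        ∃ w ∈ D.exteriorVertices (D.peel n), ReflTransGen (restrictTo r (D.peel n)) w b := by
      intro b hb
      induction hb with
      | refl => exact fun h => ⟨u, by_contra fun h' => hun ⟨h, h'⟩, .refl⟩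
      | @tail b c _ hbc ih =>
        intro hc
        by_cases hbQ : b ∈ D.peel n
        · obtain ⟨w, hw, hwb⟩ := ih hbQ
          exact ⟨w, hw, hwb.tail ⟨hbQ, hc, hbc⟩⟩
        · exact ⟨c, PlanarDrawing.mem_exteriorVertices_peel ((hr b c).2 (Or.inl hbc)) hbQ hc, .refl⟩
    exact key p.2 hup hpQ

/-- The factor 4 is 2 for the comparison of layers, whose second case is the dual of the first,
times 2 for the comparison of unfolding levels. -/
theorem altColorable_of_isOuterplanar
    (hM : ∀ (V' : Type u) [Finite V'] (r' : V' → V' → Prop) (J' : Set (V' × V')),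
      Exposed (k + 1) r' J' → AltColorable (ReflTransGen r') J' M) (hM0 : 0 < M)
    (hr : ∀ u v, G.Adj u v ↔ r u v ∨ r v u) {rk : V → ℤ} (hrk : ∀ u v, r u v → rk u < rk v)
    (hk : 1 ≤ k) (hD : D.IsOuterplanar k) {J : Set (V × V)}
    (hinc : ∀ p ∈ J, ¬ ReflTransGen r p.1 p.2 ∧ ¬ ReflTransGen r p.2 p.1) :
    AltColorable (ReflTransGen r) J (4 * k * M) := by
  have h1 := altColorable_of_upLayer hM hM0 hr hrk hk hD
    (J := {p | p ∈ J ∧ upLayer D (flip r) p.2 ≤ upLayer D r p.1}) (fun p hp => hinc p hp.1)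
    fun p hp => hp.2
  have h2 := altColorable_of_upLayer (r := flip r) (rk := fun v => - rk v) hM hM0
    (fun u v => (hr u v).trans or_comm) (fun u v h => neg_lt_neg (hrk v u h)) hk hD
    (J := Prod.swap ⁻¹' {p | p ∈ J ∧ upLayer D r p.1 ≤ upLayer D (flip r) p.2})
    (fun p hp => by
      rw [reflTransGen_flip]
      exact hinc p.swap hp.1) fun p hp => hp.2
  have h3 := h2.swap
  rw [reflTransGen_flip] at h3
  have h4 := h1.union h3
  rw [show 4 * k * M = k * (M + M) + k * (M + M) by ring]
  refine h4.mono fun p hp => ?_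
  rcases le_total (upLayer D (flip r) p.2) (upLayer D r p.1) with h | h
  · exact Or.inl ⟨hp, h⟩
  · exact Or.inr ⟨hp, h⟩

end Layers

/-! ### Conclusion -/

/-- A pair of elements of an antichain is doubly exposed. -/
theorem exists_doublyExposed_antichain (k : ℕ) {α : Type u} [Finite α] {f : α → ℂ}
    (hf : Function.Injective f) {a b : α} (hab : a ≠ b) :
    ∃ (P' : Type u) (_ : PartialOrder P') (_ : Finite P') (I : Set (P' × P')),
      IsKOuterplanar (k + 1) (SimpleGraph.hasse P') ∧ I ⊆ PosetDim.MinMaxPairs P' ∧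
      IsDoublyExposed I ∧ I.Nonempty := by
  let _ : PartialOrder α :=
    { le := Eq
      le_refl := fun _ => rfl
      le_trans := fun _ _ _ => Eq.trans
      le_antisymm := fun _ _ h _ => h }
  have hG : ∀ u v, ¬ (SimpleGraph.hasse α).Adj u v := fun u v h =>
    h.elim (fun h => h.1.ne h.1.le) fun h => h.1.ne h.1.le
  let D : PlanarDrawing (SimpleGraph.hasse α) :=
    { pt := f
      arc := fun _ => ∅
      pt_injective := hf
      isArc := fun u v h => (hG u v h).elim
      mem_of_pt_mem_arc := fun _ _ _ h => h.elim
      arc_inter_arc := fun _ _ _ _ _ _ h => h.1.elim }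
  have hext : D.exteriorVertices Set.univ = Set.univ :=
    PlanarDrawing.exteriorVertices_eq_univ_of_isEmpty hG
  have hmem : ∀ v, v ∈ D.exteriorVertices Set.univ := fun v => by rw [hext]; exact Set.mem_univ v
  have hinc : (a, b) ∈ PosetDim.Inc α := ⟨fun h => hab h, fun h => hab h.symm⟩
  refine ⟨α, inferInstance, inferInstance, {(a, b)}, ⟨D, ?_⟩, ?_, ⟨?_, D, b, a, hmem b, hmem a, ?_⟩,
    Set.singleton_nonempty _⟩
  · rw [PlanarDrawing.IsOuterplanar, PlanarDrawing.IsOuterplanarOn, hext, Set.sdiff_self]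
    exact PlanarDrawing.isOuterplanarOn_empty k
  · rintro _ rfl
    exact ⟨hinc, fun _ h => h.symm.le, fun _ h => h.symm.le⟩
  · rintro _ rfl
    exact hinc
  · rintro _ rfl
    exact ⟨le_rfl, le_rfl⟩

theorem lemma3p1 (k : ℕ) (hk : 1 ≤ k) (P : Type u) [PartialOrder P] [Finite P]
    (hP : IsKOuterplanar k (SimpleGraph.hasse P)) (hdim : 3 ≤ PosetDim.dim P) :
    ∃ (P' : Type u) (_ : PartialOrder P') (_ : Finite P') (I : Set (P' × P')),
      IsKOuterplanar (k + 1) (SimpleGraph.hasse P') ∧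
      I ⊆ PosetDim.MinMaxPairs P' ∧
      IsDoublyExposed I ∧
      PosetDim.dim P ≤ 4 * k * PosetDim.dimOf I := by
  classical
  by_contra! hno
  obtain ⟨D, hD⟩ := hP
  -- If the claim fails, 4k times the dimension of every admissible set is at most `dim P - 1`, so
  -- this quotient is a uniform bound.
  set M := (PosetDim.dim P - 1) / (4 * k) with hMdef
  have hM : ∀ (P' : Type u) [PartialOrder P'] [Finite P'] (I : Set (P' × P')),
      IsKOuterplanar (k + 1) (SimpleGraph.hasse P') → I ⊆ PosetDim.MinMaxPairs P' →
        IsDoublyExposed I → PosetDim.dimOf I ≤ M := by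
    intro P' _ _ I h1 h2 h3
    have := hno P' _ ‹_› I h1 h2 h3
    rw [hMdef, Nat.le_div_iff_mul_le (by omega), mul_comm]
    omega
  -- At least one colour is needed to discard pairs that lie on no cycle. A two-element antichain
  -- already has a nonempty doubly exposed set.
  have hM0 : 0 < M := by
    obtain ⟨P', _, _, I, h1, h2, h3, hne⟩ := exists_doublyExposed_antichain.{u} k
      (f := fun b : ULift.{u} Bool => if b.down then 1 else 0)
      (by rintro ⟨_ | _⟩ ⟨_ | _⟩ h <;> simp_all) (a := ⟨true⟩) (b := ⟨false⟩) (by simp)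
    exact (PosetDim.dimOf_pos h3.1 hne).trans_le (hM P' I h1 h2 h3)
  have hle : ReflTransGen ((· ⋖ ·) : P → P → Prop) = (· ≤ ·) := by
    have := Fintype.ofFinite P
    let _ : LocallyFiniteOrder P := Fintype.toLocallyFiniteOrder
    ext u v
    exact le_iff_reflTransGen_covBy.symm
  have hcol := altColorable_of_isOuterplanar (r := ((· ⋖ ·) : P → P → Prop)) (J := PosetDim.Inc P)
    -- The size of the principal down-set increases strictly along covers.
    (rk := fun v => ((Set.Iic v).ncard : ℤ))
    (fun V' _ r' J' h => h.altColorable hM) hM0 (fun u v => Iff.rfl)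
    (fun u v h => by
      have := Set.ncard_lt_ncard (Set.Iic_ssubset_Iic.2 h.1) (Set.toFinite _)
      exact_mod_cast this)
    hk hD (by rw [hle]; exact fun p hp => hp)
  rw [hle] at hcol
  have h1 := PosetDim.dim_le_of_altColorable (by positivity) hcol
  have h2 : 4 * k * M ≤ PosetDim.dim P - 1 := Nat.mul_div_le _ _
  omega
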